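/- **Setting.** Let $\mathcal S$ be a measurable state space and $\mathcal A$ a finite action space. For $k=1$ (source) and $k=2$ (target) let $P_k$ be a transition kernel from $\mathcal S\times\mathcal A$ to $\mathcal S$, $\gamma_k\in[0,1)$ a discount and $\pi_{k,\rm ref}$ a full-support reference policy; let $\tau_2>0$. Let $\pi_{b1}$ (source behavior policy) and $\mu$ (anchor policy) be policies, $\rho_1^{\mathcal S}$ a probability law on $\mathcal S$, $\rho_1(s,a)=\rho_1^{\mathcal S}(s)\pi_{b1}(a\mid s)$, $\rho_2$ a probability law on $\mathcal S\times\mathcal A$, $g:\mathcal S\to\mathbb R$ measurable and $C\in\mathbb R$. Write $(\pi f)(s)=(\Pi_\pi f)(s,a)=\sum_{a'}\pi(a'\mid s)f(s,a')$, $(P_k^\pi f)(s,a)=\mathbb E_{s'\sim P_k(\cdot\mid s,a)}[(\pi f)(s')]$, $\|f\|_\rho^2=\int f^2\,d\rho$, $d^{P_k}_{\pi,\rho}=(1-\gamma_k)\sum_{t\ge0}\gamma_k^t((P_k^\pi)^\top)^t\rho$, $\Omega(q)(s)=\tau_2\log\sum_a\pi_{2,\rm ref}(a\mid s)e^{q(s,a)/\tau_2}$,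 and $\pi_q(a\mid s)\propto\pi_{2,\rm ref}(a\mid s)e^{q(s,a)/\tau_2}$. Ratios such as $\|\rho_2/\rho_1\|_\infty$ and $\|\mu/\pi_{b1}\|_\infty$ are essential suprema (with respect to the measure in the denominator, respectively $\rho_1$). For a behavior policy $\pi$ let $u^\pi=\log(\pi/\pi_{1,\rm ref})-g$. Its *population transfer target* is the pair of bounded solutions of $$q_1=u^\pi+\gamma_1P_1^\mu q_1,\qquad q_2=(I-\Pi_\mu)q_1+g+C+\gamma_2P_2\Omega(q_2).$$ Let $(q_1^\star,q_2^\star)$ be the target for $\pi_{b1}$. **Data.** Mutually independent i.i.d. samples: $n_b\ge1$ demonstrations $(s^b_i,a^b_i)\sim\rho_1$, $n_1\ge1$ transitions $(s,a,s')\sim\rho_1\times P_1$, $n_2\ge1$ transitions $(s,a,s')\sim\rho_2\times P_2$; $\widehat{\mathbb E}_{n_k}$ is the empirical mean. Let $\Pi_{b1}$ be a finite class of policies with $\pi_{b1}\in\Pi_{b1}$ and $\pi(a\mid s)\ge\epsilon$ for all $\pi\in\Pi_{b1}$, $(s,a)$, where $\epsilon\in(0,1]$. Let $\widehat\pi_{b1}$,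 a function of the demonstrations, minimize $\frac1{n_b}\sum_i-\log\pi(a^b_i\mid s^b_i)$ over $\Pi_{b1}$. Put $\widehat u_g=u^{\widehat\pi_{b1}}$, let $(\widetilde q_1^\star,\widetilde q_2^\star)$ be the (random) target for $\widehat\pi_{b1}$, and $$\varepsilon_{\rm CE}(n_b,\delta)=2\log(1/\epsilon)\sqrt{2\log(|\Pi_{b1}|/\delta)/n_b}.$$ **Estimators.** With finite classes $\mathcal Q_1,\mathcal Q_2,\mathcal L_2$ and $\mathcal L_1$ (the source dual class $\mathcal L_1$ may differ between the two estimators), let $$\widehat L_1^\beta(q_1,l_1)=\widehat{\mathbb E}_{n_1}\big[\tfrac\beta2q_1(s,a)^2+l_1(s,a)\{\widehat u_g(s,a)+\gamma_1(\mu q_1)(s')-q_1(s,a)\}\big],$$ $$\widehat L_2(q_1,q_2,l_2)=\widehat{\mathbb E}_{n_2}\big[\tfrac12q_2(s,a)^2+l_2(s,a)\{(I-\Pi_\mu)q_1(s,a)+g(s)+C+\gamma_2\Omega(q_2)(s')-q_2(s,a)\}\big].$$ Modular: $(\widehat q_1^{\rm mod},\widehat l_1)\in\arg\min_{\mathcal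 Q_1}\max_{\mathcal L_1}\widehat L_1^{1}$ (with $\widehat q_1^{\rm mod}$ a function of the demonstrations and the source transitions), then $(\widehat q_2^{\rm mod},\widehat l_2)\in\arg\min_{\mathcal Q_2}\max_{\mathcal L_2}\widehat L_2(\widehat q_1^{\rm mod},\cdot,\cdot)$. Coupled: $(\widehat q_1,\widehat q_2^{\rm coup},\widehat l_1,\widehat l_2)\in\arg\min_{\mathcal Q_1\times\mathcal Q_2}\max_{\mathcal L_1\times\mathcal L_2}\{\widehat L_1^0(q_1,l_1)+\widehat L_2(q_1,q_2,l_2)\}$. **Common assumptions** (those involving $\widehat\pi_{b1}$ or the estimators hold almost surely). All functions in the classes are measurable; $|q_i|\le B_{Qi}$ on $\mathcal Q_i$; $|l_2|\le B_{L2}:=\kappa_2B_{Q2}/(1-\gamma_2)$ on $\mathcal L_2$; $0\le g\le B_G$; $|C|\le2B_{Q1}$; $|\log(\widehat\pi_{b1}/\pi_{1,\rm ref})|\le B_U$; $\widetilde q_1^\star\in\mathcal Q_1$, $\widetilde q_2^\star\in\mathcal Q_2$; $\|d^{P_2}_{\pi_{\widetilde q_2^\star},\rho_2}/\rho_2\|_\infty\le\kappa_2$;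 $\|d^{P_1}_{\mu,\rho_1}/\rho_1\|_\infty\le\kappa_1$; $\|d^{P_2}_{\pi,\rho_2}/\rho_2\|_\infty\le\kappa_2^{\rm path}$ for all policies $\pi$ along the segment from $q_2^\star$ to $\widetilde q_2^\star$; $\chi_{21}:=\|\rho_2/\rho_1\|_\infty<\infty$; $\kappa_{\mu\mid\pi_{b1}}:=\|\mu/\pi_{b1}\|_\infty<\infty$. Here the policies along the segment from $q$ to $q'$ are the $\pi_{(1-t)q+tq'}$, $t\in[0,1]$, and their average $\int_0^1\pi_{(1-t)q+tq'}\,dt$. A *target dual* of $q_2$ is an $l_2$ with $l_2\ge0$ $\rho_2$-a.e. and $\langle l_2,(I-\gamma_2P_2^{\pi_{q_2}})h\rangle_{\rho_2}=\langle q_2,h\rangle_{\rho_2}$ for all bounded measurable $h$. **Modular assumptions.** $|l_1|\le B_{L1}^{\rm mod}:=\kappa_1B_{Q1}/(1-\gamma_1)$ on the measurable functions of $\mathcal L_1$; $\mathcal L_1$ contains an $l_1$ with $\langle l_1,(I-\gamma_1P_1^\mu)h\rangle_{\rho_1}=\langle\widetilde q_1^\star,h\rangle_{\rho_1}$ for all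 bounded measurable $h$; $\mathcal L_2$ contains a target dual of $\widetilde q_2^\star$; $\kappa_{\mu\mid\pi_{b1}}\le1/\epsilon_{b1}$ with $\epsilon_{b1}>0$. The second-stage population problem is realizable: the bounded solution $\widetilde q_2$ of $\widetilde q_2=(I-\Pi_\mu)\widehat q_1^{\rm mod}+g+C+\gamma_2P_2\Omega(\widetilde q_2)$ lies in $\mathcal Q_2$ and has a target dual in $\mathcal L_2$; and $\|d^{P_2}_{\pi,\rho_2}/\rho_2\|_\infty\le\kappa_{2,\rm path}$ for all policies $\pi$ along the segment from $\widetilde q_2^\star$ to $\widetilde q_2$. **Coupled assumptions.** $|l_1|\le B_{L12}$ on the measurable functions of $\mathcal L_1$; there are a target dual $l_2\in\mathcal L_2$ of $\widetilde q_2^\star$ and $l_1\in\mathcal L_1$ with $\langle l_1,(I-\gamma_1P_1^\mu)h\rangle_{\rho_1}=\langle l_2,(I-\Pi_\mu)h\rangle_{\rho_2}$ for all bounded measurable $h$. **Bounds.** Let $B_{{\rm Res},1}=B_U+B_G+(\gamma_1+1)B_{Q1}$, $B_{{\rm Res},2}=4B_{Q1}+B_G+(\gamma_2+1)B_{Q2}$,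 $M_1^{\rm mod}=\frac{4\kappa_{2,\rm path}\chi_{21}}{\epsilon_{b1}(1-\gamma_2)^2}(\frac12B_{Q1}^2+B_{L1}^{\rm mod}B_{{\rm Res},1})$, $M_1^{\rm coup}=B_{L12}B_{{\rm Res},1}$, $M_2=\frac12B_{Q2}^2+B_{L2}B_{{\rm Res},2}$, $N_1=|\mathcal Q_1||\mathcal L_1|$, $N_2^{\rm mod}=|\mathcal Q_2||\mathcal L_2|$, $N_2^{\rm coup}=|\mathcal Q_1||\mathcal Q_2||\mathcal L_2|$, and $$\mathcal B_{\rm mod}(\delta)=8M_1^{\rm mod}\sqrt{\tfrac{2\log(4N_1/\delta)}{n_1}}+8M_2\sqrt{\tfrac{2\log(4N_2^{\rm mod}/\delta)}{n_2}},\qquad \mathcal B_{\rm coup}(\delta)=4M_1^{\rm coup}\sqrt{\tfrac{2\log(2N_1/\delta)}{n_1}}+4M_2\sqrt{\tfrac{2\log(2N_2^{\rm coup}/\delta)}{n_2}}.$$ **Theorem.** Let $\delta\in(0,1)$. For each ${\rm alg}\in\{{\rm mod},{\rm coup}\}$, under the common assumptions and the assumptions for ${\rm alg}$, with probability at least $1-\delta$,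 $$\|\widehat q_2^{\rm alg}-q_2^\star\|_{\rho_2}\le\sqrt{\mathcal B_{\rm alg}(\delta)}+\frac{(1+\sqrt{\kappa_{\mu\mid\pi_{b1}}})\sqrt{\kappa_1\kappa_2^{\rm path}\chi_{21}}}{(1-\gamma_1)(1-\gamma_2)}\Big(\frac2\epsilon\varepsilon_{\rm CE}(n_b,\delta)\Big)^{1/2}.$$ In particular, if $\kappa_{\mu\mid\pi_{b1}}\le1/\epsilon_{b1}$ with $\epsilon_{b1}>0$, the second term is at most $$\frac{2\sqrt{\kappa_1\kappa_2^{\rm path}\chi_{21}}}{\sqrt{\epsilon_{b1}}(1-\gamma_1)(1-\gamma_2)}\Big(\frac2\epsilon\varepsilon_{\rm CE}(n_b,\delta)\Big)^{1/2}.$$ -/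

import Mathlib

open MeasureTheory ProbabilityTheory Set
open scoped ENNReal

noncomputable section

namespace RewardTransfer

variable {S A : Type*} [MeasurableSpace S] [Fintype A] [MeasurableSpace A]

/-- `π s a` is the probability of action `a` in state `s`. -/
structure IsPolicy (π : S → A → ℝ) : Prop where
  measurable : ∀ a, Measurable fun s => π s a
  nonneg : ∀ s a, 0 ≤ π s a
  sum_eq_one : ∀ s, ∑ a, π s a = 1

/-- The law on `S × A` of `(s, a)` with `s ∼ ν` and `a ∼ π(· | s)`. -/
def jointLaw (ν : Measure S) (π : S → A → ℝ) : Measure (S × A) :=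
  ∑ a, (ν.withDensity fun s => ENNReal.ofReal (π s a)).map fun s => (s, a)

/-- The policy average `(π f)(s) = ∑ₐ π(a | s) f(s, a)`. -/
def policyAvg (π : S → A → ℝ) (f : S × A → ℝ) (s : S) : ℝ := ∑ a, π s a * f (s, a)

/-- The operator `P^π`: `(P^π f)(s, a) = E[(π f)(s') | s' ∼ P(· | s, a)]`. -/
def transOp (P : Kernel (S × A) S) (π : S → A → ℝ) (f : S × A → ℝ) (x : S × A) : ℝ :=
  ∫ s', policyAvg π f s' ∂(P x)

/-- The adjoint of `P^π` on measures: one step of the state-action chain. -/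
def stepLaw (P : Kernel (S × A) S) (π : S → A → ℝ) (ν : Measure (S × A)) : Measure (S × A) :=
  jointLaw (ν.bind P) π

/-- The discounted occupancy measure `(1 - γ) ∑ₜ γᵗ ((P^π)ᵀ)ᵗ ρ`. -/
def occupancy (γ : ℝ) (P : Kernel (S × A) S) (π : S → A → ℝ) (ρ : Measure (S × A)) :
    Measure (S × A) :=
  Measure.sum fun t : ℕ => ENNReal.ofReal ((1 - γ) * γ ^ t) • (stepLaw P π)^[t] ρ

open Classical in
/-- `‖ν / ρ‖_∞`: the essential supremum of the density of `ν` with respect to `ρ`, and `∞` if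
there is no density. -/
def densityNorm {X : Type*} [MeasurableSpace X] (ν ρ : Measure X) : ℝ≥0∞ :=
  if ν ≪ ρ then essSup (ν.rnDeriv ρ) ρ else ⊤

/-- The norm `‖f‖_ρ` of `L²(ρ)`. -/
def l2norm {X : Type*} [MeasurableSpace X] (ρ : Measure X) (f : X → ℝ) : ℝ :=
  Real.sqrt (∫ x, f x ^ 2 ∂ρ)

/-- Bounded measurable functions. -/
structure IsBM {X : Type*} [MeasurableSpace X] (f : X → ℝ) : Prop where
  measurable : Measurable f
  bounded : ∃ B, ∀ x, |f x| ≤ B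

/-- `(q, l) ∈ argmin_{q ∈ Q} max_{l ∈ L} F(q, l)`: the point `l` attains the maximum of `F(q, ·)`
over `L`, and that maximum is at most the maximum of `F(q', ·)` over `L`, for every `q' ∈ Q`. -/
structure IsMinimax {X Y : Type*} (F : X → Y → ℝ) (Q : Finset X) (L : Finset Y)
    (q : X) (l : Y) : Prop where
  mem_left : q ∈ Q
  mem_right : l ∈ L
  max_right : ∀ l' ∈ L, F q l' ≤ F q l
  min_left : ∀ q' ∈ Q, ∃ l' ∈ L, F q l ≤ F q' l'

/-- The empirical average of `f` over the sample `d`. -/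
def empMean {n : ℕ} {Z : Type*} (d : Fin n → Z) (f : Z → ℝ) : ℝ := (∑ i, f (d i)) / n

variable (S A) in
/-- Source and target environments with shared reward, the sampling distributions, the anchor
`(μ, g)` and the reward shift `C`. The source temperature is normalized to one. -/
structure Model where
  /-- transition kernels -/
  P₁ : Kernel (S × A) S
  P₂ : Kernel (S × A) S
  markov₁ : IsMarkovKernel P₁
  markov₂ : IsMarkovKernel P₂
  /-- discounts and target temperature -/
  γ₁ : ℝ
  γ₂ : ℝ
  τ₂ : ℝ
  γ₁_nonneg : 0 ≤ γ₁
  γ₁_lt_one : γ₁ < 1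
  γ₂_nonneg : 0 ≤ γ₂
  γ₂_lt_one : γ₂ < 1
  τ₂_pos : 0 < τ₂
  /-- full-support reference policies -/
  ref₁ : S → A → ℝ
  ref₂ : S → A → ℝ
  ref₁_policy : IsPolicy ref₁
  ref₂_policy : IsPolicy ref₂
  ref₁_pos : ∀ s a, 0 < ref₁ s a
  ref₂_pos : ∀ s a, 0 < ref₂ s a
  /-- source state distribution and source behavior policy -/
  ρ₁S : Measure S
  ρ₁S_prob : IsProbabilityMeasure ρ₁S
  πb : S → A → ℝ
  πb_policy : IsPolicy πb
  /-- target state-action distribution -/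
  ρ₂ : Measure (S × A)
  ρ₂_prob : IsProbabilityMeasure ρ₂
  /-- anchor policy, anchor function, reward shift -/
  μ : S → A → ℝ
  μ_policy : IsPolicy μ
  g : S → ℝ
  g_measurable : Measurable g
  C : ℝ

namespace Model

variable (M : Model S A)

/-- The source state-action distribution `ρ₁(s, a) = ρ₁ˢ(s) π_{b1}(a | s)`. -/
def ρ₁ : Measure (S × A) := jointLaw M.ρ₁S M.πb

/-- The soft value `Ω(q)(s) = τ₂ log ∑ₐ π_{2,ref}(a | s) exp(q(s, a) / τ₂)`. -/
def softValue (q : S × A → ℝ) (s : S) : ℝ :=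
  M.τ₂ * Real.log (∑ a, M.ref₂ s a * Real.exp (q (s, a) / M.τ₂))

/-- The target policy induced by `q`. -/
def softPolicy (q : S × A → ℝ) (s : S) (a : A) : ℝ :=
  M.ref₂ s a * Real.exp (q (s, a) / M.τ₂) /
    ∑ a', M.ref₂ s a' * Real.exp (q (s, a') / M.τ₂)

/-- The source signal `log (π / π_{1,ref}) - g` of a behavior policy `π`. -/
def signal (π : S → A → ℝ) (x : S × A) : ℝ := Real.log (π x.1 x.2 / M.ref₁ x.1 x.2) - M.g x.1

/-- The shifted transferred reward `(I - Π_μ) q₁ + g + C`. -/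
def reward (q₁ : S × A → ℝ) (x : S × A) : ℝ :=
  q₁ x - policyAvg M.μ q₁ x.1 + M.g x.1 + M.C

/-- `q₁` is the (unique) bounded solution of `q₁ = u + γ₁ P₁^μ q₁`. -/
structure IsSourceValue (u q₁ : S × A → ℝ) : Prop where
  bm : IsBM q₁
  eq : ∀ x, q₁ x = u x + M.γ₁ * transOp M.P₁ M.μ q₁ x

/-- `q₂` is the (unique) bounded solution of `q₂ = (I - Π_μ) q₁ + g + C + γ₂ P₂ Ω(q₂)`. -/
structure IsTargetValue (q₁ q₂ : S × A → ℝ) : Prop where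
  bm : IsBM q₂
  eq : ∀ x, q₂ x = M.reward q₁ x + M.γ₂ * ∫ s', M.softValue q₂ s' ∂(M.P₂ x)

/-- `(q₁, q₂)` is the population transfer target of the system with behavior policy `π`. -/
structure IsTransferTarget (π : S → A → ℝ) (q₁ q₂ : S × A → ℝ) : Prop where
  source : M.IsSourceValue (M.signal π) q₁
  target : M.IsTargetValue q₁ q₂

/-- The nonnegative target dual variable of the target value `q₂`:
`⟨l₂, (I - γ₂ P₂^{π}) h⟩_{ρ₂} = ⟨q₂, h⟩_{ρ₂}` for all `h`, with `π` induced by `q₂`. -/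
structure IsTargetDual (q₂ l₂ : S × A → ℝ) : Prop where
  nonneg : ∀ᵐ x ∂M.ρ₂, 0 ≤ l₂ x
  adjoint : ∀ h : S × A → ℝ, IsBM h →
    ∫ x, l₂ x * (h x - M.γ₂ * transOp M.P₂ (M.softPolicy q₂) h x) ∂M.ρ₂ =
      ∫ x, q₂ x * h x ∂M.ρ₂

/-- The modular source dual variable of `q₁`:
`⟨l₁, (I - γ₁ P₁^μ) h⟩_{ρ₁} = ⟨q₁, h⟩_{ρ₁}` for all `h`. -/
def IsModularSourceDual (q₁ l₁ : S × A → ℝ) : Prop :=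
  ∀ h : S × A → ℝ, IsBM h →
    ∫ x, l₁ x * (h x - M.γ₁ * transOp M.P₁ M.μ h x) ∂M.ρ₁ = ∫ x, q₁ x * h x ∂M.ρ₁

/-- The coupled source dual variable (source weight `β = 0`) belonging to `l₂`:
`⟨l₁, (I - γ₁ P₁^μ) h⟩_{ρ₁} = ⟨l₂, (I - Π_μ) h⟩_{ρ₂}` for all `h`. -/
def IsCoupledSourceDual (l₂ l₁ : S × A → ℝ) : Prop :=
  ∀ h : S × A → ℝ, IsBM h →
    ∫ x, l₁ x * (h x - M.γ₁ * transOp M.P₁ M.μ h x) ∂M.ρ₁ =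
      ∫ x, l₂ x * (h x - policyAvg M.μ h x.1) ∂M.ρ₂

/-- The policies along the segment from `q` to `q'`: those induced by its points, and the average
`∫₀¹ π_{(1-t)q+tq'} dt`, which represents the averaged derivative of `Ω` along the segment. -/
def pathPolicies (q q' : S × A → ℝ) : Set (S → A → ℝ) :=
  {π | ∃ t ∈ Icc (0 : ℝ) 1, π = M.softPolicy fun x => (1 - t) * q x + t * q' x} ∪
    {fun s a => ∫ t in (0 : ℝ)..1, M.softPolicy (fun x => (1 - t) * q x + t * q' x) s a}

/-- Pathwise target concentrability with constant `κ` along the segment from `q` to `q'`. -/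
def PathConcentrability (q q' : S × A → ℝ) (κ : ℝ) : Prop :=
  ∀ π ∈ M.pathPolicies q q',
    densityNorm (occupancy M.γ₂ M.P₂ π M.ρ₂) M.ρ₂ ≤ ENNReal.ofReal κ

/-- `χ₂₁ = ‖ρ₂ / ρ₁‖_∞`, as an extended number. -/
def chi : ℝ≥0∞ := densityNorm M.ρ₂ M.ρ₁

/-- `κ_{μ|π_{b1}} = ‖μ / π_{b1}‖_∞`, the norm of `L^∞(ρ₁)`, as an extended number. -/
def kappaMu : ℝ≥0∞ := eLpNorm (fun x : S × A => M.μ x.1 x.2 / M.πb x.1 x.2) ⊤ M.ρ₁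

/-- The sample term of the source objective with source weight `β`, at `z = ((s, a), s')`. -/
def sourceTerm (β : ℝ) (u q₁ l₁ : S × A → ℝ) (z : (S × A) × S) : ℝ :=
  β / 2 * q₁ z.1 ^ 2 + l₁ z.1 * (u z.1 + M.γ₁ * policyAvg M.μ q₁ z.2 - q₁ z.1)

/-- The sample term of the target objective, at `z = ((s, a), s')`. -/
def targetTerm (q₁ q₂ l₂ : S × A → ℝ) (z : (S × A) × S) : ℝ :=
  1 / 2 * q₂ z.1 ^ 2 + l₂ z.1 * (M.reward q₁ z.1 + M.γ₂ * M.softValue q₂ z.2 - q₂ z.1)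

/-- First stage of the modular estimator, with source signal `u`. -/
def IsModularStage1 {n₁ : ℕ} (d₁ : Fin n₁ → (S × A) × S) (u : S × A → ℝ)
    (Q₁ L₁ : Finset (S × A → ℝ)) (q₁ l₁ : S × A → ℝ) : Prop :=
  IsMinimax (fun q l => empMean d₁ (M.sourceTerm 1 u q l)) Q₁ L₁ q₁ l₁

/-- Second stage of the modular estimator, with `q₁` plugged in. -/
def IsModularStage2 {n₂ : ℕ} (d₂ : Fin n₂ → (S × A) × S) (q₁ : S × A → ℝ)
    (Q₂ L₂ : Finset (S × A → ℝ)) (q₂ l₂ : S × A → ℝ) : Prop :=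
  IsMinimax (fun q l => empMean d₂ (M.targetTerm q₁ q l)) Q₂ L₂ q₂ l₂

/-- The coupled estimator with source weight `β` and source signal `u`; `q = (q₁, q₂)` and
`l = (l₁, l₂)`. -/
def IsCoupled (β : ℝ) {n₁ n₂ : ℕ} (d₁ : Fin n₁ → (S × A) × S) (d₂ : Fin n₂ → (S × A) × S)
    (u : S × A → ℝ) (Q₁ Q₂ L₁ L₂ : Finset (S × A → ℝ))
    (q l : (S × A → ℝ) × (S × A → ℝ)) : Prop :=
  IsMinimax
    (fun q l => empMean d₁ (M.sourceTerm β u q.1 l.1) + empMean d₂ (M.targetTerm q.1 q.2 l.2))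
    (Q₁ ×ˢ Q₂) (L₁ ×ˢ L₂) q l

/-- `Db`, `D₁`, `D₂` are mutually independent i.i.d. samples: demonstrations from `ρ₁`, source
transitions from `ρ₁ × P₁`, target transitions from `ρ₂ × P₂`. -/
structure IsSample {Ω : Type*} [MeasurableSpace Ω] (Pr : Measure Ω) {nb n₁ n₂ : ℕ}
    (Db : Ω → Fin nb → S × A) (D₁ : Ω → Fin n₁ → (S × A) × S)
    (D₂ : Ω → Fin n₂ → (S × A) × S) : Prop where
  meas_b : Measurable Db
  meas₁ : Measurable D₁
  meas₂ : Measurable D₂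
  law : Pr.map (fun ω => (Db ω, D₁ ω, D₂ ω)) =
    (Measure.pi fun _ => M.ρ₁).prod
      ((Measure.pi fun _ => M.ρ₁ ⊗ₘ M.P₁).prod (Measure.pi fun _ => M.ρ₂ ⊗ₘ M.P₂))

end Model

/-- The empirical cross-entropy of the policy `π` on the demonstrations `d`. -/
def crossEntropy {n : ℕ} (d : Fin n → S × A) (π : S → A → ℝ) : ℝ :=
  empMean d fun x => -Real.log (π x.1 x.2)

/-- `d ↦ πhat d` is a (measurable) empirical cross-entropy minimizer over the class `Π`. -/
structure IsCEMinimizer {n : ℕ} (pols : Finset (S → A → ℝ))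
    (πhat : (Fin n → S × A) → S → A → ℝ) : Prop where
  mem : ∀ d, πhat d ∈ pols
  le : ∀ d, ∀ π ∈ pols, crossEntropy d (πhat d) ≤ crossEntropy d π
  measurable : ∀ π ∈ pols, MeasurableSet {d | πhat d = π}

/-- `ε_CE(n_b, δ) = 2 log(1/ε) √(2 log(|Π| / δ) / n_b)`, with `N = |Π|`. -/
def epsCE (ε : ℝ) (N nb : ℕ) (δ : ℝ) : ℝ :=
  2 * Real.log (1 / ε) * Real.sqrt (2 * Real.log (N / δ) / nb)

/-- The constants of the global finite-sample bounds: sup-norm bounds, the coverage constants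
`κ₁`, `κ₂`, and the radius `B_{L12}` of the coupled source dual class. -/
structure Constants where
  BQ₁ : ℝ
  BQ₂ : ℝ
  BU : ℝ
  BG : ℝ
  κ₁ : ℝ
  κ₂ : ℝ
  BL12 : ℝ

namespace Model

variable (M : Model S A) (c : Constants)

/-- `B_{L1}^{mod}` -/
def BL₁mod : ℝ := c.κ₁ / (1 - M.γ₁) * c.BQ₁

/-- `B_{L2}` -/
def BL₂ : ℝ := c.κ₂ / (1 - M.γ₂) * c.BQ₂

/-- `B_{Res,1}` -/
def BRes₁ : ℝ := c.BU + c.BG + (M.γ₁ + 1) * c.BQ₁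

/-- `B_{Res,2}` -/
def BRes₂ : ℝ := 4 * c.BQ₁ + c.BG + (M.γ₂ + 1) * c.BQ₂

/-- `M₁^{mod}` -/
def M₁mod (κpath εb : ℝ) : ℝ :=
  4 * κpath * M.chi.toReal / (εb * (1 - M.γ₂) ^ 2) *
    (1 / 2 * c.BQ₁ ^ 2 + M.BL₁mod c * M.BRes₁ c)

/-- `M₁^{coup}` -/
def M₁coup : ℝ := c.BL12 * M.BRes₁ c

/-- `M₂` -/
def M₂ : ℝ := 1 / 2 * c.BQ₂ ^ 2 + M.BL₂ c * M.BRes₂ c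

/-- The bound `𝓑_mod(δ)`, with `N₁ = |𝓠₁||𝓛₁|` and `N₂ = |𝓠₂||𝓛₂|`. -/
def Bmod (κpath εb : ℝ) (N₁ N₂ n₁ n₂ : ℕ) (δ : ℝ) : ℝ :=
  8 * M.M₁mod c κpath εb * Real.sqrt (2 * Real.log (4 * N₁ / δ) / n₁) +
    8 * M.M₂ c * Real.sqrt (2 * Real.log (4 * N₂ / δ) / n₂)

/-- The bound `𝓑_coup(δ)`, with `N₁ = |𝓠₁||𝓛₁|` and `N₂ = |𝓠₁||𝓠₂||𝓛₂|`. -/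
def Bcoup (N₁ N₂ n₁ n₂ : ℕ) (δ : ℝ) : ℝ :=
  4 * M.M₁coup c * Real.sqrt (2 * Real.log (2 * N₁ / δ) / n₁) +
    4 * M.M₂ c * Real.sqrt (2 * Real.log (2 * N₂ / δ) / n₂)

/-- The policy-learning term of the end-to-end bound. -/
def learningTerm (κ₁ κpath ε : ℝ) (N nb : ℕ) (δ : ℝ) : ℝ :=
  (1 + Real.sqrt M.kappaMu.toReal) * Real.sqrt (κ₁ * κpath * M.chi.toReal) /
      ((1 - M.γ₁) * (1 - M.γ₂)) *
    Real.sqrt (2 / ε * epsCE ε N nb δ)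

/-- The finite classes `Q₁`, `Q₂`, `L₂` consist of measurable functions within their radii, the
anchor function satisfies `0 ≤ g ≤ B_G`, and the shift `C` is on the `B_{Q1}`-scale. -/
structure Envelope (Q₁ Q₂ L₂ : Finset (S × A → ℝ)) : Prop where
  meas_Q₁ : ∀ q ∈ Q₁, Measurable q
  meas_Q₂ : ∀ q ∈ Q₂, Measurable q
  meas_L₂ : ∀ l ∈ L₂, Measurable l
  bound_Q₁ : ∀ q ∈ Q₁, ∀ x, |q x| ≤ c.BQ₁
  bound_Q₂ : ∀ q ∈ Q₂, ∀ x, |q x| ≤ c.BQ₂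
  bound_L₂ : ∀ l ∈ L₂, ∀ x, |l x| ≤ M.BL₂ c
  g_nonneg : ∀ s, 0 ≤ M.g s
  g_le : ∀ s, M.g s ≤ c.BG
  shift : |M.C| ≤ 2 * c.BQ₁

/-- The conditions on the system with behavior policy `π` and population target `(q₁, q₂)` that
are common to both estimators: bounded signal, realizability, target coverage. -/
structure SystemConditions (Q₁ Q₂ : Finset (S × A → ℝ)) (π : S → A → ℝ)
    (q₁ q₂ : S × A → ℝ) : Prop where
  target : M.IsTransferTarget π q₁ q₂
  signal_le : ∀ s a, |Real.log (π s a / M.ref₁ s a)| ≤ c.BU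
  mem_Q₁ : q₁ ∈ Q₁
  mem_Q₂ : q₂ ∈ Q₂
  coverage :
    densityNorm (occupancy M.γ₂ M.P₂ (M.softPolicy q₂) M.ρ₂) M.ρ₂ ≤ ENNReal.ofReal c.κ₂

end Model

end RewardTransfer

end

/-! The error splits at the random target `(q₁t, q₂t)` of the plug-in system into an estimation
error and a policy-learning error.

Estimation. Evaluate the Lagrangian at the estimated primal point and a realizable dual, and
subtract its value at the true primal point and the dual response supplied by the minimax property.
Optimality makes the empirical version of this gap nonpositive. In population the subtracted
residual vanishes, so its dual plays no role, while the dual identity and a completion of squares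
turn the rest into half a squared error (`integral_sourceGap_modular`, `targetGap_properties`). For
the target the soft value is only convex; the tangent inequality together with a nonnegative dual
leaves a lower bound, plus a cross term in the source error. In the coupled problem the source gap
with `β = 0` cancels this cross term exactly; in the modular problem the same plug-in appears on
both sides, the cross term is zero, and the first-stage error is carried to the target by
`l2norm_target_sub_le`. Thus only one-sided deviations of the gap matter. `lagrangian_gap` shows
that the gap is sub-Gaussian with proxy `2B²`, by separating the fluctuation of the next state from
the conditional mean, and `measure_deviationSet_le` takes a union bound.

Policy learning. A discounted linear Bellman equation is stable in `L²` under concentrability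
(`integral_sq_le_occupancy`). It applies to the source equation directly, and to the target because
a difference of soft values is linear for the policy averaged along the segment
(`softValue_sub_eq_policyAvg`). The forcing term of the source is a log-likelihood ratio;
`integral_sq_logRatio_le` bounds its mean square by relative entropy, and `measure_epsCE_lt_le`
bounds that entropy.

Randomness. The gap functions depend on earlier samples only through an element of a finite class
(the learned policy, or the first-stage estimate), which is independent of the sample being used.
`measure_le_of_map_prod` therefore permits bounding the deviation for each fixed element, with no
union over the conditioning class. Uniqueness of bounded solutions makes the targets functions of
that element. -/

noncomputable section

namespace RewardTransfer

set_option linter.unusedSectionVars false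

/-! ### Bounded measurable functions, `L²` inequalities and density norms. -/

section BoundedMeasurable

variable {X Y : Type*} [MeasurableSpace X] [MeasurableSpace Y]

namespace IsBM

variable {f g : X → ℝ}

theorem const (c : ℝ) : IsBM fun _ : X => c := ⟨measurable_const, |c|, fun _ => le_rfl⟩

theorem add (hf : IsBM f) (hg : IsBM g) : IsBM fun x => f x + g x := by
  obtain ⟨B, hB⟩ := hf.bounded
  obtain ⟨D, hD⟩ := hg.bounded
  exact ⟨hf.measurable.add hg.measurable, B + D,
    fun x => (abs_add_le _ _).trans (add_le_add (hB x) (hD x))⟩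

theorem neg (hf : IsBM f) : IsBM fun x => -f x := by
  obtain ⟨B, hB⟩ := hf.bounded
  exact ⟨hf.measurable.neg, B, fun x => by simpa using hB x⟩

theorem sub (hf : IsBM f) (hg : IsBM g) : IsBM fun x => f x - g x := by
  simpa [sub_eq_add_neg] using hf.add hg.neg

theorem mul (hf : IsBM f) (hg : IsBM g) : IsBM fun x => f x * g x := by
  obtain ⟨B, hB⟩ := hf.bounded
  obtain ⟨D, hD⟩ := hg.bounded
  refine ⟨hf.measurable.mul hg.measurable, B * D, fun x => ?_⟩
  rw [abs_mul]
  exact mul_le_mul (hB x) (hD x) (abs_nonneg _) ((abs_nonneg _).trans (hB x))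

theorem const_mul (c : ℝ) (hf : IsBM f) : IsBM fun x => c * f x := (IsBM.const c).mul hf

theorem sq (hf : IsBM f) : IsBM fun x => f x ^ 2 := by simpa [pow_two] using hf.mul hf

theorem comp (hf : IsBM f) {φ : Y → X} (hφ : Measurable φ) : IsBM fun y => f (φ y) :=
  ⟨hf.measurable.comp hφ, hf.bounded.imp fun _ h y => h (φ y)⟩

theorem sum {ι : Type*} (s : Finset ι) {F : ι → X → ℝ} (hF : ∀ i ∈ s, IsBM (F i)) :
    IsBM fun x => ∑ i ∈ s, F i x := by
  classical
  induction s using Finset.induction_on with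
  | empty => simpa using IsBM.const (X := X) 0
  | insert i s hi ih =>
    simp_rw [Finset.sum_insert hi]
    exact (hF i (by simp)).add (ih fun j hj => hF j (by simp [hj]))

theorem integrable (hf : IsBM f) (ρ : Measure X) [IsFiniteMeasure ρ] : Integrable f ρ := by
  obtain ⟨B, hB⟩ := hf.bounded
  exact Integrable.of_bound hf.measurable.aestronglyMeasurable B (by simpa using ae_of_all _ hB)

theorem integral_kernel {f : Y → ℝ} (hf : IsBM f) (P : Kernel X Y) [IsMarkovKernel P] :
    IsBM fun x => ∫ y, f y ∂(P x) := by
  obtain ⟨B, hB⟩ := hf.bounded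
  refine ⟨hf.measurable.stronglyMeasurable.integral_kernel.measurable, B, fun x => ?_⟩
  simpa using norm_integral_le_of_norm_le_const (μ := P x) (f := f) (C := B) (ae_of_all _ hB)

end IsBM

/-- Jensen's inequality for the square. -/
theorem sq_integral_le {f : X → ℝ} (hf : IsBM f) (ρ : Measure X) [IsProbabilityMeasure ρ] :
    (∫ x, f x ∂ρ) ^ 2 ≤ ∫ x, f x ^ 2 ∂ρ := by
  set m := ∫ x, f x ∂ρ
  have h : 0 ≤ ∫ x, (f x - m) ^ 2 ∂ρ := integral_nonneg fun x => sq_nonneg _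
  have e : ∫ x, (f x - m) ^ 2 ∂ρ = ∫ x, (f x ^ 2 - 2 * m * f x) + m ^ 2 ∂ρ := by
    congr 1; ext x; ring
  rw [e, integral_add ((hf.sq.sub (hf.const_mul _)).integrable ρ) (integrable_const _),
    integral_sub (hf.sq.integrable ρ) ((hf.const_mul _).integrable ρ), integral_const_mul] at h
  simp only [integral_const, probReal_univ, one_smul] at h
  change 0 ≤ _ - 2 * m * m + _ at h
  nlinarith

theorem l2norm_nonneg (ρ : Measure X) (f : X → ℝ) : 0 ≤ l2norm ρ f := Real.sqrt_nonneg _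

theorem sq_l2norm (ρ : Measure X) (f : X → ℝ) : l2norm ρ f ^ 2 = ∫ x, f x ^ 2 ∂ρ :=
  Real.sq_sqrt (integral_nonneg fun _ => sq_nonneg _)

theorem le_of_sq_le_sq {a b : ℝ} (h : a ^ 2 ≤ b ^ 2) (hb : 0 ≤ b) : a ≤ b :=
  (le_abs_self a).trans (abs_le_of_sq_le_sq h hb)

/-- Cauchy–Schwarz, from the discriminant of the nonnegative quadratic `t ↦ ∫ (f - t g)²`. -/
theorem integral_mul_le_l2norm {f g : X → ℝ} (hf : IsBM f) (hg : IsBM g) (ρ : Measure X)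
    [IsFiniteMeasure ρ] : ∫ x, f x * g x ∂ρ ≤ l2norm ρ f * l2norm ρ g := by
  have key (t : ℝ) : 0 ≤ (∫ x, g x ^ 2 ∂ρ) * (t * t) + (-2 * ∫ x, f x * g x ∂ρ) * t
      + ∫ x, f x ^ 2 ∂ρ := by
    have h : 0 ≤ ∫ x, (f x - t * g x) ^ 2 ∂ρ := integral_nonneg fun x => sq_nonneg _
    have e : ∫ x, (f x - t * g x) ^ 2 ∂ρ
        = ∫ x, (f x ^ 2 - 2 * t * (f x * g x)) + t ^ 2 * g x ^ 2 ∂ρ := by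
      congr 1; ext x; ring
    rw [e, integral_add ((hf.sq.sub ((hf.mul hg).const_mul _)).integrable ρ)
      ((hg.sq.const_mul _).integrable ρ), integral_sub (hf.sq.integrable ρ)
      (((hf.mul hg).const_mul _).integrable ρ), integral_const_mul, integral_const_mul] at h
    linarith
  have d := discrim_le_zero key
  rw [discrim] at d
  refine le_of_sq_le_sq ?_ (mul_nonneg (l2norm_nonneg _ _) (l2norm_nonneg _ _))
  rw [mul_pow, sq_l2norm, sq_l2norm]
  linarith

/-- Minkowski's inequality for bounded functions. -/
theorem l2norm_add_le {f g : X → ℝ} (hf : IsBM f) (hg : IsBM g) (ρ : Measure X)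
    [IsFiniteMeasure ρ] : l2norm ρ (fun x => f x + g x) ≤ l2norm ρ f + l2norm ρ g := by
  refine le_of_sq_le_sq ?_ (add_nonneg (l2norm_nonneg _ _) (l2norm_nonneg _ _))
  have e : ∫ x, (f x + g x) ^ 2 ∂ρ = ∫ x, (f x ^ 2 + 2 * (f x * g x)) + g x ^ 2 ∂ρ := by
    congr 1; ext x; ring
  rw [sq_l2norm, e, integral_add ((hf.sq.add ((hf.mul hg).const_mul _)).integrable ρ)
    (hg.sq.integrable ρ), integral_add (hf.sq.integrable ρ) (((hf.mul hg).const_mul _).integrable ρ),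
    integral_const_mul, ← sq_l2norm, ← sq_l2norm]
  nlinarith [integral_mul_le_l2norm hf hg ρ]

theorem l2norm_neg (ρ : Measure X) (f : X → ℝ) : l2norm ρ (fun x => -f x) = l2norm ρ f := by
  simp [l2norm]

/-- A bounded density norm is a domination of measures. -/
theorem le_smul_of_densityNorm_le {ν ρ : Measure X} [SigmaFinite ν] [SigmaFinite ρ] {K : ℝ≥0∞}
    (hK : K ≠ ⊤) (h : densityNorm ν ρ ≤ K) : ν ≤ K • ρ := by
  unfold densityNorm at h
  split_ifs at h with hac
  · rw [← Measure.withDensity_rnDeriv_eq ν ρ hac, ← withDensity_const]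
    exact withDensity_mono ((ENNReal.ae_le_essSup _).mono fun x hx => hx.trans h)
  · exact absurd (top_le_iff.1 h) hK

theorem integral_le_of_densityNorm_le {ν ρ : Measure X} [IsFiniteMeasure ν] [IsFiniteMeasure ρ]
    {K : ℝ≥0∞} (hK : K ≠ ⊤) (h : densityNorm ν ρ ≤ K) {f : X → ℝ} (hf : IsBM f)
    (hf0 : ∀ x, 0 ≤ f x) : ∫ x, f x ∂ν ≤ K.toReal * ∫ x, f x ∂ρ := by
  have := integral_mono_measure (le_smul_of_densityNorm_le hK h) (ae_of_all _ hf0)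
    ((hf.integrable ρ).smul_measure hK)
  simpa [integral_smul_measure] using this

/-- Test the domination of measures on the whole space: both masses are one. This supplies the signs
of all coverage constants, which are never assumed. -/
theorem pos_of_densityNorm_le {ν ρ : Measure X} [IsProbabilityMeasure ν] [IsProbabilityMeasure ρ]
    {κ : ℝ} (h : densityNorm ν ρ ≤ ENNReal.ofReal κ) : 0 < κ := by
  have := le_smul_of_densityNorm_le ENNReal.ofReal_ne_top h univ
  simp only [measure_univ, Measure.smul_apply, smul_eq_mul, mul_one] at this
  exact zero_lt_one.trans_le (ENNReal.one_le_ofReal.1 this)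

end BoundedMeasurable

/-! ### The state-action chain, its occupancy measure and `L²` stability. -/

section Chain

variable {S A : Type*} [MeasurableSpace S] [Fintype A] [MeasurableSpace A]
  [MeasurableSingletonClass A]

theorem IsPolicy.le_one {π : S → A → ℝ} (hπ : IsPolicy π) (s : S) (a : A) : π s a ≤ 1 := by
  rw [← hπ.sum_eq_one s]
  exact Finset.single_le_sum (fun b _ => hπ.nonneg s b) (Finset.mem_univ a)

theorem IsPolicy.isBM {π : S → A → ℝ} (hπ : IsPolicy π) (a : A) : IsBM fun s => π s a :=
  ⟨hπ.measurable a, 1, fun s => by rw [abs_of_nonneg (hπ.nonneg s a)]; exact hπ.le_one s a⟩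

theorem measurable_uncurry_of_forall {f : S × A → ℝ} (h : ∀ a, Measurable fun s => f (s, a)) :
    Measurable f := measurable_from_prod_countable_left h

theorem IsPolicy.measurable_uncurry {π : S → A → ℝ} (hπ : IsPolicy π) :
    Measurable fun x : S × A => π x.1 x.2 := measurable_uncurry_of_forall hπ.measurable

theorem IsBM.policyAvg {π : S → A → ℝ} (hπ : IsPolicy π) {f : S × A → ℝ} (hf : IsBM f) :
    IsBM (policyAvg π f) :=
  IsBM.sum _ fun a _ => (hπ.isBM a).mul (hf.comp measurable_prodMk_right)

theorem abs_policyAvg_le {π : S → A → ℝ} (hπ : IsPolicy π) {f : S × A → ℝ} {B : ℝ}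
    (hf : ∀ x, |f x| ≤ B) (s : S) : |policyAvg π f s| ≤ B := by
  calc |policyAvg π f s| ≤ ∑ a, |π s a * f (s, a)| := Finset.abs_sum_le_sum_abs _ _
    _ ≤ ∑ a, π s a * B := Finset.sum_le_sum fun a _ => by
        rw [abs_mul, abs_of_nonneg (hπ.nonneg s a)]
        exact mul_le_mul_of_nonneg_left (hf _) (hπ.nonneg s a)
    _ = B := by rw [← Finset.sum_mul, hπ.sum_eq_one, one_mul]

theorem abs_integral_le_of_abs_le {X : Type*} [MeasurableSpace X] (ρ : Measure X)
    [IsProbabilityMeasure ρ] {f : X → ℝ} {B : ℝ} (hf : ∀ x, |f x| ≤ B) : |∫ x, f x ∂ρ| ≤ B := by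
  simpa using norm_integral_le_of_norm_le_const (μ := ρ) (f := f) (C := B) (ae_of_all _ hf)

theorem IsBM.transOp {P : Kernel (S × A) S} [IsMarkovKernel P] {π : S → A → ℝ} (hπ : IsPolicy π)
    {f : S × A → ℝ} (hf : IsBM f) : IsBM (transOp P π f) := (hf.policyAvg hπ).integral_kernel P

theorem policyAvg_sub (π : S → A → ℝ) (f g : S × A → ℝ) (s : S) :
    policyAvg π (fun x => f x - g x) s = policyAvg π f s - policyAvg π g s := by
  simp [policyAvg, mul_sub, Finset.sum_sub_distrib]

theorem transOp_sub {P : Kernel (S × A) S} [IsMarkovKernel P] {π : S → A → ℝ} (hπ : IsPolicy π)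
    {f g : S × A → ℝ} (hf : IsBM f) (hg : IsBM g) (x : S × A) :
    transOp P π (fun y => f y - g y) x = transOp P π f x - transOp P π g x := by
  simp only [transOp, policyAvg_sub]
  exact integral_sub ((hf.policyAvg hπ).integrable _) ((hg.policyAvg hπ).integrable _)

theorem lintegral_jointLaw (ν : Measure S) {π : S → A → ℝ} (hπ : IsPolicy π) {f : S × A → ℝ≥0∞}
    (hf : Measurable f) :
    ∫⁻ x, f x ∂(jointLaw ν π) = ∫⁻ s, ∑ a, ENNReal.ofReal (π s a) * f (s, a) ∂ν := by
  have hm (a : A) : Measurable fun s => f (s, a) := hf.comp measurable_prodMk_right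
  rw [jointLaw, lintegral_finsetSum_measure, lintegral_finsetSum]
  · refine Finset.sum_congr rfl fun a _ => ?_
    rw [lintegral_map hf measurable_prodMk_right,
      lintegral_withDensity_eq_lintegral_mul _ (hπ.measurable a).ennreal_ofReal (hm a)]
    rfl
  · exact fun a _ => (hπ.measurable a).ennreal_ofReal.mul (hm a)

theorem isProbabilityMeasure_jointLaw (ν : Measure S) [IsProbabilityMeasure ν] {π : S → A → ℝ}
    (hπ : IsPolicy π) : IsProbabilityMeasure (jointLaw ν π) := by
  constructor
  rw [← lintegral_one, lintegral_jointLaw ν hπ measurable_const]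
  have (s : S) : ∑ a, ENNReal.ofReal (π s a) * 1 = 1 := by
    simp only [mul_one]
    rw [← ENNReal.ofReal_sum_of_nonneg fun a _ => hπ.nonneg s a, hπ.sum_eq_one, ENNReal.ofReal_one]
  rw [lintegral_congr this]
  simp

theorem integral_jointLaw (ν : Measure S) [IsProbabilityMeasure ν] {π : S → A → ℝ}
    (hπ : IsPolicy π) {f : S × A → ℝ} (hf : IsBM f) :
    ∫ x, f x ∂(jointLaw ν π) = ∫ s, policyAvg π f s ∂ν := by
  have hJ := isProbabilityMeasure_jointLaw ν hπ
  have hi := hf.integrable (jointLaw ν π)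
  rw [jointLaw, integrable_finsetSum_measure] at hi
  rw [jointLaw, integral_finsetSum_measure hi]
  simp only [policyAvg]
  rw [integral_finsetSum]
  · refine Finset.sum_congr rfl fun a _ => ?_
    rw [integral_map measurable_prodMk_right.aemeasurable hf.measurable.aestronglyMeasurable,
      integral_withDensity_eq_integral_toReal_smul (hπ.measurable a).ennreal_ofReal
        (ae_of_all _ fun _ => ENNReal.ofReal_lt_top)]
    simp [ENNReal.toReal_ofReal (hπ.nonneg _ a)]
  · exact fun a _ => ((hπ.isBM a).mul (hf.comp measurable_prodMk_right)).integrable ν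

theorem isProbabilityMeasure_stepLaw (P : Kernel (S × A) S) [IsMarkovKernel P] {π : S → A → ℝ}
    (hπ : IsPolicy π) (ν : Measure (S × A)) [IsProbabilityMeasure ν] :
    IsProbabilityMeasure (stepLaw P π ν) :=
  have : IsProbabilityMeasure (ν.bind P) := inferInstance
  isProbabilityMeasure_jointLaw _ hπ

theorem integral_stepLaw (P : Kernel (S × A) S) [IsMarkovKernel P] {π : S → A → ℝ}
    (hπ : IsPolicy π) (ν : Measure (S × A)) [IsProbabilityMeasure ν] {f : S × A → ℝ}
    (hf : IsBM f) : ∫ x, f x ∂(stepLaw P π ν) = ∫ x, transOp P π f x ∂ν := by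
  have : IsProbabilityMeasure (ν.bind P) := inferInstance
  rw [stepLaw, integral_jointLaw _ hπ hf]
  have h := (hf.policyAvg hπ).integrable (ν.bind P)
  rw [Measure.comp_eq_comp_const_apply] at h ⊢
  rw [Kernel.integral_comp h, Kernel.const_apply]
  rfl

theorem isProbabilityMeasure_iterate_stepLaw (P : Kernel (S × A) S) [IsMarkovKernel P]
    {π : S → A → ℝ} (hπ : IsPolicy π) (ρ : Measure (S × A)) [IsProbabilityMeasure ρ] (t : ℕ) :
    IsProbabilityMeasure ((stepLaw P π)^[t] ρ) := by
  induction t with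
  | zero => simpa
  | succ t ih =>
    rw [Function.iterate_succ_apply']
    exact isProbabilityMeasure_stepLaw P hπ _

theorem isProbabilityMeasure_occupancy {γ : ℝ} (h0 : 0 ≤ γ) (h1 : γ < 1) (P : Kernel (S × A) S)
    [IsMarkovKernel P] {π : S → A → ℝ} (hπ : IsPolicy π) (ρ : Measure (S × A))
    [IsProbabilityMeasure ρ] : IsProbabilityMeasure (occupancy γ P π ρ) := by
  constructor
  have (t : ℕ) : (stepLaw P π)^[t] ρ univ = 1 :=
    (isProbabilityMeasure_iterate_stepLaw P hπ ρ t).measure_univ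
  have hs : HasSum (fun t : ℕ => (1 - γ) * γ ^ t) 1 := by
    have := (hasSum_geometric_of_lt_one h0 h1).mul_left (1 - γ)
    rwa [mul_inv_cancel₀ (by linarith)] at this
  simp only [occupancy, Measure.sum_apply _ MeasurableSet.univ, Measure.smul_apply, smul_eq_mul,
    this, mul_one]
  rw [← ENNReal.ofReal_tsum_of_nonneg (fun t => mul_nonneg (by linarith) (pow_nonneg h0 t))
    hs.summable, hs.tsum_eq, ENNReal.ofReal_one]

theorem hasSum_integral_occupancy {γ : ℝ} (h0 : 0 ≤ γ) (h1 : γ < 1) (P : Kernel (S × A) S)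
    [IsMarkovKernel P] {π : S → A → ℝ} (hπ : IsPolicy π) (ρ : Measure (S × A))
    [IsProbabilityMeasure ρ] {f : S × A → ℝ} (hf : IsBM f) :
    HasSum (fun t : ℕ => (1 - γ) * γ ^ t * ∫ x, f x ∂((stepLaw P π)^[t] ρ))
      (∫ x, f x ∂(occupancy γ P π ρ)) := by
  have := isProbabilityMeasure_occupancy h0 h1 P hπ ρ
  have h := hasSum_integral_measure (hf.integrable (occupancy γ P π ρ))
  simp only [integral_smul_measure, smul_eq_mul,
    fun t => ENNReal.toReal_ofReal (mul_nonneg (sub_nonneg.2 h1.le) (pow_nonneg h0 t))] at h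
  exact h

theorem sq_transOp_le (P : Kernel (S × A) S) [IsMarkovKernel P] {π : S → A → ℝ}
    (hπ : IsPolicy π) {f : S × A → ℝ} (hf : IsBM f) (x : S × A) :
    transOp P π f x ^ 2 ≤ transOp P π (fun y => f y ^ 2) x := by
  have := isProbabilityMeasure_jointLaw (P x) hπ
  rw [transOp, transOp, ← integral_jointLaw _ hπ hf, ← integral_jointLaw _ hπ hf.sq]
  exact sq_integral_le hf _

/-- The `L²` stability of a discounted linear Bellman equation, with the forcing term measured
under the occupancy measure. -/
theorem integral_sq_le_occupancy {γ : ℝ} (h0 : 0 ≤ γ) (h1 : γ < 1) (P : Kernel (S × A) S)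
    [IsMarkovKernel P] {π : S → A → ℝ} (hπ : IsPolicy π) (ρ : Measure (S × A))
    [IsProbabilityMeasure ρ] {h w : S × A → ℝ} (hh : IsBM h) (hw : IsBM w)
    (heq : ∀ x, h x = w x + γ * transOp P π h x) :
    ∫ x, h x ^ 2 ∂ρ ≤ (∫ x, w x ^ 2 ∂(occupancy γ P π ρ)) / (1 - γ) ^ 2 := by
  have hγ : 0 < 1 - γ := by linarith
  obtain ⟨B, hB⟩ := hh.sq.bounded
  let ρt : ℕ → Measure (S × A) := fun t => (stepLaw P π)^[t] ρ
  have hρ (t : ℕ) : IsProbabilityMeasure (ρt t) := isProbabilityMeasure_iterate_stepLaw P hπ ρ t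
  -- Convexity of the square at `w / (1 - γ)` and `P^π h` with weights `1 - γ` and `γ`; the identity
  -- `e` below exhibits the deficit as a square.
  have pt (x : S × A) :
      h x ^ 2 ≤ (1 - γ)⁻¹ * w x ^ 2 + γ * transOp P π (fun y => h y ^ 2) x := by
    have j := sq_transOp_le P hπ hh x
    have e : (1 - γ)⁻¹ * w x ^ 2 + γ * transOp P π h x ^ 2 - (w x + γ * transOp P π h x) ^ 2
        = γ * (1 - γ)⁻¹ * (w x - (1 - γ) * transOp P π h x) ^ 2 := by
      field_simp; ring
    have : 0 ≤ γ * (1 - γ)⁻¹ * (w x - (1 - γ) * transOp P π h x) ^ 2 := by positivity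
    rw [heq x]
    nlinarith
  have step (t : ℕ) : ∫ x, h x ^ 2 ∂(ρt t) ≤
      (1 - γ)⁻¹ * ∫ x, w x ^ 2 ∂(ρt t) + γ * ∫ x, h x ^ 2 ∂(ρt (t + 1)) := by
    have e : ρt (t + 1) = stepLaw P π (ρt t) := Function.iterate_succ_apply' _ _ _
    rw [e, integral_stepLaw P hπ _ hh.sq, ← integral_const_mul, ← integral_const_mul,
      ← integral_add ((hw.sq.const_mul _).integrable _)
        (((hh.sq.transOp hπ).const_mul _).integrable _)]
    exact integral_mono (hh.sq.integrable _)
      (((hw.sq.const_mul _).add ((hh.sq.transOp hπ).const_mul _)).integrable _) pt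
  have hs := hasSum_integral_occupancy h0 h1 P hπ ρ hw.sq
  -- Unrolling `step` yields weights `γᵗ / (1 - γ)`, which are the occupancy weights `(1 - γ) γᵗ`
  -- divided by `(1 - γ)²`. The remainder dies since `h²` is bounded.
  have iter (n : ℕ) : ∫ x, h x ^ 2 ∂ρ ≤ ((1 - γ) ^ 2)⁻¹ *
      (∑ t ∈ Finset.range n, (1 - γ) * γ ^ t * ∫ x, w x ^ 2 ∂(ρt t)) +
        γ ^ n * ∫ x, h x ^ 2 ∂(ρt n) := by
    induction n with
    | zero => simp [ρt]
    | succ n ih =>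
      refine ih.trans ?_
      rw [Finset.sum_range_succ, mul_add, pow_succ γ]
      have := mul_le_mul_of_nonneg_left (step n) (pow_nonneg h0 n)
      have e : ((1 - γ) ^ 2)⁻¹ * ((1 - γ) * γ ^ n * ∫ x, w x ^ 2 ∂(ρt n)) =
        γ ^ n * ((1 - γ)⁻¹ * ∫ x, w x ^ 2 ∂(ρt n)) := by field_simp
      rw [e]
      linarith
  have lim : Filter.Tendsto (fun n : ℕ => ((1 - γ) ^ 2)⁻¹ *
      (∫ x, w x ^ 2 ∂(occupancy γ P π ρ)) + γ ^ n * B) Filter.atTop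
      (nhds (((1 - γ) ^ 2)⁻¹ * (∫ x, w x ^ 2 ∂(occupancy γ P π ρ)) + 0 * B)) :=
    ((tendsto_pow_atTop_nhds_zero_of_lt_one h0 h1).mul_const B).const_add _
  have fin : ∫ x, h x ^ 2 ∂ρ ≤ ((1 - γ) ^ 2)⁻¹ * (∫ x, w x ^ 2 ∂(occupancy γ P π ρ)) + 0 * B := by
    refine ge_of_tendsto' lim fun n => (iter n).trans (add_le_add ?_ ?_)
    · refine mul_le_mul_of_nonneg_left (sum_le_hasSum _ (fun t _ => ?_) hs) (by positivity)
      exact mul_nonneg (by positivity) (integral_nonneg fun x => sq_nonneg _)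
    · exact mul_le_mul_of_nonneg_left ((le_abs_self _).trans (abs_integral_le_of_abs_le _ hB))
        (pow_nonneg h0 n)
  rw [div_eq_inv_mul]
  simpa using fin

/-- Uniqueness for sup-norm contractions. -/
theorem eq_zero_of_forall_abs_le_mul {X : Type*} {γ : ℝ} (h0 : 0 ≤ γ) (h1 : γ < 1) {h : X → ℝ}
    (hb : ∃ B, ∀ x, |h x| ≤ B) (hc : ∀ D, (∀ x, |h x| ≤ D) → ∀ x, |h x| ≤ γ * D) (x : X) :
    h x = 0 := by
  obtain ⟨B, hB⟩ := hb
  have iter (n : ℕ) : ∀ x, |h x| ≤ γ ^ n * B := by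
    induction n with
    | zero => simpa using hB
    | succ n ih => intro x; rw [pow_succ', mul_assoc]; exact hc _ ih x
  have lim : Filter.Tendsto (fun n : ℕ => γ ^ n * B) Filter.atTop (nhds (0 * B)) :=
    (tendsto_pow_atTop_nhds_zero_of_lt_one h0 h1).mul_const B
  have := ge_of_tendsto' lim fun n => iter n x
  rw [zero_mul] at this
  exact abs_nonpos_iff.1 this

end Chain

/-! ### Soft values, soft policies and uniqueness of population targets. -/

section

variable {S A : Type*} [MeasurableSpace S] [Fintype A] [MeasurableSpace A]
  [MeasurableSingletonClass A]

namespace Model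

variable (M : Model S A)

instance : IsMarkovKernel M.P₁ := M.markov₁
instance : IsMarkovKernel M.P₂ := M.markov₂
instance : IsProbabilityMeasure M.ρ₁S := M.ρ₁S_prob
instance : IsProbabilityMeasure M.ρ₂ := M.ρ₂_prob
instance : IsProbabilityMeasure M.ρ₁ := isProbabilityMeasure_jointLaw M.ρ₁S M.πb_policy

theorem nonempty_state (M : Model S A) : Nonempty S := nonempty_of_isProbabilityMeasure M.ρ₁S

theorem nonempty_action (M : Model S A) : Nonempty A := by
  obtain ⟨s⟩ := M.nonempty_state
  by_contra h
  rw [not_nonempty_iff] at h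
  simpa using M.μ_policy.sum_eq_one s

/-- The partition function of the soft policy of `q`. -/
def partition (q : S × A → ℝ) (s : S) : ℝ := ∑ a, M.ref₂ s a * Real.exp (q (s, a) / M.τ₂)

theorem partition_pos (q : S × A → ℝ) (s : S) : 0 < M.partition q s :=
  have := M.nonempty_action
  Finset.sum_pos (fun a _ => mul_pos (M.ref₂_pos s a) (Real.exp_pos _)) Finset.univ_nonempty

theorem softValue_eq (q : S × A → ℝ) (s : S) :
    M.softValue q s = M.τ₂ * Real.log (M.partition q s) := rfl

theorem softPolicy_eq (q : S × A → ℝ) (s : S) (a : A) :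
    M.softPolicy q s a = M.ref₂ s a * Real.exp (q (s, a) / M.τ₂) / M.partition q s := rfl

theorem measurable_partition {q : S × A → ℝ} (hq : Measurable q) : Measurable (M.partition q) :=
  Finset.measurable_sum _ fun a _ => (M.ref₂_policy.measurable a).mul
    ((hq.comp measurable_prodMk_right).div_const _).exp

theorem isPolicy_softPolicy {q : S × A → ℝ} (hq : Measurable q) : IsPolicy (M.softPolicy q) where
  measurable a := ((M.ref₂_policy.measurable a).mul
    ((hq.comp measurable_prodMk_right).div_const _).exp).div (M.measurable_partition hq)
  nonneg s a := div_nonneg (mul_nonneg (M.ref₂_pos s a).le (Real.exp_pos _).le)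
    (M.partition_pos q s).le
  sum_eq_one s := by
    simp_rw [softPolicy_eq]
    rw [← Finset.sum_div]
    exact div_self (M.partition_pos q s).ne'

/-- The partition function is a reference-policy average of numbers between `exp (-B / τ₂)` and `exp
(B / τ₂)`. -/
theorem abs_softValue_le {q : S × A → ℝ} {B : ℝ} (hq : ∀ x, |q x| ≤ B) (s : S) :
    |M.softValue q s| ≤ B := by
  have hτ := M.τ₂_pos
  have hu : M.partition q s ≤ Real.exp (B / M.τ₂) := by
    calc M.partition q s ≤ ∑ a, M.ref₂ s a * Real.exp (B / M.τ₂) :=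
          Finset.sum_le_sum fun a _ => mul_le_mul_of_nonneg_left
            (Real.exp_le_exp.2 (by gcongr; exact (abs_le.1 (hq _)).2)) (M.ref₂_pos s a).le
      _ = _ := by rw [← Finset.sum_mul, M.ref₂_policy.sum_eq_one, one_mul]
  have hl : Real.exp (-B / M.τ₂) ≤ M.partition q s := by
    calc _ = ∑ a, M.ref₂ s a * Real.exp (-B / M.τ₂) := by
          rw [← Finset.sum_mul, M.ref₂_policy.sum_eq_one, one_mul]
      _ ≤ M.partition q s := Finset.sum_le_sum fun a _ => mul_le_mul_of_nonneg_left
            (Real.exp_le_exp.2 (by gcongr; exact (abs_le.1 (hq _)).1)) (M.ref₂_pos s a).le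
  have h1 := (Real.log_le_iff_le_exp (M.partition_pos q s)).2 hu
  have h2 := (Real.le_log_iff_exp_le (M.partition_pos q s)).2 hl
  rw [le_div_iff₀ hτ] at h1
  rw [div_le_iff₀ hτ] at h2
  rw [softValue_eq, abs_le]
  constructor <;> linarith

theorem isBM_softValue {q : S × A → ℝ} (hq : IsBM q) : IsBM (M.softValue q) :=
  ⟨(M.measurable_partition hq.measurable).log.const_mul _,
    hq.bounded.imp fun _ h => M.abs_softValue_le h⟩

/-- Convexity of the soft value: the tangent at `q'` has slope the soft policy of `q'`. -/
theorem policyAvg_softPolicy_le {q q' : S × A → ℝ} (hq' : Measurable q') (s : S) :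
    policyAvg (M.softPolicy q') (fun x => q x - q' x) s ≤ M.softValue q s - M.softValue q' s := by
  have hp := M.isPolicy_softPolicy hq'
  have hτ := M.τ₂_pos
  have hZ := M.partition_pos q s
  have hZ' := M.partition_pos q' s
  -- Jensen for `exp` under the soft policy of `q'`: the average of `exp ((q - q') / τ₂)` is the
  -- ratio of the two partition functions.
  have j := convexOn_exp.map_sum_le (t := Finset.univ) (w := M.softPolicy q' s)
    (p := fun a => (q (s, a) - q' (s, a)) / M.τ₂) (fun a _ => hp.nonneg s a) (hp.sum_eq_one s)
    (fun a _ => mem_univ _)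
  have e : ∑ a, M.softPolicy q' s a • Real.exp ((q (s, a) - q' (s, a)) / M.τ₂)
      = M.partition q s / M.partition q' s := by
    conv_rhs => rw [partition, Finset.sum_div]
    refine Finset.sum_congr rfl fun a _ => ?_
    rw [softPolicy_eq, sub_div, Real.exp_sub, smul_eq_mul]
    field_simp
  rw [e, ← Real.le_log_iff_exp_le (div_pos hZ hZ'), Real.log_div hZ.ne' hZ'.ne'] at j
  have := mul_le_mul_of_nonneg_left j hτ.le
  rw [Finset.mul_sum] at this
  rw [softValue_eq, softValue_eq, ← mul_sub]
  refine le_trans (le_of_eq ?_) this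
  refine Finset.sum_congr rfl fun a _ => ?_
  simp only [smul_eq_mul]
  field_simp

/-- The tangent inequality used in both directions. It makes the soft Bellman operator a
`γ₂`-contraction, hence uniqueness of the target value. -/
theorem abs_softValue_sub_le {q q' : S × A → ℝ} (hq : Measurable q) (hq' : Measurable q') {D : ℝ}
    (hD : ∀ x, |q x - q' x| ≤ D) (s : S) : |M.softValue q s - M.softValue q' s| ≤ D := by
  have h1 := M.policyAvg_softPolicy_le (q := q) hq' s
  have h2 := M.policyAvg_softPolicy_le (q := q') hq s
  have b1 := abs_le.1 (abs_policyAvg_le (M.isPolicy_softPolicy hq') hD s)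
  have b2 := abs_le.1 (abs_policyAvg_le (M.isPolicy_softPolicy hq)
    (f := fun x => q' x - q x) (fun x => by rw [abs_sub_comm]; exact hD x) s)
  rw [abs_le]
  constructor <;> linarith

/-- The average of the soft policies along the segment from `q` to `q'`. -/
def avgPolicy (q q' : S × A → ℝ) (s : S) (a : A) : ℝ :=
  ∫ t in (0 : ℝ)..1, M.softPolicy (fun x => (1 - t) * q x + t * q' x) s a

theorem avgPolicy_mem_pathPolicies (q q' : S × A → ℝ) : M.avgPolicy q q' ∈ M.pathPolicies q q' :=
  Or.inr rfl

theorem continuous_softPolicy_segment (q q' : S × A → ℝ) (s : S) (a : A) :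
    Continuous fun t : ℝ => M.softPolicy (fun x => (1 - t) * q x + t * q' x) s a := by
  refine Continuous.div (by fun_prop) (by fun_prop) fun t => ?_
  exact (M.partition_pos (fun x => (1 - t) * q x + t * q' x) s).ne'

theorem isPolicy_avgPolicy {q q' : S × A → ℝ} (hq : Measurable q) (hq' : Measurable q') :
    IsPolicy (M.avgPolicy q q') where
  measurable a := by
    -- Measurability jointly in the state and the segment parameter, so that integrating out the
    -- parameter leaves a measurable function of the state.
    have hm (b : A) : Measurable fun z : S × ℝ =>
        M.ref₂ z.1 b * Real.exp (((1 - z.2) * q (z.1, b) + z.2 * q' (z.1, b)) / M.τ₂) := by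
      have h1 : Measurable fun z : S × ℝ => q (z.1, b) :=
        hq.comp (measurable_fst.prodMk measurable_const)
      have h2 : Measurable fun z : S × ℝ => q' (z.1, b) :=
        hq'.comp (measurable_fst.prodMk measurable_const)
      have h3 : Measurable fun z : S × ℝ => M.ref₂ z.1 b :=
        (M.ref₂_policy.measurable b).comp measurable_fst
      fun_prop
    have h : Measurable fun z : S × ℝ =>
        M.softPolicy (fun x => (1 - z.2) * q x + z.2 * q' x) z.1 a :=
      (hm a).div (Finset.measurable_sum _ fun b _ => hm b)
    simp only [avgPolicy, intervalIntegral.integral_of_le zero_le_one]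
    exact (h.stronglyMeasurable.integral_prod_right' (ν := volume.restrict (Ioc (0 : ℝ) 1))).measurable
  nonneg s a := intervalIntegral.integral_nonneg zero_le_one fun t _ =>
    (M.isPolicy_softPolicy ((hq.const_mul _).add (hq'.const_mul _))).nonneg s a
  sum_eq_one s := by
    simp only [avgPolicy]
    rw [← intervalIntegral.integral_finsetSum
      fun a _ => (M.continuous_softPolicy_segment q q' s a).intervalIntegrable _ _]
    have (t : ℝ) := (M.isPolicy_softPolicy (q := fun x => (1 - t) * q x + t * q' x)
      ((hq.const_mul _).add (hq'.const_mul _))).sum_eq_one s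
    simp [this]

/-- The mean value theorem for the soft value along a segment. -/
theorem softValue_sub_eq_policyAvg (q q' : S × A → ℝ) (s : S) :
    M.softValue q' s - M.softValue q s = policyAvg (M.avgPolicy q q') (fun x => q' x - q x) s := by
  have hτ := M.τ₂_pos
  let c : ℝ → S × A → ℝ := fun t x => (1 - t) * q x + t * q' x
  have hd (t : ℝ) : HasDerivAt (fun t => M.softValue (c t) s)
      (∑ a, M.softPolicy (c t) s a * (q' (s, a) - q (s, a))) t := by
    have h0 (a : A) : HasDerivAt (fun t => M.ref₂ s a * Real.exp (c t (s, a) / M.τ₂))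
        (M.ref₂ s a * (Real.exp (c t (s, a) / M.τ₂) * ((q' (s, a) - q (s, a)) / M.τ₂))) t := by
      have h : HasDerivAt (fun t => c t (s, a)) (q' (s, a) - q (s, a)) t := by
        have := (((hasDerivAt_id t).const_sub 1).mul_const (q (s, a))).add
          ((hasDerivAt_id t).mul_const (q' (s, a)))
        refine this.congr_deriv ?_
        ring
      exact (h.div_const M.τ₂).exp.const_mul _
    have h1 := ((HasDerivAt.fun_sum fun a (_ : a ∈ Finset.univ) => h0 a).log
      (M.partition_pos (c t) s).ne').const_mul M.τ₂
    refine h1.congr_deriv ?_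
    rw [Finset.sum_div, Finset.mul_sum]
    refine Finset.sum_congr rfl fun a _ => ?_
    rw [softPolicy_eq, partition]
    field_simp
  have hcont : Continuous fun t : ℝ => ∑ a, M.softPolicy (c t) s a * (q' (s, a) - q (s, a)) :=
    continuous_finsetSum _ fun a _ => (M.continuous_softPolicy_segment q q' s a).mul_const _
  have h := intervalIntegral.integral_eq_sub_of_hasDerivAt (fun t _ => hd t)
    (hcont.intervalIntegrable 0 1)
  have e0 : c 0 = q := by ext x; simp [c]
  have e1 : c 1 = q' := by ext x; simp [c]
  rw [e0, e1] at h
  rw [← h, intervalIntegral.integral_finsetSum fun a _ =>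
    ((M.continuous_softPolicy_segment q q' s a).mul_const _).intervalIntegrable _ _]
  simp only [intervalIntegral.integral_mul_const]
  rfl

/-- The transferred reward differs by the advantage of the difference of the source values. -/
theorem reward_sub (q q' : S × A → ℝ) (x : S × A) : M.reward q' x - M.reward q x =
    (q' x - q x) - policyAvg M.μ (fun y => q' y - q y) x.1 := by
  rw [reward, reward, policyAvg_sub]
  ring

theorem isBM_advantage {h : S × A → ℝ} (hh : IsBM h) :
    IsBM fun x : S × A => h x - policyAvg M.μ h x.1 :=
  hh.sub ((hh.policyAvg M.μ_policy).comp measurable_fst)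

variable {M}

theorem IsSourceValue.unique {u q q' : S × A → ℝ} (hq : M.IsSourceValue u q)
    (hq' : M.IsSourceValue u q') : q = q' := by
  ext x
  refine sub_eq_zero.1 (eq_zero_of_forall_abs_le_mul M.γ₁_nonneg M.γ₁_lt_one
    (hq.bm.sub hq'.bm).bounded (fun D hD y => ?_) x)
  rw [hq.eq, hq'.eq, add_sub_add_left_eq_sub, ← mul_sub, ← transOp_sub M.μ_policy hq.bm hq'.bm,
    abs_mul, abs_of_nonneg M.γ₁_nonneg]
  exact mul_le_mul_of_nonneg_left
    (abs_integral_le_of_abs_le _ (abs_policyAvg_le M.μ_policy hD)) M.γ₁_nonneg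

theorem IsTargetValue.unique {q₁ q q' : S × A → ℝ} (hq : M.IsTargetValue q₁ q)
    (hq' : M.IsTargetValue q₁ q') : q = q' := by
  ext x
  refine sub_eq_zero.1 (eq_zero_of_forall_abs_le_mul M.γ₂_nonneg M.γ₂_lt_one
    (hq.bm.sub hq'.bm).bounded (fun D hD y => ?_) x)
  rw [hq.eq, hq'.eq, add_sub_add_left_eq_sub, ← mul_sub,
    ← integral_sub ((M.isBM_softValue hq.bm).integrable _) ((M.isBM_softValue hq'.bm).integrable _),
    abs_mul, abs_of_nonneg M.γ₂_nonneg]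
  exact mul_le_mul_of_nonneg_left (abs_integral_le_of_abs_le _
    (M.abs_softValue_sub_le hq.bm.measurable hq'.bm.measurable hD)) M.γ₂_nonneg

theorem IsTransferTarget.unique {π : S → A → ℝ} {q₁ q₂ q₁' q₂' : S × A → ℝ}
    (h : M.IsTransferTarget π q₁ q₂) (h' : M.IsTransferTarget π q₁' q₂') :
    q₁ = q₁' ∧ q₂ = q₂' := by
  obtain rfl := h.source.unique h'.source
  exact ⟨rfl, h.target.unique h'.target⟩

end Model

end

/-! ### Perturbation of the source and target values. -/

section

variable {S A : Type*} [MeasurableSpace S] [Fintype A] [MeasurableSpace A]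
  [MeasurableSingletonClass A]

theorem sq_policyAvg_le {π : S → A → ℝ} (hπ : IsPolicy π) (f : S × A → ℝ) (s : S) :
    policyAvg π f s ^ 2 ≤ policyAvg π (fun x => f x ^ 2) s := by
  simpa [policyAvg] using (even_two.convexOn_pow (𝕜 := ℝ)).map_sum_le (t := Finset.univ)
    (w := π s) (p := fun a => f (s, a)) (fun a _ => hπ.nonneg s a) (hπ.sum_eq_one s)
    (fun a _ => mem_univ _)

theorem l2norm_le_mul_l2norm {X Y : Type*} [MeasurableSpace X] [MeasurableSpace Y] {ρ : Measure X}
    {σ : Measure Y} {f : X → ℝ} {g : Y → ℝ} {c : ℝ} (hc : 0 ≤ c)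
    (h : ∫ x, f x ^ 2 ∂ρ ≤ c * ∫ y, g y ^ 2 ∂σ) : l2norm ρ f ≤ √c * l2norm σ g := by
  rw [l2norm, l2norm, ← Real.sqrt_mul hc]
  exact Real.sqrt_le_sqrt h

/-- Stability of a discounted linear Bellman equation in `L²(ρ)` under concentrability. -/
theorem l2norm_le_of_densityNorm_le {γ : ℝ} (h0 : 0 ≤ γ) (h1 : γ < 1) (P : Kernel (S × A) S)
    [IsMarkovKernel P] {π : S → A → ℝ} (hπ : IsPolicy π) (ρ : Measure (S × A))
    [IsProbabilityMeasure ρ] {κ : ℝ}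
    (hκ : densityNorm (occupancy γ P π ρ) ρ ≤ ENNReal.ofReal κ)
    {h w : S × A → ℝ} (hh : IsBM h) (hw : IsBM w) (heq : ∀ x, h x = w x + γ * transOp P π h x) :
    l2norm ρ h ≤ √κ / (1 - γ) * l2norm ρ w := by
  have hocc := isProbabilityMeasure_occupancy h0 h1 P hπ ρ
  have hγ : 0 < 1 - γ := by linarith
  have hκ0 := pos_of_densityNorm_le hκ
  have h2 := integral_le_of_densityNorm_le ENNReal.ofReal_ne_top hκ hw.sq fun x => sq_nonneg _
  rw [ENNReal.toReal_ofReal hκ0.le] at h2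
  have e : √κ / (1 - γ) = √(κ / (1 - γ) ^ 2) := by
    rw [Real.sqrt_div hκ0.le, Real.sqrt_sq hγ.le]
  rw [e]
  refine l2norm_le_mul_l2norm (by positivity) ((integral_sq_le_occupancy h0 h1 P hπ ρ hh hw
    heq).trans ?_)
  rw [div_mul_eq_mul_div]
  gcongr

namespace Model

variable {M : Model S A}

section Anchor

variable {ε : ℝ} (hε : 0 < ε) (hclip : ∀ s a, ε ≤ M.πb s a)
include hε hclip

theorem isBM_anchorRatio : IsBM fun x : S × A => M.μ x.1 x.2 / M.πb x.1 x.2 := by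
  refine ⟨M.μ_policy.measurable_uncurry.div M.πb_policy.measurable_uncurry, 1 / ε, fun x => ?_⟩
  rw [abs_of_nonneg (div_nonneg (M.μ_policy.nonneg _ _) (M.πb_policy.nonneg _ _))]
  exact div_le_div₀ zero_le_one (M.μ_policy.le_one _ _) hε (hclip _ _)

/-- Importance weighting: clipping keeps `πb` positive, so the factor `πb` in `ρ₁` cancels the
denominator. -/
theorem integral_anchorRatio_mul {f : S × A → ℝ} (hf : IsBM f) :
    ∫ x, M.μ x.1 x.2 / M.πb x.1 x.2 * f x ∂M.ρ₁ = ∫ s, policyAvg M.μ f s ∂M.ρ₁S := by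
  rw [ρ₁, integral_jointLaw _ M.πb_policy ((isBM_anchorRatio hε hclip).mul hf)]
  refine integral_congr_ae (ae_of_all _ fun s => Finset.sum_congr rfl fun a _ => ?_)
  have : 0 < M.πb s a := hε.trans_le (hclip s a)
  field_simp

theorem integral_anchorRatio_mul_le (hκ : M.kappaMu ≠ ⊤) {f : S × A → ℝ} (hf : IsBM f)
    (hf0 : ∀ x, 0 ≤ f x) :
    ∫ x, M.μ x.1 x.2 / M.πb x.1 x.2 * f x ∂M.ρ₁ ≤ M.kappaMu.toReal * ∫ x, f x ∂M.ρ₁ := by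
  rw [← integral_const_mul]
  refine integral_mono_ae (((isBM_anchorRatio hε hclip).mul hf).integrable _)
    ((hf.const_mul _).integrable _) ?_
  have h : ∀ᵐ x ∂M.ρ₁, ‖M.μ x.1 x.2 / M.πb x.1 x.2‖ₑ ≤ M.kappaMu := by
    rw [kappaMu, eLpNorm_exponent_top]
    exact ae_le_eLpNormEssSup
  filter_upwards [h] with x hx
  refine mul_le_mul_of_nonneg_right ?_ (hf0 x)
  have := (ENNReal.toReal_le_toReal enorm_ne_top hκ).2 hx
  rw [toReal_enorm] at this
  exact (Real.le_norm_self _).trans this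

/-- The ratio `μ / πb` has mean one under `ρ₁`, so its essential supremum is at least one. -/
theorem one_le_kappaMu (hκ : M.kappaMu ≠ ⊤) : 1 ≤ M.kappaMu.toReal := by
  have h := integral_anchorRatio_mul_le hε hclip hκ (IsBM.const 1) fun _ => zero_le_one
  rw [integral_anchorRatio_mul hε hclip (IsBM.const 1)] at h
  simpa [policyAvg, M.μ_policy.sum_eq_one] using h

/-- Since `1 ≤ √κ ≤ 1 / √εb`, the summand `1` is absorbed at the cost of a factor two. -/
theorem one_add_sqrt_kappaMu_le {εb : ℝ} (hεb : 0 < εb) (hκ : M.kappaMu ≤ ENNReal.ofReal (1 / εb)) :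
    1 + √M.kappaMu.toReal ≤ 2 / √εb := by
  have hκ' : M.kappaMu ≠ ⊤ := ne_top_of_le_ne_top ENNReal.ofReal_ne_top hκ
  have h1 : 1 ≤ √M.kappaMu.toReal := Real.one_le_sqrt.2 (one_le_kappaMu hε hclip hκ')
  have h2 : √M.kappaMu.toReal ≤ 1 / √εb := by
    have : M.kappaMu.toReal ≤ 1 / εb := ENNReal.toReal_le_of_le_ofReal (by positivity) hκ
    rw [← Real.sqrt_one, ← Real.sqrt_div zero_le_one]
    exact Real.sqrt_le_sqrt this
  calc _ ≤ 1 / √εb + 1 / √εb := add_le_add (h1.trans h2) h2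
    _ = _ := by ring

/-- The advantage operator `I - Π_μ` is bounded from `L²(ρ₁)` to `L²(ρ₂)`. -/
theorem l2norm_advantage_le (hχ : M.chi ≠ ⊤) (hκ : M.kappaMu ≠ ⊤) {h : S × A → ℝ} (hh : IsBM h) :
    l2norm M.ρ₂ (fun x => h x - policyAvg M.μ h x.1) ≤
      √M.chi.toReal * ((1 + √M.kappaMu.toReal) * l2norm M.ρ₁ h) := by
  have hp : IsBM fun x : S × A => policyAvg M.μ h x.1 :=
    (hh.policyAvg M.μ_policy).comp measurable_fst
  have hb := hh.policyAvg M.μ_policy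
  have h1 : l2norm M.ρ₁ (fun x => policyAvg M.μ h x.1) ≤ √M.kappaMu.toReal * l2norm M.ρ₁ h := by
    refine l2norm_le_mul_l2norm ENNReal.toReal_nonneg ?_
    -- Jensen over actions moves the square inside the `μ`-average; the change of action law from
    -- `πb` to `μ` then costs `κ_{μ|π_{b1}}`.
    refine le_trans ?_ (integral_anchorRatio_mul_le hε hclip hκ hh.sq fun x => sq_nonneg _)
    rw [integral_anchorRatio_mul hε hclip hh.sq, ρ₁, integral_jointLaw _ M.πb_policy hp.sq]
    refine integral_mono ((hp.sq.policyAvg M.πb_policy).integrable _)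
      ((hh.sq.policyAvg M.μ_policy).integrable _) fun s => ?_
    have : policyAvg M.πb (fun x => policyAvg M.μ h x.1 ^ 2) s = policyAvg M.μ h s ^ 2 := by
      rw [policyAvg]
      simp only
      rw [← Finset.sum_mul, M.πb_policy.sum_eq_one, one_mul]
    simp only [this]
    exact sq_policyAvg_le M.μ_policy h s
  have h2 : l2norm M.ρ₁ (fun x => h x - policyAvg M.μ h x.1) ≤
      l2norm M.ρ₁ h + l2norm M.ρ₁ (fun x => policyAvg M.μ h x.1) := by
    simpa [sub_eq_add_neg, l2norm_neg] using l2norm_add_le hh hp.neg M.ρ₁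
  have h3 := l2norm_le_mul_l2norm ENNReal.toReal_nonneg
    (integral_le_of_densityNorm_le hχ le_rfl (M.isBM_advantage hh).sq fun x => sq_nonneg _)
  refine h3.trans (mul_le_mul_of_nonneg_left ?_ (Real.sqrt_nonneg _))
  linarith

/-- Perturbation of the target value with respect to the source value. -/
theorem l2norm_target_sub_le (hχ : M.chi ≠ ⊤) (hκ : M.kappaMu ≠ ⊤) {q₁ q₁' q₂ q₂' : S × A → ℝ}
    (hq₁ : IsBM q₁) (hq₁' : IsBM q₁') (hq₂ : M.IsTargetValue q₁ q₂)
    (hq₂' : M.IsTargetValue q₁' q₂') {κ : ℝ} (hpath : M.PathConcentrability q₂ q₂' κ) :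
    l2norm M.ρ₂ (fun x => q₂' x - q₂ x) ≤
      (1 + √M.kappaMu.toReal) * √(κ * M.chi.toReal) / (1 - M.γ₂) *
        l2norm M.ρ₁ (fun x => q₁' x - q₁ x) := by
  have hw := M.isBM_advantage (hq₁'.sub hq₁)
  have hπ := M.isPolicy_avgPolicy hq₂.bm.measurable hq₂'.bm.measurable
  have hden := hpath _ (M.avgPolicy_mem_pathPolicies q₂ q₂')
  have hocc := isProbabilityMeasure_occupancy M.γ₂_nonneg M.γ₂_lt_one M.P₂ hπ M.ρ₂
  have hκ0 := pos_of_densityNorm_le hden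
  have hγ : 0 < 1 - M.γ₂ := by linarith [M.γ₂_lt_one]
  -- Although the target equation is nonlinear, the difference of two solutions solves a linear
  -- Bellman equation for the averaged policy, forced by the advantage of the source difference.
  have h1 := l2norm_le_of_densityNorm_le M.γ₂_nonneg M.γ₂_lt_one M.P₂ hπ M.ρ₂ hden
    (hq₂'.bm.sub hq₂.bm) hw fun x => by
      rw [hq₂'.eq, hq₂.eq, ← M.reward_sub, transOp]
      simp_rw [← M.softValue_sub_eq_policyAvg]
      rw [integral_sub ((M.isBM_softValue hq₂'.bm).integrable _)
        ((M.isBM_softValue hq₂.bm).integrable _)]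
      ring
  refine h1.trans ((mul_le_mul_of_nonneg_left (l2norm_advantage_le hε hclip hχ hκ
    (hq₁'.sub hq₁)) (by positivity)).trans (le_of_eq ?_))
  rw [Real.sqrt_mul hκ0.le]
  ring

end Anchor

/-- Perturbation of the source value with respect to the behavior policy. -/
theorem l2norm_source_sub_le {κ : ℝ}
    (hκ : densityNorm (occupancy M.γ₁ M.P₁ M.μ M.ρ₁) M.ρ₁ ≤ ENNReal.ofReal κ)
    {u u' q q' : S × A → ℝ} (hq : M.IsSourceValue u q) (hq' : M.IsSourceValue u' q')
    (hu : IsBM fun x => u' x - u x) :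
    l2norm M.ρ₁ (fun x => q' x - q x) ≤ √κ / (1 - M.γ₁) * l2norm M.ρ₁ (fun x => u' x - u x) := by
  refine l2norm_le_of_densityNorm_le M.γ₁_nonneg M.γ₁_lt_one M.P₁ M.μ_policy M.ρ₁ hκ
    (hq'.bm.sub hq.bm) hu fun x => ?_
  rw [transOp_sub M.μ_policy hq'.bm hq.bm, hq.eq, hq'.eq]
  ring

end Model

end

/-! ### Sub-Gaussian concentration for transition samples, and scalar logarithm inequalities. -/

open scoped NNReal

/-- Hoeffding's lemma for an interval of half-width `B`. The sign is that of mean minus value, the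
only direction of deviation used later. -/
theorem hasSubgaussianMGF_of_abs_sub_le {Z : Type*} [MeasurableSpace Z] {ν : Measure Z}
    [IsProbabilityMeasure ν] {f : Z → ℝ} (hf : Measurable f) {k : ℝ} {B : ℝ≥0}
    (hB : ∀ z, |f z - k| ≤ B) : HasSubgaussianMGF (fun z => ∫ y, f y ∂ν - f z) (B ^ 2) ν := by
  have h := (hasSubgaussianMGF_of_mem_Icc (μ := ν) (a := k - B) (b := k + B) hf.aemeasurable
    (ae_of_all _ fun z => by
      have := abs_le.1 (hB z)
      constructor <;> linarith)).neg
  have e : ‖(k + B : ℝ) - (k - B)‖₊ / 2 = B := by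
    have : (k + B : ℝ) - (k - B) = 2 * (B : ℝ) := by ring
    rw [this]
    ext
    simp
  rw [e] at h
  refine h.congr (ae_of_all _ fun z => ?_)
  simp

theorem IsBM.exp {Z : Type*} [MeasurableSpace Z] {f : Z → ℝ} (hf : IsBM f) :
    IsBM fun z => Real.exp (f z) := by
  obtain ⟨B, hB⟩ := hf.bounded
  refine ⟨hf.measurable.exp, Real.exp B, fun z => ?_⟩
  rw [abs_of_pos (Real.exp_pos _)]
  exact Real.exp_le_exp.2 (abs_le.1 (hB z)).2

/-- Two-step Hoeffding lemma: the fluctuation of `h` given the first coordinate and the conditional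
mean of `h` both have range of half-width `B`. -/
theorem hasSubgaussianMGF_compProd {X Y : Type*} [MeasurableSpace X] [MeasurableSpace Y]
    (ρ : Measure X) [IsProbabilityMeasure ρ] (P : Kernel X Y) [IsMarkovKernel P] {h : X × Y → ℝ}
    (hh : IsBM h) {k : X → ℝ} {B : ℝ≥0} (hk : ∀ x y, |h (x, y) - k x| ≤ B)
    (hm : ∀ x, |∫ y, h (x, y) ∂(P x)| ≤ B) :
    HasSubgaussianMGF (fun z => ∫ w, h w ∂(ρ ⊗ₘ P) - h z) (2 * B ^ 2) (ρ ⊗ₘ P) := by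
  set E := ∫ w, h w ∂(ρ ⊗ₘ P) with hE
  let m : X → ℝ := fun x => ∫ y, h (x, y) ∂(P x)
  have hmm : IsBM m := by
    refine ⟨?_, B, hm⟩
    exact (hh.measurable.stronglyMeasurable.integral_kernel_prod_right' (κ := P)).measurable
  have hEm : E = ∫ x, m x ∂ρ := Measure.integral_compProd (hh.integrable _)
  have h1 := hasSubgaussianMGF_of_abs_sub_le (ν := ρ) hmm.measurable (k := 0) (B := B)
    fun x => by simpa using hm x
  have h2 (x : X) := hasSubgaussianMGF_of_abs_sub_le (ν := P x) (f := fun y => h (x, y))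
    (hh.measurable.comp measurable_prodMk_left) (hk x)
  have hint (t : ℝ) : IsBM fun z => Real.exp (t * (E - h z)) :=
    (((IsBM.const E).sub hh).const_mul t).exp
  refine ⟨fun t => (hint t).integrable _, fun t => ?_⟩
  rw [mgf, Measure.integral_compProd ((hint t).integrable _)]
  -- Given the first coordinate, the exponent splits into the deviation of the conditional mean `m
  -- x` and a centred fluctuation. Each contributes a proxy `B²`.
  have b (x : X) : ∫ y, Real.exp (t * (E - h (x, y))) ∂(P x) ≤
      Real.exp (((B ^ 2 : ℝ≥0) : ℝ) * t ^ 2 / 2) * Real.exp (t * (E - m x)) := by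
    have e (y : Y) : Real.exp (t * (E - h (x, y))) =
        Real.exp (t * (E - m x)) * Real.exp (t * (m x - h (x, y))) := by
      rw [← Real.exp_add]
      ring_nf
    simp_rw [e]
    rw [integral_const_mul, mul_comm]
    exact mul_le_mul_of_nonneg_right ((h2 x).mgf_le t) (Real.exp_pos _).le
  have hbm : IsBM fun x => Real.exp (t * (E - m x)) :=
    (((IsBM.const E).sub hmm).const_mul t).exp
  have hl : IsBM fun x => ∫ y, Real.exp (t * (E - h (x, y))) ∂(P x) := by
    obtain ⟨D, hD⟩ := (hint t).bounded
    exact ⟨((hint t).measurable.stronglyMeasurable.integral_kernel_prod_right' (κ := P)).measurable,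
      D, fun x => abs_integral_le_of_abs_le _ fun y => hD (x, y)⟩
  calc ∫ x, ∫ y, Real.exp (t * (E - h (x, y))) ∂(P x) ∂ρ
      ≤ ∫ x, Real.exp (((B ^ 2 : ℝ≥0) : ℝ) * t ^ 2 / 2) * Real.exp (t * (E - m x)) ∂ρ :=
        integral_mono (hl.integrable _) ((hbm.const_mul _).integrable _) b
    _ = Real.exp (((B ^ 2 : ℝ≥0) : ℝ) * t ^ 2 / 2) * mgf (fun x => ∫ y, m y ∂ρ - m x) ρ t := by
        rw [integral_const_mul, ← hEm]
        rfl
    _ ≤ Real.exp (((B ^ 2 : ℝ≥0) : ℝ) * t ^ 2 / 2) * Real.exp (((B ^ 2 : ℝ≥0) : ℝ) * t ^ 2 / 2) :=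
        mul_le_mul_of_nonneg_left (h1.mgf_le t) (Real.exp_pos _).le
    _ = _ := by
        rw [← Real.exp_add]
        push_cast
        ring_nf

/-- Chernoff bound for the empirical mean of a sub-Gaussian function of an i.i.d. sample. -/
theorem measure_pi_lt_integral_sub_empMean_le {Z : Type*} [MeasurableSpace Z] {ν : Measure Z}
    [IsProbabilityMeasure ν] {f : Z → ℝ} {c : ℝ≥0}
    (hf : HasSubgaussianMGF (fun z => ∫ y, f y ∂ν - f z) c ν) {n : ℕ} (hn : 0 < n) {l : ℝ}
    (hl : 0 ≤ l) :
    (Measure.pi fun _ : Fin n => ν) {d | √c * √(2 * l / n) < ∫ z, f z ∂ν - empMean d f} ≤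
      ENNReal.ofReal (Real.exp (-l)) := by
  set μ := Measure.pi fun _ : Fin n => ν
  set X : Z → ℝ := fun z => ∫ y, f y ∂ν - f z
  have hn' : (0 : ℝ) < n := by exact_mod_cast hn
  have hind : iIndepFun (fun (i : Fin n) (d : Fin n → Z) => X (d i)) μ :=
    iIndepFun_pi fun _ => hf.aemeasurable
  have hsub (i : Fin n) : HasSubgaussianMGF (fun d : Fin n → Z => X (d i)) c μ := by
    refine HasSubgaussianMGF.of_map (Y := fun d : Fin n → Z => d i) (X := X)
      (measurable_pi_apply i).aemeasurable ?_
    rwa [(measurePreserving_eval (fun _ : Fin n => ν) i).map_eq]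
  have hsum := HasSubgaussianMGF.sum_of_iIndepFun hind (s := Finset.univ) fun i _ => hsub i
  have e (d : Fin n → Z) : ∑ i, X (d i) = n * (∫ z, f z ∂ν - empMean d f) := by
    simp only [X, empMean, Finset.sum_sub_distrib, Finset.sum_const, Finset.card_univ,
      Fintype.card_fin, nsmul_eq_mul]
    field_simp
  simp_rw [e] at hsum
  simp only [Finset.sum_const, Finset.card_univ, Fintype.card_fin, nsmul_eq_mul] at hsum
  -- The exponent of the tail bound divides by the proxy. At proxy zero the deviation vanishes
  -- almost surely, and the strict inequality in the event makes it null.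
  rcases eq_or_ne c 0 with rfl | hc
  · rw [mul_zero] at hsum
    have h0 := hsum.ae_eq_zero_of_hasSubgaussianMGF_zero
    refine le_of_eq_of_le (measure_mono_null (fun d hd => ?_) (ae_iff.1 h0)) zero_le
    have : 0 < ∫ z, f z ∂ν - empMean d f := by simpa using hd
    exact (mul_pos hn' this).ne'
  · have hc' : (0 : ℝ) < c := by exact_mod_cast pos_iff_ne_zero.2 hc
    have ht := hsum.measure_ge_le (ε := n * (√c * √(2 * l / n))) (by positivity)
    have ex : -(n * (√c * √(2 * l / n))) ^ 2 / (2 * ((n * c : ℝ≥0) : ℝ)) = -l := by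
      rw [mul_pow, mul_pow, Real.sq_sqrt hc'.le, Real.sq_sqrt (by positivity)]
      push_cast
      field_simp
    rw [ex] at ht
    refine (measure_mono fun d hd => ?_).trans
      ((ENNReal.le_ofReal_iff_toReal_le (measure_ne_top _ _) (Real.exp_pos _).le).2 ht)
    exact mul_le_mul_of_nonneg_left (le_of_lt hd) hn'.le

theorem measurable_empMean {Z : Type*} [MeasurableSpace Z] {f : Z → ℝ} (hf : Measurable f)
    {n : ℕ} : Measurable fun d : Fin n → Z => empMean d f :=
  (Finset.measurable_sum _ fun i _ => hf.comp (measurable_pi_apply i)).div_const _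

theorem empMean_sub {Z : Type*} {n : ℕ} (d : Fin n → Z) (f g : Z → ℝ) :
    empMean d (fun z => f z - g z) = empMean d f - empMean d g := by
  simp [empMean, Finset.sum_sub_distrib, sub_div]

/-- The difference of the two sides vanishes at zero and has derivative `y (exp y - 1) ≥ 0`. With `y
= -log r` it settles the case `r ≤ 1` of the next lemma. -/
theorem sq_div_two_le_one_add_sub_one_mul_exp {y : ℝ} (hy : 0 ≤ y) :
    y ^ 2 / 2 ≤ 1 + (y - 1) * Real.exp y := by
  have hd (x : ℝ) : HasDerivAt (fun x : ℝ => 1 + (x - 1) * Real.exp x - x ^ 2 / 2)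
      (x * (Real.exp x - 1)) x := by
    have h := ((((hasDerivAt_id x).sub_const 1).mul (Real.hasDerivAt_exp x)).const_add 1).sub
      (((hasDerivAt_id x).pow 2).div_const 2)
    refine h.congr_deriv ?_
    simp
    ring
  have hmono : MonotoneOn (fun x : ℝ => 1 + (x - 1) * Real.exp x - x ^ 2 / 2) (Ici 0) := by
    refine monotoneOn_of_deriv_nonneg (convex_Ici 0)
      (fun x _ => (hd x).continuousAt.continuousWithinAt)
      (fun x _ => (hd x).differentiableAt.differentiableWithinAt) fun x hx => ?_
    rw [interior_Ici] at hx
    rw [(hd x).deriv]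
    exact mul_nonneg (le_of_lt hx) (sub_nonneg.2 (Real.one_le_exp (le_of_lt hx)))
  have := hmono (mem_Ici.2 le_rfl) (mem_Ici.2 hy) hy
  norm_num at this
  linarith

/-- A quadratic lower bound on the Bregman divergence of the logarithm. -/
theorem mul_sq_log_le {ε r : ℝ} (hε₀ : 0 < ε) (hε₁ : ε ≤ 1) (hr : ε ≤ r) :
    ε / 2 * Real.log r ^ 2 ≤ r - 1 - Real.log r := by
  have hr0 : 0 < r := hε₀.trans_le hr
  rcases le_total 0 (Real.log r) with h | h
  · have := Real.quadratic_le_exp_of_nonneg h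
    rw [Real.exp_log hr0] at this
    nlinarith [sq_nonneg (Real.log r)]
  · have := sq_div_two_le_one_add_sub_one_mul_exp (neg_nonneg.2 h)
    rw [Real.exp_neg, Real.exp_log hr0] at this
    have h2 := mul_le_mul_of_nonneg_left this hr0.le
    have e : r * (1 + (-Real.log r - 1) * r⁻¹) = r - 1 - Real.log r := by field_simp; ring
    rw [e] at h2
    nlinarith [sq_nonneg (Real.log r)]

/-! ### Relative entropy and the cross-entropy minimizer. -/

section

variable {S A : Type*} [MeasurableSpace S] [Fintype A] [MeasurableSpace A]
  [MeasurableSingletonClass A]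

/-- The log-likelihood ratio of `π` to `π'`. -/
def logRatio (π π' : S → A → ℝ) (x : S × A) : ℝ := Real.log (π x.1 x.2) - Real.log (π' x.1 x.2)

section Clipped

variable {ε : ℝ} (hε₀ : 0 < ε) {π π' : S → A → ℝ} (hπ : IsPolicy π) (hπ' : IsPolicy π')
  (hc : ∀ s a, ε ≤ π s a) (hc' : ∀ s a, ε ≤ π' s a)
include hε₀ hπ hπ' hc hc'

theorem abs_logRatio_le (x : S × A) : |logRatio π π' x| ≤ Real.log (1 / ε) := by
  have b {p : ℝ} (h : ε ≤ p) (h1 : p ≤ 1) : Real.log ε ≤ Real.log p ∧ Real.log p ≤ 0 :=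
    ⟨Real.log_le_log hε₀ h, Real.log_nonpos (hε₀.le.trans h) h1⟩
  have h1 := b (hc x.1 x.2) (hπ.le_one _ _)
  have h2 := b (hc' x.1 x.2) (hπ'.le_one _ _)
  rw [one_div, Real.log_inv, logRatio, abs_le]
  constructor <;> linarith

theorem isBM_logRatio : IsBM (logRatio π π') :=
  ⟨hπ.measurable_uncurry.log.sub hπ'.measurable_uncurry.log, _,
    abs_logRatio_le hε₀ hπ hπ' hc hc'⟩

/-- The mean square log-likelihood ratio is bounded by the relative entropy. -/
theorem integral_sq_logRatio_le (hε₁ : ε ≤ 1) (ν : Measure S) [IsProbabilityMeasure ν] :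
    ∫ x, logRatio π π' x ^ 2 ∂(jointLaw ν π') ≤
      2 / ε * ∫ x, logRatio π' π x ∂(jointLaw ν π') := by
  have hb := isBM_logRatio hε₀ hπ hπ' hc hc'
  have hb' := isBM_logRatio hε₀ hπ' hπ hc' hc
  rw [integral_jointLaw ν hπ' hb.sq, integral_jointLaw ν hπ' hb', ← integral_const_mul]
  refine integral_mono ((hb.sq.policyAvg hπ').integrable _)
    (((hb'.policyAvg hπ').const_mul _).integrable _) fun s => ?_
  -- The scalar inequality at `r = π / π'`, multiplied by `π'`. Here `r ≥ ε` because `π' ≤ 1`. On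
  -- summing over actions the linear part `π - π'` disappears.
  have key (a : A) : ε / 2 * (π' s a * logRatio π π' (s, a) ^ 2) ≤
      π s a - π' s a + π' s a * logRatio π' π (s, a) := by
    have h1 : 0 < π s a := hε₀.trans_le (hc s a)
    have h2 : 0 < π' s a := hε₀.trans_le (hc' s a)
    have hr : ε ≤ π s a / π' s a := by
      rw [le_div_iff₀ h2]
      nlinarith [hc s a, hπ'.le_one s a]
    have h := mul_le_mul_of_nonneg_left (mul_sq_log_le hε₀ hε₁ hr) h2.le
    rw [Real.log_div h1.ne' h2.ne'] at h
    have e : π' s a * (π s a / π' s a) = π s a := by field_simp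
    simp only [logRatio]
    nlinarith
  have hsum := Finset.sum_le_sum fun a (_ : a ∈ Finset.univ) => key a
  rw [Finset.sum_add_distrib, Finset.sum_sub_distrib, hπ.sum_eq_one, hπ'.sum_eq_one, sub_self,
    zero_add, ← Finset.mul_sum] at hsum
  change ε / 2 * policyAvg π' (fun x => logRatio π π' x ^ 2) s ≤ policyAvg π' (logRatio π' π) s
    at hsum
  change policyAvg π' (fun x => logRatio π π' x ^ 2) s ≤ 2 / ε * policyAvg π' (logRatio π' π) s
  rw [div_mul_eq_mul_div, le_div_iff₀ hε₀]
  linarith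

end Clipped

namespace Model

variable {M : Model S A}

/-- The relative entropy of the empirical cross-entropy minimizer is at most `ε_CE` with high
probability. -/
theorem measure_epsCE_lt_le {nb : ℕ} (hnb : 0 < nb) {δ : ℝ} (hδ₀ : 0 < δ) (hδ₁ : δ < 1)
    {pols : Finset (S → A → ℝ)} (hpols : ∀ π ∈ pols, IsPolicy π) (hreal : M.πb ∈ pols)
    {ε : ℝ} (hε₀ : 0 < ε) (hε₁ : ε ≤ 1) (hclip : ∀ π ∈ pols, ∀ s a, ε ≤ π s a)
    {πhat : (Fin nb → S × A) → S → A → ℝ} (hπhat : IsCEMinimizer pols πhat) :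
    (Measure.pi fun _ : Fin nb => M.ρ₁)
      {d | epsCE ε pols.card nb δ < ∫ x, logRatio M.πb (πhat d) x ∂M.ρ₁} ≤
        ENNReal.ofReal (δ / 8) := by
  classical
  set N := pols.card with hN
  have hN1 : 1 ≤ N := Finset.card_pos.2 ⟨_, hreal⟩
  have hNr : (1 : ℝ) ≤ N := by exact_mod_cast hN1
  have hL : 0 ≤ Real.log (1 / ε) := Real.log_nonneg (by rw [le_div_iff₀ hε₀]; linarith)
  have hlog : 0 ≤ Real.log (N / δ) := Real.log_nonneg (by rw [le_div_iff₀ hδ₀]; linarith)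
  have hnb' : (0 : ℝ) < nb := by exact_mod_cast hnb
  have single (π : S → A → ℝ) (hπ : π ∈ pols) : (Measure.pi fun _ : Fin nb => M.ρ₁)
      {d | epsCE ε N nb δ < ∫ x, logRatio M.πb π x ∂M.ρ₁ - empMean d (logRatio M.πb π)} ≤
        ENNReal.ofReal ((δ / N) ^ 4) := by
    have hb := isBM_logRatio hε₀ M.πb_policy (hpols π hπ) (hclip _ hreal) (hclip π hπ)
    have hsub := hasSubgaussianMGF_of_abs_sub_le (ν := M.ρ₁) hb.measurable (k := 0)
      (B := (Real.log (1 / ε)).toNNReal) fun x => by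
        rw [sub_zero, Real.coe_toNNReal _ hL]
        exact abs_logRatio_le hε₀ M.πb_policy (hpols π hπ) (hclip _ hreal) (hclip π hπ) x
    -- The factor 2 in `epsCE` doubles the deviation and so quadruples the exponent, giving `(δ /
    -- N)⁴` per policy.
    have h := measure_pi_lt_integral_sub_empMean_le hsub hnb (l := 4 * Real.log (N / δ))
      (by positivity)
    have e1 : √(((Real.log (1 / ε)).toNNReal ^ 2 : NNReal) : ℝ) * √(2 * (4 * Real.log (N / δ)) / nb)
        = epsCE ε N nb δ := by
      have e4 : 2 * (4 * Real.log (N / δ)) / nb = 2 ^ 2 * (2 * Real.log (N / δ) / nb) := by ring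
      rw [e4, Real.sqrt_mul (by positivity), Real.sqrt_sq (by norm_num), epsCE]
      push_cast
      rw [Real.coe_toNNReal _ hL, Real.sqrt_sq hL]
      ring
    have e2 : Real.exp (-(4 * Real.log (N / δ))) = (δ / N) ^ 4 := by
      have : -(4 * Real.log (N / δ)) = ((4 : ℕ) : ℝ) * Real.log (δ / N) := by
        rw [← inv_div, Real.log_inv]
        push_cast
        ring
      rw [this, Real.exp_nat_mul, Real.exp_log (by positivity)]
    rwa [e1, e2] at h
  -- The minimizer has nonpositive empirical log-likelihood ratio, so a large relative entropy is
  -- itself a large deviation. The true policy has relative entropy zero and drops out of the union.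
  have hsubset : {d | epsCE ε N nb δ < ∫ x, logRatio M.πb (πhat d) x ∂M.ρ₁} ⊆
      ⋃ π ∈ pols.erase M.πb,
        {d | epsCE ε N nb δ < ∫ x, logRatio M.πb π x ∂M.ρ₁ - empMean d (logRatio M.πb π)} := by
    intro d hd
    simp only [mem_ofPred_eq] at hd
    have hε : 0 ≤ epsCE ε N nb δ := by rw [epsCE]; positivity
    have hne : πhat d ≠ M.πb := by
      intro h
      rw [h] at hd
      simp only [logRatio, sub_self, integral_zero] at hd
      exact hε.not_gt hd
    refine mem_biUnion (x := πhat d) (Finset.mem_coe.2 (Finset.mem_erase.2 ⟨hne, hπhat.mem d⟩)) ?_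
    have hle := hπhat.le d _ hreal
    have e : empMean d (logRatio M.πb (πhat d)) =
        crossEntropy d (πhat d) - crossEntropy d M.πb := by
      rw [crossEntropy, crossEntropy, ← empMean_sub]
      congr 1
      ext x
      rw [logRatio]
      ring
    simp only [mem_ofPred_eq]
    linarith
  refine (measure_mono hsubset).trans ((measure_biUnion_finset_le _ _).trans
    ((Finset.sum_le_sum fun π hπ => single π (Finset.mem_of_mem_erase hπ)).trans ?_))
  rw [Finset.sum_const, Finset.card_erase_of_mem hreal, ← hN, nsmul_eq_mul,
    ← ENNReal.ofReal_natCast, ← ENNReal.ofReal_mul (by positivity)]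
  refine ENNReal.ofReal_le_ofReal ?_
  -- Erasing the true policy leaves an empty union when `N = 1`; otherwise `N³ ≥ 8` produces the
  -- factor `1 / 8`.
  rcases Nat.lt_or_ge 1 N with h2 | h1
  · have hN2 : (2 : ℝ) ≤ N := by exact_mod_cast h2
    have hcast : ((N - 1 : ℕ) : ℝ) ≤ N := by exact_mod_cast Nat.sub_le N 1
    have h8 : (8 : ℝ) ≤ (N : ℝ) ^ 3 := by
      calc (8 : ℝ) = 2 ^ 3 := by norm_num
        _ ≤ _ := by gcongr
    have hd4 : δ ^ 4 ≤ δ := pow_le_of_le_one hδ₀.le hδ₁.le (by norm_num)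
    calc ((N - 1 : ℕ) : ℝ) * (δ / N) ^ 4 ≤ N * (δ / N) ^ 4 := by gcongr
      _ = δ ^ 4 / N ^ 3 := by field_simp
      _ ≤ δ / 8 := div_le_div₀ hδ₀.le hd4 (by norm_num) h8
  · have : N - 1 = 0 := by omega
    rw [this]
    simp only [Nat.cast_zero, zero_mul]
    positivity

end Model

end

/-! ### The Lagrangian gap: concentration and population value. -/

section Gap

variable {X Y : Type*} [MeasurableSpace X] [MeasurableSpace Y]

/-- The difference of two Lagrangian terms, the second with vanishing Bellman residual. -/
theorem lagrangian_gap (ρ : Measure X) [IsProbabilityMeasure ρ] (P : Kernel X Y)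
    [IsMarkovKernel P] {a r r' l l' : X → ℝ} {v v' : Y → ℝ} {γ Ba BL Bv R : ℝ} (hγ : 0 ≤ γ)
    (ha : IsBM a) (hr : IsBM r) (hr' : IsBM r') (hl : IsBM l) (hl' : IsBM l') (hv : IsBM v)
    (hv' : IsBM v') (hBL : 0 ≤ BL) (ba : ∀ x, |a x| ≤ Ba) (bl : ∀ x, |l x| ≤ BL)
    (bl' : ∀ x, |l' x| ≤ BL) (bv : ∀ y, |v y| ≤ Bv) (bv' : ∀ y, |v' y| ≤ Bv)
    (br : ∀ x y, |r x + γ * v y| ≤ R) (hR : 2 * γ * Bv ≤ R)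
    (hres : ∀ x, r' x + γ * ∫ y, v' y ∂(P x) = 0) {h : X × Y → ℝ}
    (hh : ∀ x y, h (x, y) = a x + l x * (r x + γ * v y) - l' x * (r' x + γ * v' y)) :
    IsBM h ∧ HasSubgaussianMGF (fun z => ∫ w, h w ∂(ρ ⊗ₘ P) - h z)
      (2 * (Ba + BL * R).toNNReal ^ 2) (ρ ⊗ₘ P) ∧
    ∫ w, h w ∂(ρ ⊗ₘ P) = ∫ x, (a x + l x * (r x + γ * ∫ y, v y ∂(P x))) ∂ρ := by
  obtain ⟨x₀⟩ := nonempty_of_isProbabilityMeasure ρ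
  have : Nonempty Y := nonempty_of_isProbabilityMeasure (P x₀)
  obtain ⟨y₀⟩ := this
  have hBa : 0 ≤ Ba := (abs_nonneg _).trans (ba x₀)
  have hR0 : 0 ≤ R := (abs_nonneg _).trans (br x₀ y₀)
  have hB : 0 ≤ Ba + BL * R := by positivity
  have hbm : IsBM h := by
    have e : h = fun z : X × Y => a z.1 + l z.1 * (r z.1 + γ * v z.2)
        - l' z.1 * (r' z.1 + γ * v' z.2) := by
      ext ⟨x, y⟩
      exact hh x y
    rw [e]
    exact ((ha.comp measurable_fst).add ((hl.comp measurable_fst).mul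
      ((hr.comp measurable_fst).add ((hv.comp measurable_snd).const_mul γ)))).sub
      ((hl'.comp measurable_fst).mul
        ((hr'.comp measurable_fst).add ((hv'.comp measurable_snd).const_mul γ)))
  -- Averaging over the next state annihilates the `l'` term by `hres`. The conditional mean is thus
  -- bounded by one Lagrangian term instead of two.
  have mean (x : X) : ∫ y, h (x, y) ∂(P x) = a x + l x * (r x + γ * ∫ y, v y ∂(P x)) := by
    have hi := hv.integrable (P x)
    have hi' := hv'.integrable (P x)
    have e : ∫ y, h (x, y) ∂(P x) = ∫ y, (a x + l x * r x - l' x * r' x)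
        + (l x * γ * v y - l' x * γ * v' y) ∂(P x) := by
      congr 1
      ext y
      rw [hh]
      ring
    rw [e, integral_add (integrable_const _) (((hv.const_mul _).sub (hv'.const_mul _)).integrable _),
      integral_sub (hi.const_mul _) (hi'.const_mul _), integral_const_mul, integral_const_mul]
    simp only [integral_const, probReal_univ, one_smul]
    linear_combination (-l' x) * hres x
  refine ⟨hbm, ?_, ?_⟩
  · refine hasSubgaussianMGF_compProd ρ P hbm (k := fun x => a x + l x * r x - l' x * r' x)
      (fun x y => ?_) fun x => ?_
    · rw [Real.coe_toNNReal _ hB]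
      -- Only the next-state values fluctuate, so the half-width is `2 γ BL Bv`, within `BL R` by
      -- `hR`.
      have e : h (x, y) - (a x + l x * r x - l' x * r' x) = γ * (l x * v y - l' x * v' y) := by
        rw [hh]
        ring
      have b : |l x * v y - l' x * v' y| ≤ BL * Bv + BL * Bv := by
        refine (abs_sub _ _).trans ?_
        rw [abs_mul, abs_mul]
        exact add_le_add (mul_le_mul (bl x) (bv y) (abs_nonneg _) hBL)
          (mul_le_mul (bl' x) (bv' y) (abs_nonneg _) hBL)
      rw [e, abs_mul, abs_of_nonneg hγ]
      have h1 := mul_le_mul_of_nonneg_left b hγ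
      have h2 := mul_le_mul_of_nonneg_left hR hBL
      linarith
    · rw [Real.coe_toNNReal _ hB, mean]
      have b : |r x + γ * ∫ y, v y ∂(P x)| ≤ R := by
        have e : r x + γ * ∫ y, v y ∂(P x) = ∫ y, r x + γ * v y ∂(P x) := by
          rw [integral_add (integrable_const _) ((hv.integrable _).const_mul _),
            integral_const_mul]
          simp
        rw [e]
        exact abs_integral_le_of_abs_le _ (br x)
      refine (abs_add_le _ _).trans (add_le_add (ba x) ?_)
      rw [abs_mul]
      exact mul_le_mul (bl x) b (abs_nonneg _) hBL
  · rw [Measure.integral_compProd (hbm.integrable _)]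
    simp_rw [mean]

/-- Both squares lie in `[0, B²]`, which avoids the factor two of the triangle inequality. -/
theorem abs_sq_sub_sq_le {p q B : ℝ} (hp : |p| ≤ B) (hq : |q| ≤ B) : |p ^ 2 - q ^ 2| ≤ B ^ 2 := by
  have h1 := sq_le_sq' (abs_le.1 hp).1 (abs_le.1 hp).2
  have h2 := sq_le_sq' (abs_le.1 hq).1 (abs_le.1 hq).2
  rw [abs_le]
  constructor <;> nlinarith [sq_nonneg p, sq_nonneg q]

end Gap

/-! ### Source and target gaps. -/

section

variable {S A : Type*} [MeasurableSpace S] [Fintype A] [MeasurableSpace A]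
  [MeasurableSingletonClass A]

namespace Model

variable (M : Model S A)

/-- The difference of two source terms. -/
def sourceGap (β : ℝ) (u q l q' l' : S × A → ℝ) (z : (S × A) × S) : ℝ :=
  M.sourceTerm β u q l z - M.sourceTerm β u q' l' z

/-- The difference of two target terms. -/
def targetGap (q₁ q₂ l q₁' q₂' l' : S × A → ℝ) (z : (S × A) × S) : ℝ :=
  M.targetTerm q₁ q₂ l z - M.targetTerm q₁' q₂' l' z

variable {M}

/-- An instance of `lagrangian_gap`. Subtracting the equation for `q'` rewrites the residual of `q`
as minus the linear Bellman operator applied to `q - q'`, the form in which a dual identity can be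
inserted. -/
theorem sourceGap_properties {β U BQ BL : ℝ} (hβ : 0 ≤ β) (hBL : 0 ≤ BL)
    {u q l q' l' : S × A → ℝ} (hu : Measurable u) (hq : Measurable q) (hl : Measurable l)
    (hl' : Measurable l') (bu : ∀ x, |u x| ≤ U) (bq : ∀ x, |q x| ≤ BQ) (bq' : ∀ x, |q' x| ≤ BQ)
    (bl : ∀ x, |l x| ≤ BL) (bl' : ∀ x, |l' x| ≤ BL) (hv : M.IsSourceValue u q') :
    IsBM (M.sourceGap β u q l q' l') ∧
    HasSubgaussianMGF
      (fun z => ∫ w, M.sourceGap β u q l q' l' w ∂(M.ρ₁ ⊗ₘ M.P₁) - M.sourceGap β u q l q' l' z)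
      (2 * (β / 2 * BQ ^ 2 + BL * (U + (M.γ₁ + 1) * BQ)).toNNReal ^ 2) (M.ρ₁ ⊗ₘ M.P₁) ∧
    ∫ w, M.sourceGap β u q l q' l' w ∂(M.ρ₁ ⊗ₘ M.P₁) =
      (∫ x, β / 2 * (q x ^ 2 - q' x ^ 2) ∂M.ρ₁) -
        ∫ x, l x * ((q x - q' x) - M.γ₁ * transOp M.P₁ M.μ (fun y => q y - q' y) x) ∂M.ρ₁ := by
  have Bu : IsBM u := ⟨hu, U, bu⟩
  have Bq : IsBM q := ⟨hq, BQ, bq⟩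
  have Bq' := hv.bm
  have Bl : IsBM l := ⟨hl, BL, bl⟩
  have hγ0 := M.γ₁_nonneg
  obtain ⟨x₀⟩ := nonempty_of_isProbabilityMeasure M.ρ₁
  have hBQ : 0 ≤ BQ := (abs_nonneg _).trans (bq x₀)
  have hU : 0 ≤ U := (abs_nonneg _).trans (bu x₀)
  have pq := abs_policyAvg_le M.μ_policy bq
  obtain ⟨h1, h2, h3⟩ := lagrangian_gap M.ρ₁ M.P₁ (γ := M.γ₁) (Ba := β / 2 * BQ ^ 2) (BL := BL)
    (Bv := BQ) (R := U + (M.γ₁ + 1) * BQ) (a := fun x => β / 2 * (q x ^ 2 - q' x ^ 2))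
    (r := fun x => u x - q x) (r' := fun x => u x - q' x) (l := l) (l' := l')
    (v := policyAvg M.μ q) (v' := policyAvg M.μ q') (h := M.sourceGap β u q l q' l') hγ0
    ((Bq.sq.sub Bq'.sq).const_mul _) (Bu.sub Bq) (Bu.sub Bq') Bl ⟨hl', BL, bl'⟩
    (Bq.policyAvg M.μ_policy) (Bq'.policyAvg M.μ_policy) hBL
    (fun x => by
      rw [abs_mul, abs_of_nonneg (by positivity)]
      exact mul_le_mul_of_nonneg_left (abs_sq_sub_sq_le (bq x) (bq' x)) (by positivity))
    bl bl' pq (abs_policyAvg_le M.μ_policy bq')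
    (fun x y => by
      have b1 := abs_le.1 (bu x)
      have b2 := abs_le.1 (bq x)
      have b3 := abs_le.1 (pq y)
      rw [abs_le]
      constructor <;> nlinarith)
    (by nlinarith [M.γ₁_lt_one])
    (fun x => by
      have := hv.eq x
      rw [transOp] at this
      linarith)
    (fun x y => by
      simp only [sourceGap, sourceTerm]
      ring)
  refine ⟨h1, h2, h3.trans ?_⟩
  have Bh := Bq.sub Bq'
  rw [← integral_sub (((Bq.sq.sub Bq'.sq).const_mul _).integrable _)
    ((Bl.mul (Bh.sub ((Bh.transOp M.μ_policy).const_mul _))).integrable _)]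
  refine integral_congr_ae (ae_of_all _ fun x => ?_)
  have e := hv.eq x
  simp only
  rw [transOp_sub M.μ_policy Bq Bq', transOp, e]
  ring

/-- The population source gap under the modular source dual is half the squared error. -/
theorem integral_sourceGap_modular {U BQ BL : ℝ} (hBL : 0 ≤ BL)
    {u q l q' l' : S × A → ℝ} (hu : Measurable u) (hq : Measurable q) (hl : Measurable l)
    (hl' : Measurable l') (bu : ∀ x, |u x| ≤ U) (bq : ∀ x, |q x| ≤ BQ) (bq' : ∀ x, |q' x| ≤ BQ)
    (bl : ∀ x, |l x| ≤ BL) (bl' : ∀ x, |l' x| ≤ BL) (hv : M.IsSourceValue u q')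
    (hdual : M.IsModularSourceDual q' l) :
    ∫ w, M.sourceGap 1 u q l q' l' w ∂(M.ρ₁ ⊗ₘ M.P₁) =
      1 / 2 * l2norm M.ρ₁ (fun x => q x - q' x) ^ 2 := by
  have Bq : IsBM q := ⟨hq, BQ, bq⟩
  have Bq' := hv.bm
  rw [(sourceGap_properties zero_le_one hBL hu hq hl hl' bu bq bq' bl bl' hv).2.2,
    hdual _ (Bq.sub Bq'), sq_l2norm, ← integral_const_mul,
    ← integral_sub (((Bq.sq.sub Bq'.sq).const_mul _).integrable _)
      ((Bq'.mul (Bq.sub Bq')).integrable _)]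
  congr 1
  ext x
  ring

/-- Another instance of `lagrangian_gap`. The dual identity supplies `⟨q₂', q₂ - q₂'⟩`, which
completes the square; convexity of the soft value gives an inequality, and the source error survives
as a cross term weighted by the dual. -/
theorem targetGap_properties {BG BQ₁ BQ₂ BL : ℝ} (hBL : 0 ≤ BL)
    {q₁ q₂ l q₁' q₂' l' : S × A → ℝ} (hq₁ : Measurable q₁) (hq₂ : Measurable q₂)
    (hl : Measurable l) (hl' : Measurable l') (hq₁' : IsBM q₁') (g0 : ∀ s, 0 ≤ M.g s)
    (g1 : ∀ s, M.g s ≤ BG) (hC : |M.C| ≤ 2 * BQ₁) (bq₁ : ∀ x, |q₁ x| ≤ BQ₁)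
    (bq₂ : ∀ x, |q₂ x| ≤ BQ₂) (bq₂' : ∀ x, |q₂' x| ≤ BQ₂)
    (bl : ∀ x, |l x| ≤ BL) (bl' : ∀ x, |l' x| ≤ BL) (hv : M.IsTargetValue q₁' q₂') :
    IsBM (M.targetGap q₁ q₂ l q₁' q₂' l') ∧
    HasSubgaussianMGF
      (fun z => ∫ w, M.targetGap q₁ q₂ l q₁' q₂' l' w ∂(M.ρ₂ ⊗ₘ M.P₂) -
        M.targetGap q₁ q₂ l q₁' q₂' l' z)
      (2 * (1 / 2 * BQ₂ ^ 2 + BL * (4 * BQ₁ + BG + (M.γ₂ + 1) * BQ₂)).toNNReal ^ 2)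
      (M.ρ₂ ⊗ₘ M.P₂) ∧
    (M.IsTargetDual q₂' l →
      1 / 2 * l2norm M.ρ₂ (fun x => q₂ x - q₂' x) ^ 2 +
        ∫ x, l x * ((q₁ x - q₁' x) - policyAvg M.μ (fun y => q₁ y - q₁' y) x.1) ∂M.ρ₂ ≤
      ∫ w, M.targetGap q₁ q₂ l q₁' q₂' l' w ∂(M.ρ₂ ⊗ₘ M.P₂)) := by
  have Bq₁ : IsBM q₁ := ⟨hq₁, BQ₁, bq₁⟩
  have Bq₂ : IsBM q₂ := ⟨hq₂, BQ₂, bq₂⟩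
  have Bq₂' := hv.bm
  have Bl : IsBM l := ⟨hl, BL, bl⟩
  have Bg : IsBM M.g := ⟨M.g_measurable, BG, fun s => by rw [abs_of_nonneg (g0 s)]; exact g1 s⟩
  have BR {q : S × A → ℝ} (hq : IsBM q) : IsBM (M.reward q) :=
    ((M.isBM_advantage hq).add (Bg.comp measurable_fst)).add (IsBM.const M.C)
  have hγ0 := M.γ₂_nonneg
  have hγ1 := M.γ₂_lt_one
  obtain ⟨x₀⟩ := nonempty_of_isProbabilityMeasure M.ρ₂
  have hBQ₁ : 0 ≤ BQ₁ := (abs_nonneg _).trans (bq₁ x₀)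
  have hBQ₂ : 0 ≤ BQ₂ := (abs_nonneg _).trans (bq₂ x₀)
  have hBG : 0 ≤ BG := (g0 x₀.1).trans (g1 x₀.1)
  have pq := abs_policyAvg_le M.μ_policy bq₁
  obtain ⟨h1, h2, h3⟩ := lagrangian_gap M.ρ₂ M.P₂ (γ := M.γ₂) (Ba := 1 / 2 * BQ₂ ^ 2) (BL := BL)
    (Bv := BQ₂) (R := 4 * BQ₁ + BG + (M.γ₂ + 1) * BQ₂)
    (a := fun x => 1 / 2 * (q₂ x ^ 2 - q₂' x ^ 2))
    (r := fun x => M.reward q₁ x - q₂ x) (r' := fun x => M.reward q₁' x - q₂' x) (l := l) (l' := l')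
    (v := M.softValue q₂) (v' := M.softValue q₂') (h := M.targetGap q₁ q₂ l q₁' q₂' l') hγ0
    ((Bq₂.sq.sub Bq₂'.sq).const_mul _) ((BR Bq₁).sub Bq₂) ((BR hq₁').sub Bq₂') Bl ⟨hl', BL, bl'⟩
    (M.isBM_softValue Bq₂) (M.isBM_softValue Bq₂') hBL
    (fun x => by
      rw [abs_mul, abs_of_nonneg (by positivity)]
      exact mul_le_mul_of_nonneg_left (abs_sq_sub_sq_le (bq₂ x) (bq₂' x)) (by positivity))
    bl bl' (M.abs_softValue_le bq₂) (M.abs_softValue_le bq₂')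
    (fun x y => by
      have b1 := abs_le.1 (bq₁ x)
      have b2 := abs_le.1 (bq₂ x)
      have b3 := abs_le.1 (pq x.1)
      have b4 := abs_le.1 (M.abs_softValue_le bq₂ y)
      have b5 := abs_le.1 hC
      have b6 := g0 x.1
      have b7 := g1 x.1
      simp only [reward]
      rw [abs_le]
      constructor <;> nlinarith)
    (by nlinarith)
    (fun x => by
      have := hv.eq x
      linarith)
    (fun x y => by
      simp only [targetGap, targetTerm]
      ring)
  refine ⟨h1, h2, fun hdual => ?_⟩
  have Bh := Bq₂.sub Bq₂'
  have hπ := M.isPolicy_softPolicy Bq₂'.measurable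
  have BA := M.isBM_advantage (Bq₁.sub hq₁')
  have Bpi := (M.isBM_softValue Bq₂).integral_kernel M.P₂
  have hd := hdual.adjoint _ Bh
  have Bd := Bl.mul (Bh.sub ((Bh.transOp (P := M.P₂) hπ).const_mul M.γ₂))
  have e : 1 / 2 * l2norm M.ρ₂ (fun x => q₂ x - q₂' x) ^ 2 =
      (∫ x, 1 / 2 * (q₂ x ^ 2 - q₂' x ^ 2) ∂M.ρ₂) - ∫ x, q₂' x * (q₂ x - q₂' x) ∂M.ρ₂ := by
    rw [sq_l2norm, ← integral_const_mul,
      ← integral_sub (((Bq₂.sq.sub Bq₂'.sq).const_mul _).integrable _)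
        ((Bq₂'.mul Bh).integrable _)]
    congr 1
    ext x
    ring
  rw [e, ← hd, h3, ← integral_sub (((Bq₂.sq.sub Bq₂'.sq).const_mul _).integrable _)
    (Bd.integrable _), ← integral_add ((((Bq₂.sq.sub Bq₂'.sq).const_mul _).sub Bd).integrable _)
    ((Bl.mul BA).integrable _)]
  refine integral_mono_ae (((((Bq₂.sq.sub Bq₂'.sq).const_mul _).sub Bd).add
    (Bl.mul BA)).integrable _) ((((Bq₂.sq.sub Bq₂'.sq).const_mul _).add
    (Bl.mul (((BR Bq₁).sub Bq₂).add (Bpi.const_mul M.γ₂)))).integrable _) ?_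
  -- Nonnegativity of the dual lets the pointwise tangent inequality for the soft value be
  -- multiplied by `l`.
  filter_upwards [hdual.nonneg] with x hx
  have t : transOp M.P₂ (M.softPolicy q₂') (fun y => q₂ y - q₂' y) x ≤
      ∫ y, M.softValue q₂ y ∂(M.P₂ x) - ∫ y, M.softValue q₂' y ∂(M.P₂ x) := by
    rw [← integral_sub ((M.isBM_softValue Bq₂).integrable _)
      ((M.isBM_softValue Bq₂').integrable _)]
    exact integral_mono ((Bh.policyAvg hπ).integrable _)
      (((M.isBM_softValue Bq₂).sub (M.isBM_softValue Bq₂')).integrable _)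
      (M.policyAvg_softPolicy_le Bq₂'.measurable)
  have t' := mul_le_mul_of_nonneg_left t hγ0
  have hr := M.reward_sub q₁' q₁ x
  have hv' := hv.eq x
  have key : (q₁ x - q₁' x - policyAvg M.μ (fun y => q₁ y - q₁' y) x.1)
      - (q₂ x - q₂' x - M.γ₂ * transOp M.P₂ (M.softPolicy q₂') (fun y => q₂ y - q₂' y) x)
      ≤ M.reward q₁ x - q₂ x + M.γ₂ * ∫ y, M.softValue q₂ y ∂(M.P₂ x) := by
    rw [← hr]
    linarith
  have := mul_le_mul_of_nonneg_left key hx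
  linarith

end Model

end

/-! ### Uniform deviations over finite classes, conditionally on an independent variable. -/

section UnionBound

/-- The samples on which some member of a finite two-parameter family of functions has a mean
exceeding its empirical mean by more than `t`. -/
def deviationSet {Z X Y : Type*} [MeasurableSpace Z] (ν : Measure Z) (n : ℕ) (Q : Finset X)
    (L : Finset Y) (F : X → Y → Z → ℝ) (t : ℝ) : Set (Fin n → Z) :=
  ⋃ p ∈ Q ×ˢ L, {d | t < ∫ z, F p.1 p.2 z ∂ν - empMean d (F p.1 p.2)}

theorem integral_sub_empMean_le_of_notMem {Z X Y : Type*} [MeasurableSpace Z] {ν : Measure Z}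
    {n : ℕ} {Q : Finset X} {L : Finset Y} {F : X → Y → Z → ℝ} {t : ℝ} {d : Fin n → Z}
    (hd : d ∉ deviationSet ν n Q L F t) {q : X} (hq : q ∈ Q) {l : Y} (hl : l ∈ L) :
    ∫ z, F q l z ∂ν - empMean d (F q l) ≤ t := by
  by_contra h
  exact hd (mem_biUnion (x := (q, l)) (Finset.mem_coe.2 (Finset.mk_mem_product hq hl))
    (not_le.1 h))

variable {Z X Y : Type*} [MeasurableSpace Z] {ν : Measure Z} [IsProbabilityMeasure ν]

theorem measurableSet_deviationSet {n : ℕ} {Q : Finset X} {L : Finset Y} {F : X → Y → Z → ℝ}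
    {t : ℝ} (hF : ∀ q ∈ Q, ∀ l ∈ L, IsBM (F q l)) : MeasurableSet (deviationSet ν n Q L F t) := by
  refine Finset.measurableSet_biUnion _ fun p hp => ?_
  obtain ⟨h1, h2⟩ := Finset.mem_product.1 hp
  exact measurableSet_lt measurable_const
    (measurable_const.sub (measurable_empMean (hF _ h1 _ h2).measurable))

theorem measure_deviationSet_le {n : ℕ} (hn : 0 < n) {Q : Finset X} {L : Finset Y}
    {F : X → Y → Z → ℝ} {B : ℝ} (hB : 0 ≤ B)
    (hF : ∀ q ∈ Q, ∀ l ∈ L, HasSubgaussianMGF (fun z => ∫ w, F q l w ∂ν - F q l z)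
      (2 * B.toNNReal ^ 2) ν)
    {k : ℝ} (hk : 1 ≤ k) {δ : ℝ} (hδ₀ : 0 < δ) (hδ₁ : δ < 1) :
    (Measure.pi fun _ : Fin n => ν) (deviationSet ν n Q L F
      (2 * B * √(2 * Real.log (k * (Q.card * L.card : ℕ) / δ) / n))) ≤
        ENNReal.ofReal (δ / k ^ 2) := by
  set N := Q.card * L.card with hN
  rcases Nat.eq_zero_or_pos N with h0 | h1
  · have : Q ×ˢ L = ∅ := by rw [← Finset.card_eq_zero, Finset.card_product, ← hN, h0]
    simp [deviationSet, this]
  have hN1 : (1 : ℝ) ≤ N := by exact_mod_cast h1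
  have hlog : 0 ≤ Real.log (k * N / δ) :=
    Real.log_nonneg (by rw [le_div_iff₀ hδ₀]; nlinarith)
  have hn' : (0 : ℝ) < n := by exact_mod_cast hn
  have hk0 : 0 < k := by linarith
  have single (p : X × Y) (hp : p ∈ Q ×ˢ L) : (Measure.pi fun _ : Fin n => ν)
      {d | 2 * B * √(2 * Real.log (k * N / δ) / n) <
        ∫ z, F p.1 p.2 z ∂ν - empMean d (F p.1 p.2)} ≤ ENNReal.ofReal ((δ / (k * N)) ^ 2) := by
    obtain ⟨hq, hl⟩ := Finset.mem_product.1 hp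
    -- The proxy `2B²` with exponent `2 log (k N / δ)` gives exactly the threshold `2B √(2 log (k N
    -- / δ) / n)`. Each tail is then `(δ / (k N))²`, and the sum over `N` pairs is at most `δ / k²`.
    have h := measure_pi_lt_integral_sub_empMean_le (hF _ hq _ hl) hn
      (l := 2 * Real.log (k * N / δ)) (by positivity)
    have e1 : √((2 * B.toNNReal ^ 2 : NNReal) : ℝ) * √(2 * (2 * Real.log (k * N / δ)) / n)
        = 2 * B * √(2 * Real.log (k * N / δ) / n) := by
      push_cast
      rw [Real.coe_toNNReal _ hB, ← Real.sqrt_mul (by positivity)]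
      have e4 : 2 * B ^ 2 * (2 * (2 * Real.log (k * N / δ)) / n) =
          (2 * B) ^ 2 * (2 * Real.log (k * N / δ) / n) := by ring
      rw [e4, Real.sqrt_mul (by positivity), Real.sqrt_sq (by positivity)]
    have e2 : Real.exp (-(2 * Real.log (k * N / δ))) = (δ / (k * N)) ^ 2 := by
      have : -(2 * Real.log (k * N / δ)) = ((2 : ℕ) : ℝ) * Real.log (δ / (k * N)) := by
        rw [← inv_div, Real.log_inv]
        push_cast
        ring
      rw [this, Real.exp_nat_mul, Real.exp_log (by positivity)]
    rwa [e1, e2] at h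
  refine (measure_biUnion_finset_le _ _).trans ((Finset.sum_le_sum single).trans ?_)
  rw [Finset.sum_const, Finset.card_product, ← hN, nsmul_eq_mul, ← ENNReal.ofReal_natCast,
    ← ENNReal.ofReal_mul (by positivity)]
  refine ENNReal.ofReal_le_ofReal ?_
  have hd2 : δ ^ 2 ≤ δ := pow_le_of_le_one hδ₀.le hδ₁.le (by norm_num)
  calc (N : ℝ) * (δ / (k * N)) ^ 2 = δ ^ 2 / (k ^ 2 * N) := by field_simp
    _ ≤ δ / k ^ 2 := div_le_div₀ hδ₀.le hd2 (by positivity) (le_mul_of_one_le_right (by positivity) hN1)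

/-- A conditional bound on an event whose shape depends on finitely many values of an independent
variable. -/
theorem measure_le_of_map_prod {Ω X Y ι : Type*} [MeasurableSpace Ω] [MeasurableSpace X]
    [MeasurableSpace Y] {Pr : Measure Ω} {μ : Measure X} [IsProbabilityMeasure μ] {ν : Measure Y}
    [IsProbabilityMeasure ν] {U : Ω → X} {V : Ω → Y} (hU : Measurable U) (hV : Measurable V)
    (h : Pr.map (fun ω => (U ω, V ω)) = μ.prod ν) (I : Finset ι) (c : X → ι)
    (hc : ∀ i ∈ I, MeasurableSet {x | c x = i}) (G : ι → Set Y)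
    (hG : ∀ i ∈ I, MeasurableSet (G i)) {η : ℝ≥0∞} (hη : ∀ i ∈ I, ν (G i) ≤ η) :
    Pr {ω | c (U ω) ∈ I ∧ V ω ∈ G (c (U ω))} ≤ η := by
  let T : Set (X × Y) := {z | c z.1 ∈ I ∧ z.2 ∈ G (c z.1)}
  have hT : MeasurableSet T := by
    have e : T = ⋃ i ∈ I, {x | c x = i} ×ˢ G i := by
      ext ⟨x, y⟩
      simp [T]
    rw [e]
    exact Finset.measurableSet_biUnion _ fun i hi => (hc i hi).prod (hG i hi)
  have e : {ω | c (U ω) ∈ I ∧ V ω ∈ G (c (U ω))} = (fun ω => (U ω, V ω)) ⁻¹' T := rfl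
  rw [e, ← Measure.map_apply (hU.prodMk hV) hT, h, Measure.prod_apply hT]
  calc ∫⁻ x, ν (Prod.mk x ⁻¹' T) ∂μ ≤ ∫⁻ _, η ∂μ := by
        refine lintegral_mono fun x => ?_
        by_cases hx : c x ∈ I
        · refine (measure_mono fun y hy => ?_).trans (hη _ hx)
          exact hy.2
        · have : Prod.mk x ⁻¹' T = ∅ := by
            ext y
            simp [T, hx]
          simp [this]
    _ = η := by simp

end UnionBound

/-! ### Marginals of the samples and the policy-learning term. -/

section

variable {S A : Type*} [MeasurableSpace S] [Fintype A] [MeasurableSpace A]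
  [MeasurableSingletonClass A]

namespace Model

variable {M : Model S A}

section Sample

variable {Ω : Type*} [MeasurableSpace Ω] {Pr : Measure Ω} [IsProbabilityMeasure Pr] {nb n₁ n₂ : ℕ}
  {Db : Ω → Fin nb → S × A} {D₁ : Ω → Fin n₁ → (S × A) × S} {D₂ : Ω → Fin n₂ → (S × A) × S}

theorem IsSample.map_demonstrations (h : M.IsSample Pr Db D₁ D₂) :
    Pr.map Db = Measure.pi fun _ => M.ρ₁ := by
  have e := congrArg (Measure.map Prod.fst) h.law
  rwa [Measure.map_map measurable_fst (h.meas_b.prodMk (h.meas₁.prodMk h.meas₂)),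
    Measure.map_fst_prod, measure_univ, one_smul] at e

theorem IsSample.map_demonstrations_source (h : M.IsSample Pr Db D₁ D₂) :
    Pr.map (fun ω => (Db ω, D₁ ω)) =
      (Measure.pi fun _ => M.ρ₁).prod (Measure.pi fun _ => M.ρ₁ ⊗ₘ M.P₁) := by
  have e := congrArg (Measure.map (Prod.map id Prod.fst)) h.law
  rwa [Measure.map_map (measurable_id.prodMap measurable_fst)
    (h.meas_b.prodMk (h.meas₁.prodMk h.meas₂)), ← Measure.map_prod_map _ _ measurable_id
    measurable_fst, Measure.map_id, Measure.map_fst_prod, measure_univ, one_smul] at e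

theorem IsSample.map_demonstrations_target (h : M.IsSample Pr Db D₁ D₂) :
    Pr.map (fun ω => (Db ω, D₂ ω)) =
      (Measure.pi fun _ => M.ρ₁).prod (Measure.pi fun _ => M.ρ₂ ⊗ₘ M.P₂) := by
  have e := congrArg (Measure.map (Prod.map id Prod.snd)) h.law
  rwa [Measure.map_map (measurable_id.prodMap measurable_snd)
    (h.meas_b.prodMk (h.meas₁.prodMk h.meas₂)), ← Measure.map_prod_map _ _ measurable_id
    measurable_snd, Measure.map_id, Measure.map_snd_prod, measure_univ, one_smul] at e

theorem IsSample.map_assoc (h : M.IsSample Pr Db D₁ D₂) :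
    Pr.map (fun ω => ((Db ω, D₁ ω), D₂ ω)) =
      ((Measure.pi fun _ => M.ρ₁).prod (Measure.pi fun _ => M.ρ₁ ⊗ₘ M.P₁)).prod
        (Measure.pi fun _ => M.ρ₂ ⊗ₘ M.P₂) := by
  have e := congrArg (Measure.map MeasurableEquiv.prodAssoc.symm) h.law
  rw [Measure.map_map (MeasurableEquiv.measurable _)
    (h.meas_b.prodMk (h.meas₁.prodMk h.meas₂)), ← Measure.prodAssoc_prod,
    Measure.map_map (MeasurableEquiv.measurable _) (MeasurableEquiv.measurable _),
    MeasurableEquiv.symm_comp_self, Measure.map_id] at e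
  exact e

end Sample

theorem PathConcentrability.pos {q q' : S × A → ℝ} (hq : Measurable q) (hq' : Measurable q')
    {κ : ℝ} (h : M.PathConcentrability q q' κ) : 0 < κ :=
  have := isProbabilityMeasure_occupancy M.γ₂_nonneg M.γ₂_lt_one M.P₂ (M.isPolicy_avgPolicy hq hq')
    M.ρ₂
  pos_of_densityNorm_le (h _ (M.avgPolicy_mem_pathPolicies q q'))

/-- The effect on the target value of learning the behavior policy. -/
theorem l2norm_target_sub_le_learningTerm {ε : ℝ} (hε₀ : 0 < ε) (hε₁ : ε ≤ 1)
    (hclip : ∀ s a, ε ≤ M.πb s a) {π : S → A → ℝ} (hπ : IsPolicy π) (hclip' : ∀ s a, ε ≤ π s a)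
    {q₁ q₂ q₁' q₂' : S × A → ℝ} (ht : M.IsTransferTarget M.πb q₁ q₂)
    (ht' : M.IsTransferTarget π q₁' q₂') {κ₁ κpath : ℝ}
    (hκ₁ : densityNorm (occupancy M.γ₁ M.P₁ M.μ M.ρ₁) M.ρ₁ ≤ ENNReal.ofReal κ₁)
    (hpath : M.PathConcentrability q₂ q₂' κpath) (hχ : M.chi ≠ ⊤) (hκμ : M.kappaMu ≠ ⊤)
    {N nb : ℕ} {δ : ℝ} (hCE : ∫ x, logRatio M.πb π x ∂M.ρ₁ ≤ epsCE ε N nb δ) :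
    l2norm M.ρ₂ (fun x => q₂' x - q₂ x) ≤ M.learningTerm κ₁ κpath ε N nb δ := by
  have hb := isBM_logRatio hε₀ hπ M.πb_policy hclip' hclip
  have hγ₁ : 0 < 1 - M.γ₁ := by linarith [M.γ₁_lt_one]
  have hγ₂ : 0 < 1 - M.γ₂ := by linarith [M.γ₂_lt_one]
  have hocc := isProbabilityMeasure_occupancy M.γ₁_nonneg M.γ₁_lt_one M.P₁ M.μ_policy M.ρ₁
  have hκ₁0 : 0 < κ₁ := pos_of_densityNorm_le hκ₁
  -- The anchor function and the reference policy are common to both signals, so only the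
  -- log-likelihood ratio remains as forcing term.
  have hsig : (fun x => M.signal π x - M.signal M.πb x) = logRatio π M.πb := by
    ext x
    rw [signal, signal, logRatio, Real.log_div (hε₀.trans_le (hclip' _ _)).ne' (M.ref₁_pos _ _).ne',
      Real.log_div (hε₀.trans_le (hclip _ _)).ne' (M.ref₁_pos _ _).ne']
    ring
  have h1 := l2norm_target_sub_le hε₀ hclip hχ hκμ ht.source.bm ht'.source.bm ht.target ht'.target
    hpath
  have h2 := l2norm_source_sub_le hκ₁ ht.source ht'.source (by rw [hsig]; exact hb)
  rw [hsig] at h2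
  have h3 : l2norm M.ρ₁ (logRatio π M.πb) ≤ √(2 / ε * epsCE ε N nb δ) := by
    refine Real.sqrt_le_sqrt ((integral_sq_logRatio_le hε₀ hπ M.πb_policy hclip' hclip hε₁
      M.ρ₁S).trans ?_)
    exact mul_le_mul_of_nonneg_left hCE (by positivity)
  calc _ ≤ (1 + √M.kappaMu.toReal) * √(κpath * M.chi.toReal) / (1 - M.γ₂) *
        (√κ₁ / (1 - M.γ₁) * √(2 / ε * epsCE ε N nb δ)) := by
        refine h1.trans (mul_le_mul_of_nonneg_left (h2.trans ?_) (by positivity))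
        exact mul_le_mul_of_nonneg_left h3 (by positivity)
    _ = _ := by
        rw [learningTerm, mul_assoc κ₁, Real.sqrt_mul hκ₁0.le]
        field_simp

theorem measurable_signal {π : S → A → ℝ} (hπ : IsPolicy π) : Measurable (M.signal π) :=
  (hπ.measurable_uncurry.div M.ref₁_policy.measurable_uncurry).log.sub
    (M.g_measurable.comp measurable_fst)

theorem abs_signal_le {π : S → A → ℝ} {BU BG : ℝ}
    (hU : ∀ s a, |Real.log (π s a / M.ref₁ s a)| ≤ BU) (g0 : ∀ s, 0 ≤ M.g s)
    (g1 : ∀ s, M.g s ≤ BG) (x : S × A) : |M.signal π x| ≤ BU + BG := by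
  have h1 := abs_le.1 (hU x.1 x.2)
  have h2 := g0 x.1
  have h3 := g1 x.1
  rw [signal, abs_le]
  constructor <;> linarith

end Model

end

/-! ### Deterministic error bounds outside the deviation sets. -/

section

variable {S A : Type*} [MeasurableSpace S] [Fintype A] [MeasurableSpace A]
  [MeasurableSingletonClass A]

namespace Model

variable {M : Model S A}

theorem empMean_sourceGap {n : ℕ} (d : Fin n → (S × A) × S) (β : ℝ) (u q l q' l' : S × A → ℝ) :
    empMean d (M.sourceGap β u q l q' l') =
      empMean d (M.sourceTerm β u q l) - empMean d (M.sourceTerm β u q' l') :=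
  empMean_sub d _ _

theorem empMean_targetGap {n : ℕ} (d : Fin n → (S × A) × S) (q₁ q₂ l q₁' q₂' l' : S × A → ℝ) :
    empMean d (M.targetGap q₁ q₂ l q₁' q₂' l') =
      empMean d (M.targetTerm q₁ q₂ l) - empMean d (M.targetTerm q₁' q₂' l') :=
  empMean_sub d _ _

section Deterministic

variable {c : Constants} {Q₁ Q₂ L₁ L₂ : Finset (S × A → ℝ)} (henv : M.Envelope c Q₁ Q₂ L₂)
  {π : S → A → ℝ} (hπ : IsPolicy π) {q₁ q₂ : S × A → ℝ}
  (hsys : M.SystemConditions c Q₁ Q₂ π q₁ q₂) {n₁ n₂ : ℕ}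
include henv

theorem Envelope.nonneg_BL₂ {l : S × A → ℝ} (hl : l ∈ L₂) : 0 ≤ M.BL₂ c := by
  obtain ⟨x₀⟩ := nonempty_of_isProbabilityMeasure M.ρ₂
  exact (abs_nonneg _).trans (henv.bound_L₂ l hl x₀)

/-- The target gap over the finite classes, relative to a realizable target value. -/
theorem targetGap_of_mem {p₁ p₂ q l l' q' : S × A → ℝ} (hp₁ : p₁ ∈ Q₁) (hp₂ : p₂ ∈ Q₂)
    (hl : l ∈ L₂) (hl' : l' ∈ L₂) (hq : IsBM q) (hq' : q' ∈ Q₂) (hv : M.IsTargetValue q q') :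
    IsBM (M.targetGap p₁ p₂ l q q' l') ∧
    HasSubgaussianMGF
      (fun z => ∫ w, M.targetGap p₁ p₂ l q q' l' w ∂(M.ρ₂ ⊗ₘ M.P₂) - M.targetGap p₁ p₂ l q q' l' z)
      (2 * (M.M₂ c).toNNReal ^ 2) (M.ρ₂ ⊗ₘ M.P₂) ∧
    (M.IsTargetDual q' l →
      1 / 2 * l2norm M.ρ₂ (fun x => p₂ x - q' x) ^ 2 +
        ∫ x, l x * ((p₁ x - q x) - policyAvg M.μ (fun y => p₁ y - q y) x.1) ∂M.ρ₂ ≤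
      ∫ w, M.targetGap p₁ p₂ l q q' l' w ∂(M.ρ₂ ⊗ₘ M.P₂)) :=
  targetGap_properties (henv.nonneg_BL₂ hl) (henv.meas_Q₁ _ hp₁) (henv.meas_Q₂ _ hp₂)
    (henv.meas_L₂ _ hl) (henv.meas_L₂ _ hl') hq henv.g_nonneg henv.g_le henv.shift
    (henv.bound_Q₁ _ hp₁) (henv.bound_Q₂ _ hp₂) (henv.bound_Q₂ _ hq') (henv.bound_L₂ _ hl)
    (henv.bound_L₂ _ hl') hv

theorem Envelope.nonneg_M₂ {q l : S × A → ℝ} (hq₁ : q₁ ∈ Q₁) (hq : q ∈ Q₂) (hl : l ∈ L₂) :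
    0 ≤ M.M₂ c := by
  obtain ⟨x₀⟩ := nonempty_of_isProbabilityMeasure M.ρ₂
  have h1 := henv.nonneg_BL₂ hl
  have h2 : 0 ≤ c.BQ₁ := (abs_nonneg _).trans (henv.bound_Q₁ _ hq₁ x₀)
  have h3 : 0 ≤ c.BQ₂ := (abs_nonneg _).trans (henv.bound_Q₂ _ hq x₀)
  have h4 : 0 ≤ c.BG := (henv.g_nonneg x₀.1).trans (henv.g_le x₀.1)
  have h5 := M.γ₂_nonneg
  rw [M₂, BRes₂]
  positivity

/-- The second stage of the modular estimator on samples with small deviations. -/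
theorem sq_l2norm_stage2_le {t : ℝ} {p q' l₂ : S × A → ℝ} (hp : p ∈ Q₁) (hq' : q' ∈ Q₂)
    (hv : M.IsTargetValue p q') (hl₂ : l₂ ∈ L₂) (hdual : M.IsTargetDual q' l₂)
    {d₂ : Fin n₂ → (S × A) × S}
    (hd₂ : d₂ ∉ deviationSet (M.ρ₂ ⊗ₘ M.P₂) n₂ Q₂ L₂
      (fun r l' => M.targetGap p r l₂ p q' l') t)
    {q l : S × A → ℝ} (hq : M.IsModularStage2 d₂ p Q₂ L₂ q l) :
    l2norm M.ρ₂ (fun x => q x - q' x) ^ 2 ≤ 2 * t := by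
  -- `hmin` and `hmax` sandwich the saddle value, so the empirical gap between `(q, l₂)` and `(q',
  -- l')` is nonpositive and the population gap is at most `t`.
  obtain ⟨l', hl', hmin⟩ := hq.min_left q' hq'
  have hmax := hq.max_right l₂ hl₂
  have e := integral_sub_empMean_le_of_notMem hd₂ hq.mem_left hl'
  have s := (targetGap_of_mem henv hp hq.mem_left hl₂ hl'
    ⟨henv.meas_Q₁ _ hp, _, henv.bound_Q₁ _ hp⟩ hq' hv).2.2 hdual
  simp only [sub_self, policyAvg, mul_zero, Finset.sum_const_zero, integral_zero, add_zero] at s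
  simp only [empMean_targetGap] at e
  linarith

include hπ hsys

theorem sourceGap_of_mem {β BL : ℝ} (hβ : 0 ≤ β)
    (hL₁ : ∀ l ∈ L₁, Measurable l ∧ ∀ x, |l x| ≤ BL) {p l l' : S × A → ℝ} (hp : p ∈ Q₁)
    (hl : l ∈ L₁) (hl' : l' ∈ L₁) :
    IsBM (M.sourceGap β (M.signal π) p l q₁ l') ∧
    HasSubgaussianMGF (fun z => ∫ w, M.sourceGap β (M.signal π) p l q₁ l' w ∂(M.ρ₁ ⊗ₘ M.P₁) -
        M.sourceGap β (M.signal π) p l q₁ l' z)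
      (2 * (β / 2 * c.BQ₁ ^ 2 + BL * M.BRes₁ c).toNNReal ^ 2) (M.ρ₁ ⊗ₘ M.P₁) ∧
    ∫ w, M.sourceGap β (M.signal π) p l q₁ l' w ∂(M.ρ₁ ⊗ₘ M.P₁) =
      (∫ x, β / 2 * (p x ^ 2 - q₁ x ^ 2) ∂M.ρ₁) -
        ∫ x, l x * ((p x - q₁ x) - M.γ₁ * transOp M.P₁ M.μ (fun y => p y - q₁ y) x) ∂M.ρ₁ := by
  obtain ⟨x₀⟩ := nonempty_of_isProbabilityMeasure M.ρ₁
  exact sourceGap_properties hβ ((abs_nonneg _).trans ((hL₁ l hl).2 x₀)) (measurable_signal hπ)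
    (henv.meas_Q₁ _ hp) (hL₁ l hl).1 (hL₁ l' hl').1
    (abs_signal_le hsys.signal_le henv.g_nonneg henv.g_le) (henv.bound_Q₁ _ hp)
    (henv.bound_Q₁ _ hsys.mem_Q₁) (hL₁ l hl).2 (hL₁ l' hl').2 hsys.target.source

theorem nonneg_source_constant {β BL : ℝ} (hβ : 0 ≤ β)
    (hL₁ : ∀ l ∈ L₁, Measurable l ∧ ∀ x, |l x| ≤ BL) {l : S × A → ℝ} (hl : l ∈ L₁) :
    0 ≤ β / 2 * c.BQ₁ ^ 2 + BL * M.BRes₁ c := by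
  obtain ⟨x₀⟩ := nonempty_of_isProbabilityMeasure M.ρ₁
  have h1 : 0 ≤ BL := (abs_nonneg _).trans ((hL₁ l hl).2 x₀)
  have h2 : 0 ≤ c.BQ₁ := (abs_nonneg _).trans (henv.bound_Q₁ _ hsys.mem_Q₁ x₀)
  have h3 : 0 ≤ c.BU := (abs_nonneg _).trans (hsys.signal_le x₀.1 x₀.2)
  have h4 : 0 ≤ c.BG := (henv.g_nonneg x₀.1).trans (henv.g_le x₀.1)
  have h5 := M.γ₁_nonneg
  rw [BRes₁]
  positivity

/-- The coupled estimator on samples with small deviations. -/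
theorem sq_l2norm_coupled_le {BL t₁ t₂ : ℝ} (hL₁ : ∀ l ∈ L₁, Measurable l ∧ ∀ x, |l x| ≤ BL)
    {l₁ l₂ : S × A → ℝ} (hl₁ : l₁ ∈ L₁) (hl₂ : l₂ ∈ L₂) (hdual : M.IsTargetDual q₂ l₂)
    (hdual₁ : M.IsCoupledSourceDual l₂ l₁) {d₁ : Fin n₁ → (S × A) × S} {d₂ : Fin n₂ → (S × A) × S}
    (hd₁ : d₁ ∉ deviationSet (M.ρ₁ ⊗ₘ M.P₁) n₁ Q₁ L₁
      (fun p l' => M.sourceGap 0 (M.signal π) p l₁ q₁ l') t₁)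
    (hd₂ : d₂ ∉ deviationSet (M.ρ₂ ⊗ₘ M.P₂) n₂ (Q₁ ×ˢ Q₂) L₂
      (fun p l' => M.targetGap p.1 p.2 l₂ q₁ q₂ l') t₂)
    {q l : (S × A → ℝ) × (S × A → ℝ)}
    (hq : M.IsCoupled 0 d₁ d₂ (M.signal π) Q₁ Q₂ L₁ L₂ q l) :
    l2norm M.ρ₂ (fun x => q.2 x - q₂ x) ^ 2 ≤ 2 * (t₁ + t₂) := by
  obtain ⟨hq₁, hq₂⟩ := Finset.mem_product.1 hq.mem_left
  obtain ⟨l', hl', hmin⟩ := hq.min_left (q₁, q₂) (Finset.mk_mem_product hsys.mem_Q₁ hsys.mem_Q₂)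
  have hmax := hq.max_right (l₁, l₂) (Finset.mk_mem_product hl₁ hl₂)
  obtain ⟨hl'₁, hl'₂⟩ := Finset.mem_product.1 hl'
  have e₁ := integral_sub_empMean_le_of_notMem hd₁ hq₁ hl'₁
  have e₂ := integral_sub_empMean_le_of_notMem hd₂ (Finset.mk_mem_product hq₁ hq₂) hl'₂
  have s := (sourceGap_of_mem henv hπ hsys le_rfl hL₁ hq₁ hl₁ hl'₁).2.2
  have t := (targetGap_of_mem henv hq₁ hq₂ hl₂ hl'₂ hsys.target.source.bm hsys.mem_Q₂
    hsys.target.target).2.2 hdual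
  -- The coupled dual identity at the source error equates the source gap with minus the cross term
  -- of the target gap; their sum controls the target error alone.
  have hd := hdual₁ (fun x => q.1 x - q₁ x)
    (IsBM.sub ⟨henv.meas_Q₁ _ hq₁, _, henv.bound_Q₁ _ hq₁⟩ hsys.target.source.bm)
  simp only [zero_div, zero_mul, integral_zero, zero_sub] at s
  simp only [empMean_sourceGap] at e₁
  simp only [empMean_targetGap] at e₂
  simp only at hmin hmax
  linarith

/-- The first stage of the modular estimator on samples with small deviations. -/
theorem sq_l2norm_stage1_le {BL t : ℝ} (hL₁ : ∀ l ∈ L₁, Measurable l ∧ ∀ x, |l x| ≤ BL)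
    {l₁ : S × A → ℝ} (hl₁ : l₁ ∈ L₁) (hdual : M.IsModularSourceDual q₁ l₁)
    {d₁ : Fin n₁ → (S × A) × S}
    (hd₁ : d₁ ∉ deviationSet (M.ρ₁ ⊗ₘ M.P₁) n₁ Q₁ L₁
      (fun p l' => M.sourceGap 1 (M.signal π) p l₁ q₁ l') t)
    {q l : S × A → ℝ} (hq : M.IsModularStage1 d₁ (M.signal π) Q₁ L₁ q l) :
    l2norm M.ρ₁ (fun x => q x - q₁ x) ^ 2 ≤ 2 * t := by
  obtain ⟨x₀⟩ := nonempty_of_isProbabilityMeasure M.ρ₁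
  obtain ⟨l', hl', hmin⟩ := hq.min_left q₁ hsys.mem_Q₁
  have hmax := hq.max_right l₁ hl₁
  have e := integral_sub_empMean_le_of_notMem hd₁ hq.mem_left hl'
  have s := integral_sourceGap_modular ((abs_nonneg _).trans ((hL₁ l₁ hl₁).2 x₀))
    (measurable_signal hπ) (henv.meas_Q₁ _ hq.mem_left) (hL₁ l₁ hl₁).1 (hL₁ l' hl').1
    (abs_signal_le hsys.signal_le henv.g_nonneg henv.g_le) (henv.bound_Q₁ _ hq.mem_left)
    (henv.bound_Q₁ _ hsys.mem_Q₁) (hL₁ l₁ hl₁).2 (hL₁ l' hl').2 hsys.target.source hdual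
  simp only [empMean_sourceGap] at e
  linarith

end Deterministic

end Model

end

/-! ### Assembly of the probability bounds. -/

section

variable {S A : Type*} [MeasurableSpace S] [Fintype A] [MeasurableSpace A]
  [MeasurableSingletonClass A]

/-- Turns the targets and duals, given separately at each outcome, into a deterministic function of
the learned object. This removes their dependence on the sample and any question of their
measurability. -/
theorem exists_forall_choice {ι X : Type*} [Nonempty X] (D : ι → X → Prop) :
    ∃ f : ι → X, ∀ i x, D i x → D i (f i) := by
  have (i : ι) : ∃ y, ∀ x, D i x → D i y := by
    by_cases h : ∃ y, D i y
    · exact h.imp fun y hy _ _ => hy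
    · exact ⟨Classical.arbitrary X, fun x hx => absurd ⟨x, hx⟩ h⟩
  exact Classical.skolem.1 this

/-- Merges the two modular stages under one root via `(a + b)² ≤ 2a² + 2b²`; this doubles the
modular constants from 4 to 8. -/
theorem add_le_sqrt_of_sq_le {a b x y : ℝ} (ha : a ^ 2 ≤ x) (hb : b ^ 2 ≤ y) :
    a + b ≤ √(2 * x + 2 * y) :=
  Real.le_sqrt_of_sq_le (by nlinarith [sq_nonneg (a - b)])

theorem measure_le_of_forall_mem_or {Ω : Type*} [MeasurableSpace Ω] {Pr : Measure Ω}
    {E E₀ E₁ E₂ : Set Ω} {a b d e : ℝ} (ha : 0 ≤ a) (hb : 0 ≤ b) (hd : 0 ≤ d)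
    (h : ∀ᵐ ω ∂Pr, ω ∈ E → ω ∈ E₀ ∨ ω ∈ E₁ ∨ ω ∈ E₂) (h₀ : Pr E₀ ≤ ENNReal.ofReal a)
    (h₁ : Pr E₁ ≤ ENNReal.ofReal b) (h₂ : Pr E₂ ≤ ENNReal.ofReal d) (hs : a + b + d ≤ e) :
    Pr E ≤ ENNReal.ofReal e := by
  calc Pr E ≤ Pr (E₀ ∪ (E₁ ∪ E₂)) := measure_mono_ae h
    _ ≤ Pr E₀ + (Pr E₁ + Pr E₂) :=
        (measure_union_le _ _).trans (add_le_add le_rfl (measure_union_le _ _))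
    _ ≤ ENNReal.ofReal a + (ENNReal.ofReal b + ENNReal.ofReal d) := by gcongr
    _ = ENNReal.ofReal (a + b + d) := by
        rw [ENNReal.ofReal_add (by positivity) hd, ENNReal.ofReal_add ha hb, add_assoc]
    _ ≤ _ := ENNReal.ofReal_le_ofReal hs

theorem l2norm_sub_le_add {X : Type*} [MeasurableSpace X] (ρ : Measure X) [IsFiniteMeasure ρ]
    {f g h : X → ℝ} (hf : IsBM f) (hg : IsBM g) (hh : IsBM h) :
    l2norm ρ (fun x => f x - h x) ≤
      l2norm ρ (fun x => f x - g x) + l2norm ρ (fun x => g x - h x) := by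
  simpa using l2norm_add_le (hf.sub hg) (hg.sub hh) ρ

namespace Model

variable {M : Model S A}

section Events

variable {Ω : Type*} [MeasurableSpace Ω] {Pr : Measure Ω} [IsProbabilityMeasure Pr]
  {nb n₁ n₂ : ℕ} {Db : Ω → Fin nb → S × A} {D₁ : Ω → Fin n₁ → (S × A) × S}
  {D₂ : Ω → Fin n₂ → (S × A) × S}

theorem measure_demonstrations_le (hD : M.IsSample Pr Db D₁ D₂) {s : Set (Fin nb → S × A)}
    {η : ℝ≥0∞} (hs : (Measure.pi fun _ => M.ρ₁) s ≤ η) : Pr {ω | Db ω ∈ s} ≤ η :=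
  (Measure.le_map_apply hD.meas_b.aemeasurable s).trans
    (by rw [hD.map_demonstrations]; exact hs)

end Events

theorem coupled_bound {Ω : Type*} [MeasurableSpace Ω] (Pr : Measure Ω) [IsProbabilityMeasure Pr]
    {nb n₁ n₂ : ℕ} (hnb : 0 < nb) (hn₁ : 0 < n₁) (hn₂ : 0 < n₂)
    {Db : Ω → Fin nb → S × A} {D₁ : Ω → Fin n₁ → (S × A) × S} {D₂ : Ω → Fin n₂ → (S × A) × S}
    (hD : M.IsSample Pr Db D₁ D₂) {δ : ℝ} (hδ₀ : 0 < δ) (hδ₁ : δ < 1)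
    {pols : Finset (S → A → ℝ)} (hpols : ∀ π ∈ pols, IsPolicy π) (hreal : M.πb ∈ pols)
    {ε : ℝ} (hε₀ : 0 < ε) (hε₁ : ε ≤ 1) (hclip : ∀ π ∈ pols, ∀ s a, ε ≤ π s a)
    {πhat : (Fin nb → S × A) → S → A → ℝ} (hπhat : IsCEMinimizer pols πhat)
    {q₁s q₂s : S × A → ℝ} (hs : M.IsTransferTarget M.πb q₁s q₂s)
    {c : Constants} {Q₁ Q₂ L₂ : Finset (S × A → ℝ)} (henv : M.Envelope c Q₁ Q₂ L₂)
    {q₁t q₂t : Ω → S × A → ℝ}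
    (hsys : ∀ᵐ ω ∂Pr, M.SystemConditions c Q₁ Q₂ (πhat (Db ω)) (q₁t ω) (q₂t ω))
    (hκ₁ : densityNorm (occupancy M.γ₁ M.P₁ M.μ M.ρ₁) M.ρ₁ ≤ ENNReal.ofReal c.κ₁)
    {κpath : ℝ} (hpath : ∀ᵐ ω ∂Pr, M.PathConcentrability q₂s (q₂t ω) κpath)
    (hχ : M.chi ≠ ⊤) (hκμ : M.kappaMu ≠ ⊤) {L₁ : Finset (S × A → ℝ)}
    {qhat lhat : Ω → (S × A → ℝ) × (S × A → ℝ)}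
    (hL₁ : ∀ l ∈ L₁, Measurable l ∧ ∀ x, |l x| ≤ c.BL12)
    (hdual : ∀ᵐ ω ∂Pr, ∃ l₂ ∈ L₂, M.IsTargetDual (q₂t ω) l₂ ∧
      ∃ l₁ ∈ L₁, M.IsCoupledSourceDual l₂ l₁)
    (hhat : ∀ ω, M.IsCoupled 0 (D₁ ω) (D₂ ω) (M.signal (πhat (Db ω))) Q₁ Q₂ L₁ L₂
      (qhat ω) (lhat ω)) :
    Pr {ω | ¬ l2norm M.ρ₂ (fun x => (qhat ω).2 x - q₂s x) ≤
      √(M.Bcoup c (Q₁.card * L₁.card) (Q₁.card * Q₂.card * L₂.card) n₁ n₂ δ) +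
        M.learningTerm c.κ₁ κpath ε pols.card nb δ} ≤ ENNReal.ofReal δ := by
  classical
  let F := S × A → ℝ
  let D : (S → A → ℝ) → F × F × F × F → Prop := fun π z =>
    M.SystemConditions c Q₁ Q₂ π z.1 z.2.1 ∧ z.2.2.1 ∈ L₁ ∧ z.2.2.2 ∈ L₂ ∧
      M.IsTargetDual z.2.1 z.2.2.2 ∧ M.IsCoupledSourceDual z.2.2.2 z.2.2.1
  obtain ⟨f, hf⟩ := exists_forall_choice D
  let t₁ := 2 * M.M₁coup c * √(2 * Real.log (2 * (Q₁.card * L₁.card : ℕ) / δ) / n₁)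
  let t₂ := 2 * M.M₂ c * √(2 * Real.log (2 * ((Q₁ ×ˢ Q₂).card * L₂.card : ℕ) / δ) / n₂)
  -- Including `D π (f π)` makes the bad set empty for policies without a realizable system, where
  -- the concentration lemmas are unavailable.
  let T₁ : (S → A → ℝ) → Set (Fin n₁ → (S × A) × S) := fun π =>
    {d | D π (f π) ∧ d ∈ deviationSet (M.ρ₁ ⊗ₘ M.P₁) n₁ Q₁ L₁
      (fun p l' => M.sourceGap 0 (M.signal π) p (f π).2.2.1 (f π).1 l') t₁}
  let T₂ : (S → A → ℝ) → Set (Fin n₂ → (S × A) × S) := fun π =>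
    {d | D π (f π) ∧ d ∈ deviationSet (M.ρ₂ ⊗ₘ M.P₂) n₂ (Q₁ ×ˢ Q₂) L₂
      (fun p l' => M.targetGap p.1 p.2 (f π).2.2.2 (f π).1 (f π).2.1 l') t₂}
  have sg {π : S → A → ℝ} (hπ : π ∈ pols) (h : D π (f π)) {p l' : F} (hp : p ∈ Q₁)
      (hl' : l' ∈ L₁) := sourceGap_of_mem henv (hpols π hπ) h.1 le_rfl hL₁ hp h.2.1 hl'
  have tg {π : S → A → ℝ} (h : D π (f π)) {p : F × F} {l' : F} (hp : p ∈ Q₁ ×ˢ Q₂)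
      (hl' : l' ∈ L₂) := targetGap_of_mem henv (Finset.mem_product.1 hp).1
        (Finset.mem_product.1 hp).2 h.2.2.1 hl' h.1.target.source.bm h.1.mem_Q₂ h.1.target.target
  have eT₁ {π : S → A → ℝ} (h : D π (f π)) : T₁ π = deviationSet (M.ρ₁ ⊗ₘ M.P₁) n₁ Q₁ L₁
      (fun p l' => M.sourceGap 0 (M.signal π) p (f π).2.2.1 (f π).1 l') t₁ :=
    Set.ext fun _ => and_iff_right h
  have eT₂ {π : S → A → ℝ} (h : D π (f π)) : T₂ π = deviationSet (M.ρ₂ ⊗ₘ M.P₂) n₂ (Q₁ ×ˢ Q₂) L₂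
      (fun p l' => M.targetGap p.1 p.2 (f π).2.2.2 (f π).1 (f π).2.1 l') t₂ :=
    Set.ext fun _ => and_iff_right h
  have eM : 0 / 2 * c.BQ₁ ^ 2 + c.BL12 * M.BRes₁ c = M.M₁coup c := by
    rw [M₁coup]
    ring
  have m₁ : Pr {ω | πhat (Db ω) ∈ pols ∧ D₁ ω ∈ T₁ (πhat (Db ω))} ≤
      ENNReal.ofReal (δ / 2 ^ 2) := by
    refine measure_le_of_map_prod hD.meas_b hD.meas₁ hD.map_demonstrations_source pols πhat
      hπhat.measurable T₁ (fun π hπ => ?_) fun π hπ => ?_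
    · by_cases h : D π (f π)
      · rw [eT₁ h]
        exact measurableSet_deviationSet fun p hp l' hl' => (sg hπ h hp hl').1
      · simp [T₁, h]
    · by_cases h : D π (f π)
      · rw [eT₁ h]
        have hB := nonneg_source_constant henv (hpols π hπ) h.1 le_rfl hL₁ h.2.1
        rw [eM] at hB
        exact measure_deviationSet_le (ν := M.ρ₁ ⊗ₘ M.P₁) (Q := Q₁) (L := L₁)
          (F := fun p l' => M.sourceGap 0 (M.signal π) p (f π).2.2.1 (f π).1 l') (k := 2) hn₁ hB
          (fun p hp l' hl' => by
            have := (sg hπ h hp hl').2.1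
            rwa [eM] at this) one_le_two hδ₀ hδ₁
      · simp [T₁, h]
  have m₂ : Pr {ω | πhat (Db ω) ∈ pols ∧ D₂ ω ∈ T₂ (πhat (Db ω))} ≤
      ENNReal.ofReal (δ / 2 ^ 2) := by
    refine measure_le_of_map_prod hD.meas_b hD.meas₂ hD.map_demonstrations_target pols πhat
      hπhat.measurable T₂ (fun π hπ => ?_) fun π hπ => ?_
    · by_cases h : D π (f π)
      · rw [eT₂ h]
        exact measurableSet_deviationSet fun p hp l' hl' => (tg h hp hl').1
      · simp [T₂, h]
    · by_cases h : D π (f π)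
      · rw [eT₂ h]
        have hB := henv.nonneg_M₂ h.1.mem_Q₁ h.1.mem_Q₂ h.2.2.1
        exact measure_deviationSet_le (ν := M.ρ₂ ⊗ₘ M.P₂) (Q := Q₁ ×ˢ Q₂) (L := L₂)
          (F := fun p l' => M.targetGap p.1 p.2 (f π).2.2.2 (f π).1 (f π).2.1 l') (k := 2) hn₂ hB
          (fun p hp l' hl' => (tg h hp hl').2.1) one_le_two
          hδ₀ hδ₁
      · simp [T₂, h]
  -- The failure probabilities are `δ / 8` for the demonstrations and `δ / 4` for each transition
  -- sample.
  refine measure_le_of_forall_mem_or (by positivity) (by positivity) (by positivity) ?_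
    (measure_demonstrations_le hD
      (measure_epsCE_lt_le hnb hδ₀ hδ₁ hpols hreal hε₀ hε₁ hclip hπhat)) m₁ m₂ (by linarith)
  filter_upwards [hsys, hpath, hdual] with ω hsys hpath hdual
  contrapose!
  rintro ⟨h₀, h₁, h₂⟩
  obtain ⟨l₂, hl₂, hd₂, l₁, hl₁, hd₁⟩ := hdual
  set π := πhat (Db ω)
  have hπ : π ∈ pols := hπhat.mem _
  have hDf : D π (f π) := hf π (q₁t ω, q₂t ω, l₁, l₂) ⟨hsys, hl₁, hl₂, hd₂, hd₁⟩
  -- Uniqueness identifies the chosen target of the learned policy with the one given at the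
  -- outcome.
  obtain ⟨hu₁, hu₂⟩ := hDf.1.target.unique hsys.target
  have g₁ : D₁ ω ∉ deviationSet (M.ρ₁ ⊗ₘ M.P₁) n₁ Q₁ L₁
      (fun p l' => M.sourceGap 0 (M.signal π) p (f π).2.2.1 (f π).1 l') t₁ :=
    fun h => h₁ hπ ⟨hDf, h⟩
  have g₂ : D₂ ω ∉ deviationSet (M.ρ₂ ⊗ₘ M.P₂) n₂ (Q₁ ×ˢ Q₂) L₂
      (fun p l' => M.targetGap p.1 p.2 (f π).2.2.2 (f π).1 (f π).2.1 l') t₂ :=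
    fun h => h₂ hπ ⟨hDf, h⟩
  have main := sq_l2norm_coupled_le henv (hpols π hπ) hDf.1 hL₁ hDf.2.1 hDf.2.2.1 hDf.2.2.2.1
    hDf.2.2.2.2 g₁ g₂ (hhat ω)
  rw [hu₂] at main
  have eB : 2 * (t₁ + t₂) = M.Bcoup c (Q₁.card * L₁.card) (Q₁.card * Q₂.card * L₂.card) n₁ n₂ δ := by
    simp only [t₁, t₂, Bcoup, Finset.card_product]
    ring
  rw [eB] at main
  have hq₂ := (Finset.mem_product.1 (hhat ω).mem_left).2
  have learn := l2norm_target_sub_le_learningTerm hε₀ hε₁ (hclip _ hreal) (hpols π hπ)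
    (hclip π hπ) hs hsys.target hκ₁ hpath hχ hκμ h₀
  exact (l2norm_sub_le_add M.ρ₂ ⟨henv.meas_Q₂ _ hq₂, _, henv.bound_Q₂ _ hq₂⟩ hsys.target.target.bm
    hs.target.bm).trans (add_le_add (Real.le_sqrt_of_sq_le main) learn)

theorem modular_bound {Ω : Type*} [MeasurableSpace Ω] (Pr : Measure Ω) [IsProbabilityMeasure Pr]
    {nb n₁ n₂ : ℕ} (hnb : 0 < nb) (hn₁ : 0 < n₁) (hn₂ : 0 < n₂)
    {Db : Ω → Fin nb → S × A} {D₁ : Ω → Fin n₁ → (S × A) × S} {D₂ : Ω → Fin n₂ → (S × A) × S}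
    (hD : M.IsSample Pr Db D₁ D₂) {δ : ℝ} (hδ₀ : 0 < δ) (hδ₁ : δ < 1)
    {pols : Finset (S → A → ℝ)} (hpols : ∀ π ∈ pols, IsPolicy π) (hreal : M.πb ∈ pols)
    {ε : ℝ} (hε₀ : 0 < ε) (hε₁ : ε ≤ 1) (hclip : ∀ π ∈ pols, ∀ s a, ε ≤ π s a)
    {πhat : (Fin nb → S × A) → S → A → ℝ} (hπhat : IsCEMinimizer pols πhat)
    {q₁s q₂s : S × A → ℝ} (hs : M.IsTransferTarget M.πb q₁s q₂s)
    {c : Constants} {Q₁ Q₂ L₂ : Finset (S × A → ℝ)} (henv : M.Envelope c Q₁ Q₂ L₂)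
    {q₁t q₂t : Ω → S × A → ℝ}
    (hsys : ∀ᵐ ω ∂Pr, M.SystemConditions c Q₁ Q₂ (πhat (Db ω)) (q₁t ω) (q₂t ω))
    (hκ₁ : densityNorm (occupancy M.γ₁ M.P₁ M.μ M.ρ₁) M.ρ₁ ≤ ENNReal.ofReal c.κ₁)
    {κpath : ℝ} (hpath : ∀ᵐ ω ∂Pr, M.PathConcentrability q₂s (q₂t ω) κpath)
    (hχ : M.chi ≠ ⊤) {εb : ℝ} {L₁ : Finset (S × A → ℝ)} {κpathMod : ℝ}
    {q₁hat : (Fin nb → S × A) × (Fin n₁ → (S × A) × S) → S × A → ℝ}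
    {q₂plug q₂hat l₁hat l₂hat : Ω → S × A → ℝ} (hεb : 0 < εb)
    (hκεb : M.kappaMu ≤ ENNReal.ofReal (1 / εb))
    (hL₁ : ∀ l ∈ L₁, Measurable l ∧ ∀ x, |l x| ≤ M.BL₁mod c)
    (hdual : ∀ᵐ ω ∂Pr, ∃ l₁ ∈ L₁, M.IsModularSourceDual (q₁t ω) l₁)
    (hmeas : ∀ q ∈ Q₁, MeasurableSet {d | q₁hat d = q})
    (hst₁ : ∀ ω, M.IsModularStage1 (D₁ ω) (M.signal (πhat (Db ω))) Q₁ L₁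
      (q₁hat (Db ω, D₁ ω)) (l₁hat ω))
    (hst₂ : ∀ ω, M.IsModularStage2 (D₂ ω) (q₁hat (Db ω, D₁ ω)) Q₂ L₂ (q₂hat ω) (l₂hat ω))
    (hplug : ∀ᵐ ω ∂Pr, M.IsTargetValue (q₁hat (Db ω, D₁ ω)) (q₂plug ω) ∧ q₂plug ω ∈ Q₂ ∧
      (∃ l₂ ∈ L₂, M.IsTargetDual (q₂plug ω) l₂) ∧
      M.PathConcentrability (q₂t ω) (q₂plug ω) κpathMod) :
    Pr {ω | ¬ l2norm M.ρ₂ (fun x => q₂hat ω x - q₂s x) ≤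
      √(M.Bmod c κpathMod εb (Q₁.card * L₁.card) (Q₂.card * L₂.card) n₁ n₂ δ) +
        M.learningTerm c.κ₁ κpath ε pols.card nb δ} ≤ ENNReal.ofReal δ := by
  classical
  let F := S × A → ℝ
  have hκμ : M.kappaMu ≠ ⊤ := ne_top_of_le_ne_top ENNReal.ofReal_ne_top hκεb
  let D : (S → A → ℝ) → F × F × F → Prop := fun π z =>
    M.SystemConditions c Q₁ Q₂ π z.1 z.2.1 ∧ z.2.2 ∈ L₁ ∧ M.IsModularSourceDual z.1 z.2.2
  let E : F → F × F → Prop := fun p z =>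
    M.IsTargetValue p z.1 ∧ z.1 ∈ Q₂ ∧ z.2 ∈ L₂ ∧ M.IsTargetDual z.1 z.2
  obtain ⟨f, hf⟩ := exists_forall_choice D
  obtain ⟨g, hg⟩ := exists_forall_choice E
  let B := 1 / 2 * c.BQ₁ ^ 2 + M.BL₁mod c * M.BRes₁ c
  let t₁ := 2 * B * √(2 * Real.log (4 * (Q₁.card * L₁.card : ℕ) / δ) / n₁)
  let t₂ := 2 * M.M₂ c * √(2 * Real.log (4 * (Q₂.card * L₂.card : ℕ) / δ) / n₂)
  let T₁ : (S → A → ℝ) → Set (Fin n₁ → (S × A) × S) := fun π =>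
    {d | D π (f π) ∧ d ∈ deviationSet (M.ρ₁ ⊗ₘ M.P₁) n₁ Q₁ L₁
      (fun p l' => M.sourceGap 1 (M.signal π) p (f π).2.2 (f π).1 l') t₁}
  -- The second stage sees the past only through the first-stage estimate `p`, which is independent
  -- of the target sample. Conditioning on `p` keeps `𝓠₁` out of the second union bound.
  let T₂ : F → Set (Fin n₂ → (S × A) × S) := fun p =>
    {d | E p (g p) ∧ d ∈ deviationSet (M.ρ₂ ⊗ₘ M.P₂) n₂ Q₂ L₂
      (fun r l' => M.targetGap p r (g p).2 p (g p).1 l') t₂}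
  have sg {π : S → A → ℝ} (hπ : π ∈ pols) (h : D π (f π)) {p l' : F} (hp : p ∈ Q₁)
      (hl' : l' ∈ L₁) := sourceGap_of_mem henv (hpols π hπ) h.1 zero_le_one hL₁ hp h.2.1 hl'
  have tg {p : F} (hp : p ∈ Q₁) (h : E p (g p)) {r l' : F} (hr : r ∈ Q₂)
      (hl' : l' ∈ L₂) := targetGap_of_mem henv hp hr h.2.2.1 hl'
        ⟨henv.meas_Q₁ _ hp, _, henv.bound_Q₁ _ hp⟩ h.2.1 h.1
  have eT₁ {π : S → A → ℝ} (h : D π (f π)) : T₁ π = deviationSet (M.ρ₁ ⊗ₘ M.P₁) n₁ Q₁ L₁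
      (fun p l' => M.sourceGap 1 (M.signal π) p (f π).2.2 (f π).1 l') t₁ :=
    Set.ext fun _ => and_iff_right h
  have eT₂ {p : F} (h : E p (g p)) : T₂ p = deviationSet (M.ρ₂ ⊗ₘ M.P₂) n₂ Q₂ L₂
      (fun r l' => M.targetGap p r (g p).2 p (g p).1 l') t₂ :=
    Set.ext fun _ => and_iff_right h
  have m₁ : Pr {ω | πhat (Db ω) ∈ pols ∧ D₁ ω ∈ T₁ (πhat (Db ω))} ≤
      ENNReal.ofReal (δ / 4 ^ 2) := by
    refine measure_le_of_map_prod hD.meas_b hD.meas₁ hD.map_demonstrations_source pols πhat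
      hπhat.measurable T₁ (fun π hπ => ?_) fun π hπ => ?_
    · by_cases h : D π (f π)
      · rw [eT₁ h]
        exact measurableSet_deviationSet fun p hp l' hl' => (sg hπ h hp hl').1
      · simp [T₁, h]
    · by_cases h : D π (f π)
      · rw [eT₁ h]
        exact measure_deviationSet_le (ν := M.ρ₁ ⊗ₘ M.P₁) (Q := Q₁) (L := L₁)
          (F := fun p l' => M.sourceGap 1 (M.signal π) p (f π).2.2 (f π).1 l') (k := 4) hn₁
          (nonneg_source_constant henv (hpols π hπ) h.1 zero_le_one hL₁ h.2.1)
          (fun p hp l' hl' => (sg hπ h hp hl').2.1) (by norm_num) hδ₀ hδ₁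
      · simp [T₁, h]
  have m₂ : Pr {ω | q₁hat (Db ω, D₁ ω) ∈ Q₁ ∧ D₂ ω ∈ T₂ (q₁hat (Db ω, D₁ ω))} ≤
      ENNReal.ofReal (δ / 4 ^ 2) := by
    refine measure_le_of_map_prod (hD.meas_b.prodMk hD.meas₁) hD.meas₂ hD.map_assoc Q₁ q₁hat
      hmeas T₂ (fun p hp => ?_) fun p hp => ?_
    · by_cases h : E p (g p)
      · rw [eT₂ h]
        exact measurableSet_deviationSet fun r hr l' hl' => (tg hp h hr hl').1
      · simp [T₂, h]
    · by_cases h : E p (g p)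
      · rw [eT₂ h]
        exact measure_deviationSet_le (ν := M.ρ₂ ⊗ₘ M.P₂) (Q := Q₂) (L := L₂)
          (F := fun r l' => M.targetGap p r (g p).2 p (g p).1 l') (k := 4) hn₂
          (henv.nonneg_M₂ hp h.2.1 h.2.2.1)
          (fun r hr l' hl' => (tg hp h hr hl').2.1) (by norm_num) hδ₀ hδ₁
      · simp [T₂, h]
  -- The failure probabilities are `δ / 8` for the demonstrations and `δ / 16` for each transition
  -- sample.
  refine measure_le_of_forall_mem_or (by positivity) (by positivity) (by positivity) ?_
    (measure_demonstrations_le hD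
      (measure_epsCE_lt_le hnb hδ₀ hδ₁ hpols hreal hε₀ hε₁ hclip hπhat)) m₁ m₂ (by linarith)
  filter_upwards [hsys, hpath, hdual, hplug] with ω hsys hpath hdual hplug
  contrapose!
  rintro ⟨h₀, h₁, h₂⟩
  obtain ⟨l₁, hl₁, hd₁⟩ := hdual
  obtain ⟨hval, hmem, ⟨l₂, hl₂, hd₂⟩, hpathMod⟩ := hplug
  set π := πhat (Db ω)
  set p := q₁hat (Db ω, D₁ ω)
  have hπ : π ∈ pols := hπhat.mem _
  have hp : p ∈ Q₁ := (hst₁ ω).mem_left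
  have hpBM : IsBM p := ⟨henv.meas_Q₁ _ hp, _, henv.bound_Q₁ _ hp⟩
  have hDf : D π (f π) := hf π (q₁t ω, q₂t ω, l₁) ⟨hsys, hl₁, hd₁⟩
  have hEg : E p (g p) := hg p (q₂plug ω, l₂) ⟨hval, hmem, hl₂, hd₂⟩
  have hu₁ := (hDf.1.target.unique hsys.target).1
  have hu₂ := hEg.1.unique hval
  have g₁ : D₁ ω ∉ deviationSet (M.ρ₁ ⊗ₘ M.P₁) n₁ Q₁ L₁
      (fun p l' => M.sourceGap 1 (M.signal π) p (f π).2.2 (f π).1 l') t₁ :=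
    fun h => h₁ hπ ⟨hDf, h⟩
  have g₂ : D₂ ω ∉ deviationSet (M.ρ₂ ⊗ₘ M.P₂) n₂ Q₂ L₂
      (fun r l' => M.targetGap p r (g p).2 p (g p).1 l') t₂ :=
    fun h => h₂ hp ⟨hEg, h⟩
  have s₁ := sq_l2norm_stage1_le henv (hpols π hπ) hDf.1 hL₁ hDf.2.1 hDf.2.2 g₁ (hst₁ ω)
  have s₂ := sq_l2norm_stage2_le henv hp hEg.2.1 hEg.1 hEg.2.2.1 hEg.2.2.2 g₂ (hst₂ ω)
  rw [hu₁] at s₁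
  rw [hu₂] at s₂
  have hκ0 := hpathMod.pos hsys.target.target.bm.measurable hval.bm.measurable
  have hχ0 : 0 ≤ M.chi.toReal := ENNReal.toReal_nonneg
  have hγ : 0 < 1 - M.γ₂ := by linarith [M.γ₂_lt_one]
  -- The first-stage error reaches the target through the population problem with the estimate
  -- plugged in: `q₂plug` against `q₂t`. The remaining error, `q₂hat` against `q₂plug`, is purely
  -- second-stage.
  have tr := l2norm_target_sub_le hε₀ (hclip _ hreal) hχ hκμ hsys.target.source.bm hpBM
    hsys.target.target hval hpathMod
  have hone := one_add_sqrt_kappaMu_le hε₀ (hclip _ hreal) hεb hκεb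
  have tr' : l2norm M.ρ₂ (fun x => q₂plug ω x - q₂t ω x) ≤
      2 / √εb * √(κpathMod * M.chi.toReal) / (1 - M.γ₂) *
        l2norm M.ρ₁ (fun x => p x - q₁t ω x) := by
    refine tr.trans (mul_le_mul_of_nonneg_right ?_ (l2norm_nonneg _ _))
    gcongr
  have sq : l2norm M.ρ₂ (fun x => q₂plug ω x - q₂t ω x) ^ 2 ≤
      4 * κpathMod * M.chi.toReal / (εb * (1 - M.γ₂) ^ 2) * (2 * t₁) := by
    have h := pow_le_pow_left₀ (l2norm_nonneg _ _) tr' 2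
    have e : (2 / √εb * √(κpathMod * M.chi.toReal) / (1 - M.γ₂) *
        l2norm M.ρ₁ (fun x => p x - q₁t ω x)) ^ 2 =
        4 * κpathMod * M.chi.toReal / (εb * (1 - M.γ₂) ^ 2) *
          l2norm M.ρ₁ (fun x => p x - q₁t ω x) ^ 2 := by
      rw [mul_pow, div_pow, mul_pow, div_pow, Real.sq_sqrt hεb.le, Real.sq_sqrt (by positivity)]
      field_simp
      ring
    rw [e] at h
    exact h.trans (mul_le_mul_of_nonneg_left s₁ (by positivity))
  have comb := add_le_sqrt_of_sq_le sq s₂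
  have eB : 2 * (4 * κpathMod * M.chi.toReal / (εb * (1 - M.γ₂) ^ 2) * (2 * t₁)) + 2 * (2 * t₂) =
      M.Bmod c κpathMod εb (Q₁.card * L₁.card) (Q₂.card * L₂.card) n₁ n₂ δ := by
    simp only [t₁, t₂, B, Bmod, M₁mod]
    ring
  rw [eB] at comb
  have hq₂ := (hst₂ ω).mem_left
  have hq₂BM : IsBM (q₂hat ω) := ⟨henv.meas_Q₂ _ hq₂, _, henv.bound_Q₂ _ hq₂⟩
  have learn := l2norm_target_sub_le_learningTerm hε₀ hε₁ (hclip _ hreal) (hpols π hπ)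
    (hclip π hπ) hs hsys.target hκ₁ hpath hχ hκμ h₀
  have tri₁ := l2norm_sub_le_add M.ρ₂ hq₂BM hsys.target.target.bm hs.target.bm
  have tri₂ := l2norm_sub_le_add M.ρ₂ hq₂BM hval.bm hsys.target.target.bm
  linarith

theorem learningTerm_le {ε : ℝ} (hε₀ : 0 < ε) (hclip : ∀ s a, ε ≤ M.πb s a) {εb : ℝ}
    (hεb : 0 < εb) (hκ : M.kappaMu ≤ ENNReal.ofReal (1 / εb)) (κ₁ κpath : ℝ) (N nb : ℕ) (δ : ℝ) :
    M.learningTerm κ₁ κpath ε N nb δ ≤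
      2 * √(κ₁ * κpath * M.chi.toReal) / (√εb * (1 - M.γ₁) * (1 - M.γ₂)) *
        √(2 / ε * epsCE ε N nb δ) := by
  have h1 : 0 < 1 - M.γ₁ := by linarith [M.γ₁_lt_one]
  have h2 : 0 < 1 - M.γ₂ := by linarith [M.γ₂_lt_one]
  have e : 2 * √(κ₁ * κpath * M.chi.toReal) / (√εb * (1 - M.γ₁) * (1 - M.γ₂)) =
      2 / √εb * √(κ₁ * κpath * M.chi.toReal) / ((1 - M.γ₁) * (1 - M.γ₂)) := by
    field_simp
  rw [learningTerm, e]
  gcongr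
  exact one_add_sqrt_kappaMu_le hε₀ hclip hεb hκ

end Model

end

end RewardTransfer

end

open RewardTransfer in
theorem mainTheorem10 {S A : Type*} [MeasurableSpace S] [Fintype A] [MeasurableSpace A]
    [MeasurableSingletonClass A] (M : Model S A)
    -- independent samples of positive sizes
    {Ω : Type*} [MeasurableSpace Ω] (Pr : Measure Ω) [IsProbabilityMeasure Pr]
    {nb n₁ n₂ : ℕ} (hnb : 0 < nb) (hn₁ : 0 < n₁) (hn₂ : 0 < n₂)
    (Db : Ω → Fin nb → S × A) (D₁ : Ω → Fin n₁ → (S × A) × S) (D₂ : Ω → Fin n₂ → (S × A) × S)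
    (hD : M.IsSample Pr Db D₁ D₂)
    (δ : ℝ) (hδ₀ : 0 < δ) (hδ₁ : δ < 1)
    -- the learned behavior policy
    (pols : Finset (S → A → ℝ)) (hpols : ∀ π ∈ pols, IsPolicy π) (hreal : M.πb ∈ pols)
    (ε : ℝ) (hε₀ : 0 < ε) (hε₁ : ε ≤ 1) (hclip : ∀ π ∈ pols, ∀ s a, ε ≤ π s a)
    (πhat : (Fin nb → S × A) → S → A → ℝ) (hπhat : IsCEMinimizer pols πhat)
    -- the true population target
    (q₁s q₂s : S × A → ℝ) (hs : M.IsTransferTarget M.πb q₁s q₂s)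
    -- the conditions of the global bounds that are common to both estimators, for the plug-in
    -- population system with target `(q₁t, q₂t)`
    (c : Constants) (Q₁ Q₂ L₂ : Finset (S × A → ℝ)) (henv : M.Envelope c Q₁ Q₂ L₂)
    (q₁t q₂t : Ω → S × A → ℝ)
    (hsys : ∀ᵐ ω ∂Pr, M.SystemConditions c Q₁ Q₂ (πhat (Db ω)) (q₁t ω) (q₂t ω))
    -- coverage
    (hκ₁ : densityNorm (occupancy M.γ₁ M.P₁ M.μ M.ρ₁) M.ρ₁ ≤ ENNReal.ofReal c.κ₁)
    (κpath : ℝ) (hpath : ∀ᵐ ω ∂Pr, M.PathConcentrability q₂s (q₂t ω) κpath)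
    (hχ : M.chi ≠ ⊤) (hκμ : M.kappaMu ≠ ⊤) :
    -- modular estimator
    (∀ (εb : ℝ) (L₁ : Finset (S × A → ℝ)) (κpathMod : ℝ)
      (q₁hat : (Fin nb → S × A) × (Fin n₁ → (S × A) × S) → S × A → ℝ)
      (q₂plug q₂hat l₁hat l₂hat : Ω → S × A → ℝ),
      0 < εb → M.kappaMu ≤ ENNReal.ofReal (1 / εb) →
      (∀ l ∈ L₁, Measurable l ∧ ∀ x, |l x| ≤ M.BL₁mod c) →
      -- realizability of the source and target dual variables of the plug-in system
      (∀ᵐ ω ∂Pr, (∃ l₁ ∈ L₁, M.IsModularSourceDual (q₁t ω) l₁) ∧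
        ∃ l₂ ∈ L₂, M.IsTargetDual (q₂t ω) l₂) →
      -- the two stages
      (∀ q ∈ Q₁, MeasurableSet {d | q₁hat d = q}) →
      (∀ ω, M.IsModularStage1 (D₁ ω) (M.signal (πhat (Db ω))) Q₁ L₁
        (q₁hat (Db ω, D₁ ω)) (l₁hat ω)) →
      (∀ ω, M.IsModularStage2 (D₂ ω) (q₁hat (Db ω, D₁ ω)) Q₂ L₂ (q₂hat ω) (l₂hat ω)) →
      -- the second-stage population problem is realizable, with pathwise concentrability
      (∀ᵐ ω ∂Pr, M.IsTargetValue (q₁hat (Db ω, D₁ ω)) (q₂plug ω) ∧ q₂plug ω ∈ Q₂ ∧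
        (∃ l₂ ∈ L₂, M.IsTargetDual (q₂plug ω) l₂) ∧
        M.PathConcentrability (q₂t ω) (q₂plug ω) κpathMod) →
      Pr {ω | ¬ l2norm M.ρ₂ (fun x => q₂hat ω x - q₂s x) ≤
          Real.sqrt (M.Bmod c κpathMod εb (Q₁.card * L₁.card) (Q₂.card * L₂.card) n₁ n₂ δ) +
            M.learningTerm c.κ₁ κpath ε pols.card nb δ} ≤ ENNReal.ofReal δ) ∧
    -- coupled estimator, with source weight `β = 0`
    (∀ (L₁ : Finset (S × A → ℝ)) (qhat lhat : Ω → (S × A → ℝ) × (S × A → ℝ)),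
      (∀ l ∈ L₁, Measurable l ∧ ∀ x, |l x| ≤ c.BL12) →
      (∀ᵐ ω ∂Pr, ∃ l₂ ∈ L₂, M.IsTargetDual (q₂t ω) l₂ ∧
        ∃ l₁ ∈ L₁, M.IsCoupledSourceDual l₂ l₁) →
      (∀ ω, M.IsCoupled 0 (D₁ ω) (D₂ ω) (M.signal (πhat (Db ω))) Q₁ Q₂ L₁ L₂
        (qhat ω) (lhat ω)) →
      Pr {ω | ¬ l2norm M.ρ₂ (fun x => (qhat ω).2 x - q₂s x) ≤
          Real.sqrt (M.Bcoup c (Q₁.card * L₁.card) (Q₁.card * Q₂.card * L₂.card) n₁ n₂ δ) +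
            M.learningTerm c.κ₁ κpath ε pols.card nb δ} ≤ ENNReal.ofReal δ) ∧
    -- the simplified policy-learning term
    (∀ εb : ℝ, 0 < εb → M.kappaMu ≤ ENNReal.ofReal (1 / εb) →
      M.learningTerm c.κ₁ κpath ε pols.card nb δ ≤
        2 * Real.sqrt (c.κ₁ * κpath * M.chi.toReal) /
            (Real.sqrt εb * (1 - M.γ₁) * (1 - M.γ₂)) *
          Real.sqrt (2 / ε * epsCE ε pols.card nb δ)) := by
  have hb := hclip _ hreal
  refine ⟨?_, ?_, ?_⟩
  · intro εb L₁ κpathMod q₁hat q₂plug q₂hat l₁hat l₂hat hεb hκεb hL₁ hdual hmeas hst₁ hst₂ hplug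
    exact Model.modular_bound Pr hnb hn₁ hn₂ hD hδ₀ hδ₁ hpols hreal hε₀ hε₁ hclip hπhat hs henv hsys
      hκ₁ hpath hχ hεb hκεb hL₁ (hdual.mono fun _ h => h.1) hmeas hst₁ hst₂ hplug
  · intro L₁ qhat lhat hL₁ hdual hhat
    exact Model.coupled_bound Pr hnb hn₁ hn₂ hD hδ₀ hδ₁ hpols hreal hε₀ hε₁ hclip hπhat hs henv hsys
      hκ₁ hpath hχ hκμ hL₁ hdual hhat
  · intro εb hεb hκεb
    exact Model.learningTerm_le hε₀ hb hεb hκεb _ _ _ _ _
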